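/- Let $n\ge 2$, let $\Omega\subset\mathbb R^n$ be open and bounded, $T>0$, $\Omega_T:=\Omega\times(0,T)$, $\mu\in[0,1]$, and let $p,q,\alpha,\beta$ be real numbers with $2\le p\le q$, $\alpha,\beta>1$ and $$q<p\,\frac{\alpha}{\alpha+1}\,\frac{\beta-1}{\beta}+\frac{2}{n+2}.$$ Put $p_\alpha:=\frac{p\alpha}{\alpha+1}$, $q_\beta:=\frac{q\beta}{\beta-1}$ and $m:=\frac{p_\alpha(n+2)}{n}$. Let $\mathcal A:\Omega_T\times\mathbb R^n\to\mathbb R^n$ be a Carathéodory function such that, for a.e. $(x,t)\in\Omega_T$ and all $\xi\in\mathbb R^n$, $$|\mathcal A(x,t,\xi)|\le b(x,t)(\mu^2+|\xi|^2)^{\frac{q-1}{2}},\qquad \langle\mathcal A(x,t,\xi),\xi\rangle\ge a(x,t)(\mu^2+|\xi|^2)^{\frac{p-2}{2}}|\xi|^2,$$ where $a,b:\Omega_T\to[0,\infty)$ satisfy $a^{-1}\in L^\alpha(\Omega_T)$ (in particular $a>0$ a.e.) and $b\in L^\beta(\Omega_T)$. Let $u\in L^{q_\beta}(0,T;W^{1,q_\beta}(\Omega))\cap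 C_w([0,T];L^2(\Omega))$ be a weak subsolution of $\partial_tu-\operatorname{div}\mathcal A(x,t,Du)=0$ in $\Omega_T$, that is, $$\int_{\Omega_T}\big(-u\,\partial_t\varphi+\langle\mathcal A(x,t,Du),D\varphi\rangle\big)\,dx\,dt\le 0\qquad\text{for every } \varphi\in C_0^\infty(\Omega_T),\ \varphi\ge 0;$$ here $C_w([0,T];L^2(\Omega))$ is the space of bounded maps $[0,T]\to L^2(\Omega)$ that are continuous with respect to the weak topology of $L^2(\Omega)$. For $z_o=(x_o,t_o)$ write $Q_{\rho,\sigma}(z_o):=B_\rho(x_o)\times(t_o-\sigma,t_o)$. Let $\rho,\sigma>0$ and let $Q:=Q_{2\rho,2\sigma}(z_o)\subset\Omega_T$ have positive distance from the parabolic boundary $(\overline\Omega\times\{0\})\cup(\partial\Omega\times(0,T])$. Then $u_+^m$ is integrable on $Q$, $u$ is essentially bounded from above on $\frac12Q:=Q_{\rho,\sigma}(z_o)$, and, with mean integrals denoted by $\fint$, $$\operatorname*{ess\,sup}_{\frac12Q}u\le C_{a,b}\max\left\{\Big(\frac{\sigma}{\rho^{\frac{p}{p+1-q}}}\Big)^{\vartheta_1}\frac{1}{\rho^{(q-p)\vartheta_2}}\Big(\fint_Q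 u_+^m\,dz\Big)^{\vartheta_3},\ \Big(\fint_Q u_+^m\,dz\Big)^{\frac1m},\ \Big(\frac{\rho^{\frac{p}{p+1-q}}}{\sigma}\Big)^{\frac{p+1-q}{p-2+2(q-p)}},\ \rho\right\}.$$ The constants $\vartheta_1,\vartheta_2,\vartheta_3>0$ depend only on $n,p,q,\alpha,\beta$, and the constant $C_{a,b}>0$ depends only on $n,p,q,\alpha,\beta$ and on $\fint_Qa^{-\alpha}\,dz$ and $\fint_Qb^{\beta}\,dz$. If $p=q=2$, the exponent $\frac{p+1-q}{p-2+2(q-p)}=\frac10$ is read as $+\infty$, with $x^{\infty}:=\lim_{s\to\infty}x^s\in\{0,1,\infty\}$ for $x>0$. -/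

import Mathlib

open MeasureTheory Set
open scoped ENNReal ContDiff

noncomputable section

namespace ParabolicPQ

/-- Euclidean space `ℝⁿ`. -/
abbrev E (n : ℕ) := EuclideanSpace ℝ (Fin n)

/-- The space-time cylinder `Ω_T = Ω × (0,T)`. -/
def spaceTime {n : ℕ} (Ω : Set (E n)) (T : ℝ) : Set (E n × ℝ) :=
  Ω ×ˢ Ioo 0 T

/-- The parabolic boundary `(closure Ω × {0}) ∪ (∂Ω × (0,T])` of `Ω_T`. -/
def parBoundary {n : ℕ} (Ω : Set (E n)) (T : ℝ) : Set (E n × ℝ) :=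
  (closure Ω ×ˢ {0}) ∪ (frontier Ω ×ˢ Ioc 0 T)

/-- The backward cylinder `Q_{ρ,σ}(z₀) = B_ρ(x₀) × (t₀ - σ, t₀)`. -/
def cyl {n : ℕ} (z₀ : E n × ℝ) (ρ σ : ℝ) : Set (E n × ℝ) :=
  Metric.ball z₀.1 ρ ×ˢ Ioo (z₀.2 - σ) z₀.2

/-- `v ∈ W^{1,r}(Ω)` with weak gradient `G`. -/
structure MemSobolev {n : ℕ} (Ω : Set (E n)) (r : ℝ) (v : E n → ℝ) (G : E n → E n) : Prop where
  memLp : MemLp v (ENNReal.ofReal r) (volume.restrict Ω)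
  memLp_grad : MemLp G (ENNReal.ofReal r) (volume.restrict Ω)
  integral_eq : ∀ φ : E n → ℝ, ContDiff ℝ ∞ φ → HasCompactSupport φ → tsupport φ ⊆ Ω →
    ∫ x in Ω, v x • gradient φ x = - ∫ x in Ω, φ x • G x

/-- `u ∈ L^r(0,T; W^{1,r}(Ω))` with spatial weak gradient `Du`: both functions belong to
`L^r(Ω_T)` and almost every time slice of `u` is in `W^{1,r}(Ω)` with gradient the slice of `Du`. -/
structure MemBochnerSobolev {n : ℕ} (Ω : Set (E n)) (T r : ℝ)
    (u : E n × ℝ → ℝ) (Du : E n × ℝ → E n) : Prop where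
  memLp : MemLp u (ENNReal.ofReal r) (volume.restrict (spaceTime Ω T))
  memLp_grad : MemLp Du (ENNReal.ofReal r) (volume.restrict (spaceTime Ω T))
  slice : ∀ᵐ t ∂(volume.restrict (Ioo 0 T)),
    MemSobolev Ω r (fun x => u (x, t)) (fun x => Du (x, t))

/-- `u ∈ C_w([0,T]; L²(Ω))`: up to a null set of times, `u` is given by a bounded map
`[0,T] → L²(Ω)` that is continuous for the weak topology of `L²(Ω)`. -/
def MemCw {n : ℕ} (Ω : Set (E n)) (T : ℝ) (u : E n × ℝ → ℝ) : Prop :=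
  ∃ v : ℝ → Lp ℝ 2 (volume.restrict Ω),
    (∃ M : ℝ, ∀ t ∈ Icc 0 T, ‖v t‖ ≤ M) ∧
    (∀ w : Lp ℝ 2 (volume.restrict Ω), ContinuousOn (fun t => inner ℝ w (v t)) (Icc 0 T)) ∧
    ∀ᵐ t ∂(volume.restrict (Ioo 0 T)), (fun x => u (x, t)) =ᵐ[volume.restrict Ω] v t

/-- `u ∈ L^r(0,T; W^{1,r}(Ω)) ∩ C_w([0,T]; L²(Ω))` is a weak subsolution of
`∂ₜu - div 𝒜(x,t,Du) = 0` in `Ω_T`. -/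
def IsWeakSubsolution {n : ℕ} (Ω : Set (E n)) (T r : ℝ)
    (𝒜 : E n × ℝ → E n → E n) (u : E n × ℝ → ℝ) : Prop :=
  ∃ Du : E n × ℝ → E n, MemBochnerSobolev Ω T r u Du ∧ MemCw Ω T u ∧
    ∀ φ : E n × ℝ → ℝ, ContDiff ℝ ∞ φ → HasCompactSupport φ → tsupport φ ⊆ spaceTime Ω T →
      (∀ z, 0 ≤ φ z) →
      ∫ z in spaceTime Ω T,
        (-(u z * deriv (fun s => φ (z.1, s)) z.2)
          + inner ℝ (𝒜 z (Du z)) (gradient (fun y => φ (y, z.2)) z.1)) ≤ 0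

/-- `𝒜` is a Carathéodory function on `Ω_T × ℝⁿ`. -/
structure IsCaratheodory {n : ℕ} (Ω : Set (E n)) (T : ℝ) (𝒜 : E n × ℝ → E n → E n) : Prop where
  measurable : ∀ ξ, AEStronglyMeasurable (fun z => 𝒜 z ξ) (volume.restrict (spaceTime Ω T))
  continuous : ∀ᵐ z ∂(volume.restrict (spaceTime Ω T)), Continuous (𝒜 z)

/-- The `p,q`-growth conditions with coefficients `a`, `b`, where `a⁻¹ ∈ L^α(Ω_T)` and
`b ∈ L^β(Ω_T)`. Since `1/a = ∞` where `a = 0`, the condition `a⁻¹ ∈ L^α` entails `a > 0` a.e.,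
which has to be said separately because `0⁻¹ = 0` for real numbers here. -/
structure HasPQGrowth {n : ℕ} (Ω : Set (E n)) (T p q α β μ : ℝ)
    (a b : E n × ℝ → ℝ) (𝒜 : E n × ℝ → E n → E n) : Prop where
  growth : ∀ᵐ z ∂(volume.restrict (spaceTime Ω T)), ∀ ξ,
    ‖𝒜 z ξ‖ ≤ b z * (μ ^ 2 + ‖ξ‖ ^ 2) ^ ((q - 1) / 2)
  coercive : ∀ᵐ z ∂(volume.restrict (spaceTime Ω T)), ∀ ξ,
    a z * (μ ^ 2 + ‖ξ‖ ^ 2) ^ ((p - 2) / 2) * ‖ξ‖ ^ 2 ≤ inner ℝ (𝒜 z ξ) ξ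
  a_pos : ∀ᵐ z ∂(volume.restrict (spaceTime Ω T)), 0 < a z
  b_nonneg : ∀ᵐ z ∂(volume.restrict (spaceTime Ω T)), 0 ≤ b z
  memLp_a_inv : MemLp (fun z => (a z)⁻¹) (ENNReal.ofReal α) (volume.restrict (spaceTime Ω T))
  memLp_b : MemLp b (ENNReal.ofReal β) (volume.restrict (spaceTime Ω T))

/-- The scaling term `(ρ^{p/(p+1-q)} / σ)^{(p+1-q)/(p-2+2(q-p))}`. For `p = q = 2` the outer
exponent is `1/0`, read as `+∞`, and `x^∞` is the limit of `x^s` as `s → ∞`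
(`0`, `1` or `∞` for `x < 1`, `x = 1`, `x > 1`), where `x = ρ² / σ`. -/
def scaleTerm (p q ρ σ : ℝ) : EReal :=
  if p = 2 ∧ q = 2 then
    if ρ ^ 2 < σ then 0 else if ρ ^ 2 = σ then 1 else ⊤
  else
    (((ρ ^ (p / (p + 1 - q)) / σ) ^ ((p + 1 - q) / (p - 2 + 2 * (q - p))) : ℝ) : EReal)

/-- `p_α = pα/(α+1)`. -/
def pExp (p α : ℝ) : ℝ := p * α / (α + 1)

/-- `q_β = qβ/(β-1)`. -/
def qExp (q β : ℝ) : ℝ := q * β / (β - 1)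

/-- `m = p_α (n+2)/n`. -/
def mExp (n : ℕ) (p α : ℝ) : ℝ := pExp p α * (n + 2) / n

/-- The mean integral of `u_+^m` over `Q`. -/
def meanPos {n : ℕ} (Q : Set (E n × ℝ)) (m : ℝ) (u : E n × ℝ → ℝ) : ℝ :=
  ⨍ z in Q, max (u z) 0 ^ m

/-- The essential supremum of `u` over `Q`, as an extended real number. -/
def essSupOn {n : ℕ} (Q : Set (E n × ℝ)) (u : E n × ℝ → ℝ) : EReal :=
  essSup (fun z => (u z : EReal)) (volume.restrict Q)

end ParabolicPQ

end

open Filter Topology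
open scoped Convolution

/-! The proof is De Giorgi's iteration for the truncations (u - k)₊. Write G = Du and V = 𝒜(z, Du),
so that a|G|^p ≤ ⟨V, G⟩ and |V| ≤ b(1 + |G|)^(q-1). Testing with a cutoff φ times (u - k)₊ yields a
quantity R that controls both the L² norms of the cut-off truncations on time slices and the
integral of φ⟨V, G⟩ over {u > k}; it is itself bounded by ∫ |∂ₜφ| (u - k)₊² and ∫ |∇φ| (u - k)₊ |V|.
Since a⁻¹ ∈ L^α, Hölder's inequality turns the energy into a bound for |G| in L^(p_α), and the
parabolic Gagliardo-Nirenberg inequality `lintegral_rpow_le_gnConst` with exponent p_α gains the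
power m.

The obstruction is that the flux grows like |G|^(q-1) while the energy sees only |G|^p. The spatial
cutoff is therefore a power π = p/(p+1-q), for which |∇φ| ≤ Lφ^(1-1/π) and 1 - 1/π = (q-1)/p: this
is the weight needed to bound the flux term by R^((q-1)/p) (`energy_level_le`). As (q-1)/p < 1 the
power of R is absorbed, at the price of raising its coefficient to the power π, which produces the
factor (k/ρ)^π (`energy_numeric`).

On cylinders shrinking from 2ρ, 2σ to ρ, σ and levels rising from 0 to k, the normalized integrals
y_j of (u - k_j)₊^m / k^m satisfy y_(j+1) ≤ K b^j y_j^(1+ε). The gap condition on q says exactly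
that p_α times the complementary Hölder exponent `compExp` exceeds n/(n+2). It gives ε > 0 and, more
strongly, that K y_0^ε tends to 0 as k grows (`Admissible.levelExp_mul_lt_iterExp`). Solving the
smallness condition of `tendsto_zero_of_le_mul_rpow` for k gives the first term of the maximum. The
others express y_0 ≤ 1, k²/σ ≤ (k/ρ)^π, so that the time derivative of the cutoff costs no more than
the spatial one, and ρ ≤ k.

The testing is made rigorous by mollifying u, G, V in space-time: the choice of q_β puts V in the
space dual to that of u and G. The right-hand sides converge by dominated convergence with varying
majorants, the Gagliardo-Nirenberg left-hand side is handled by Fatou's lemma, and afterwards the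
smooth truncation is removed. -/

namespace ParabolicPQ

/-! ### Dominated convergence with varying majorants -/

/-- Dominated convergence for nonnegative functions with varying majorants of constant integral. -/
theorem tendsto_lintegral_of_le_of_lintegral_eq {X : Type*} [MeasurableSpace X] {ν : Measure X}
    {f g : ℕ → X → ℝ≥0∞} {F G : X → ℝ≥0∞}
    (hf : ∀ N, AEMeasurable (f N) ν) (hg : ∀ N, AEMeasurable (g N) ν)
    (hfg : ∀ᶠ N in atTop, ∀ᵐ x ∂ν, f N x ≤ g N x)
    (hfF : ∀ᵐ x ∂ν, Tendsto (fun N => f N x) atTop (𝓝 (F x)))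
    (hgG : ∀ᵐ x ∂ν, Tendsto (fun N => g N x) atTop (𝓝 (G x)))
    (hI : ∀ᶠ N in atTop, ∫⁻ x, g N x ∂ν = ∫⁻ x, G x ∂ν) (hG : ∫⁻ x, G x ∂ν ≠ ⊤) :
    Tendsto (fun N => ∫⁻ x, f N x ∂ν) atTop (𝓝 (∫⁻ x, F x ∂ν)) := by
  have hFm : AEMeasurable F ν := aemeasurable_of_tendsto_metrizable_ae atTop hf hfF
  have hGm : AEMeasurable G ν := aemeasurable_of_tendsto_metrizable_ae atTop hg hgG
  obtain ⟨N₀, hN₀⟩ := eventually_atTop.1 hfg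
  have hFG : ∀ᵐ x ∂ν, F x ≤ G x := by
    have h : ∀ᵐ x ∂ν, ∀ N, N₀ ≤ N → f N x ≤ g N x := by
      rw [ae_all_iff]; intro N
      by_cases h : N₀ ≤ N
      · filter_upwards [hN₀ N h] with x hx _ using hx
      · exact ae_of_all _ fun x h' => (h h').elim
    filter_upwards [h, hfF, hgG] with x h1 h2 h3
    exact le_of_tendsto_of_tendsto h2 h3 (eventually_atTop.2 ⟨N₀, fun N hN => h1 N hN⟩)
  have hGfin : ∀ᵐ x ∂ν, G x < ⊤ := ae_lt_top' hGm hG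
  have hF : ∫⁻ x, F x ∂ν ≠ ⊤ := ((lintegral_mono_ae hFG).trans_lt hG.lt_top).ne
  refine tendsto_of_le_liminf_of_limsup_le ?_ ?_
  · calc ∫⁻ x, F x ∂ν = ∫⁻ x, liminf (fun N => f N x) atTop ∂ν :=
          lintegral_congr_ae (hfF.mono fun x hx => hx.liminf_eq.symm)
      _ ≤ _ := lintegral_liminf_le' hf
  -- Fatou's lemma for the nonnegative differences g - f gives the upper bound: ∫ g is eventually
  -- the finite constant ∫ G and can be cancelled.
  · have key : ∫⁻ x, (G x - F x) ∂ν ≤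
        liminf (fun N => ∫⁻ x, (g N x - f N x) ∂ν) atTop := by
      calc ∫⁻ x, (G x - F x) ∂ν = ∫⁻ x, liminf (fun N => g N x - f N x) atTop ∂ν := by
            refine lintegral_congr_ae ?_
            filter_upwards [hfF, hgG, hGfin] with x h1 h2 h3
            exact (ENNReal.Tendsto.sub h2 h1 (Or.inl h3.ne)).liminf_eq.symm
        _ ≤ _ := lintegral_liminf_le' fun N => (hg N).sub (hf N)
    have hev : ∀ᶠ N in atTop, ∫⁻ x, (g N x - f N x) ∂ν
        = ∫⁻ x, G x ∂ν - ∫⁻ x, f N x ∂ν := by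
      filter_upwards [hfg, hI] with N h1 h2
      rw [lintegral_sub' (hf N) _ h1, h2]
      exact ((lintegral_mono_ae h1).trans_lt (h2 ▸ hG.lt_top)).ne
    rw [liminf_congr hev, lintegral_sub' hFm hF hFG] at key
    rw [ENNReal.liminf_const_sub _ _ hG] at key
    have h1 : limsup (fun N => ∫⁻ x, f N x ∂ν) atTop ≤ ∫⁻ x, G x ∂ν := by
      refine limsup_le_of_le (by isBoundedDefault) ?_
      filter_upwards [hfg, hI] with N h1 h2
      exact h2 ▸ lintegral_mono_ae h1
    exact (ENNReal.sub_le_sub_iff_left h1 hG).1 key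

/-! ### Mollification by bump functions -/

section Mollification

variable {X : Type*} [NormedAddCommGroup X] [NormedSpace ℝ X] [FiniteDimensional ℝ X]
  [MeasureSpace X] [BorelSpace X] [(volume : Measure X).IsAddHaarMeasure]
  {F : Type*} [NormedAddCommGroup F] [NormedSpace ℝ F]

/-- The convolution of `f` with the normalized bump function `B`. -/
noncomputable def moll (B : ContDiffBump (0 : X)) (f : X → F) : X → F :=
  B.normed volume ⋆[ContinuousLinearMap.lsmul ℝ ℝ, volume] f

theorem moll_apply (B : ContDiffBump (0 : X)) (f : X → F) (z : X) :
    moll B f z = ∫ w, B.normed volume (z - w) • f w := by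
  simp [moll, convolution_eq_swap]

theorem integral_normed_sub (B : ContDiffBump (0 : X)) (z : X) :
    ∫ w, B.normed volume (z - w) = 1 := by
  rw [integral_sub_left_eq_self (fun w => B.normed volume w) volume z, B.integral_normed]

theorem contDiff_moll (B : ContDiffBump (0 : X)) {f : X → F} (hf : LocallyIntegrable f)
    [CompleteSpace F] : ContDiff ℝ ∞ (moll B f) :=
  B.hasCompactSupport_normed.contDiff_convolution_left _ B.contDiff_normed hf

theorem integrable_normed_sub_smul (B : ContDiffBump (0 : X)) {f : X → F}
    (hf : LocallyIntegrable f) (z : X) :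
    Integrable fun w => B.normed volume (z - w) • f w := by
  have := (B.hasCompactSupport_normed (μ := volume)).convolutionExists_left
    (ContinuousLinearMap.lsmul ℝ ℝ) B.continuous_normed hf z
  simpa using this.integrable_swap

theorem fderiv_moll [CompleteSpace F] (B : ContDiffBump (0 : X)) {f : X → F}
    (hf : LocallyIntegrable f) (z v : X) :
    fderiv ℝ (moll B f) z v = ∫ w, fderiv ℝ (B.normed volume) (z - w) v • f w := by
  have hC : ContDiff ℝ 1 (B.normed (volume : Measure X)) := B.contDiff_normed
  have h := (B.hasCompactSupport_normed (μ := volume)).hasFDerivAt_convolution_left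
    (ContinuousLinearMap.lsmul ℝ ℝ) hC hf z
  have hex := ((B.hasCompactSupport_normed (μ := volume)).fderiv ℝ).convolutionExists_left
    ((ContinuousLinearMap.lsmul ℝ ℝ : ℝ →L[ℝ] F →L[ℝ] F).precompL X)
    (hC.continuous_fderiv one_ne_zero) hf z
  rw [moll, h.fderiv, convolution_eq_swap, ContinuousLinearMap.integral_apply hex.integrable_swap]
  simp [ContinuousLinearMap.precompL_apply]

/-- Jensen's inequality for mollifications. -/
theorem norm_moll_rpow_le (B : ContDiffBump (0 : X)) {f : X → F} {s : ℝ} (hs : 1 ≤ s)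
    (hf : LocallyIntegrable f) (hfs : LocallyIntegrable fun w => ‖f w‖ ^ s) (z : X) :
    ‖moll B f z‖ ^ s ≤ moll B (fun w => ‖f w‖ ^ s) z := by
  set b : X → ℝ := fun w => B.normed volume (z - w) with hb
  have hb0 : ∀ w, 0 ≤ b w := fun w => B.nonneg_normed _
  have hbc : Continuous b := B.continuous_normed.comp (by fun_prop)
  -- The translated kernel is the density of a probability measure, so Jensen's inequality for the
  -- convex power s applies.
  set ν : Measure X := volume.withDensity fun w => ENNReal.ofReal (b w) with hν
  have hbi : Integrable b := by
    simpa using integrable_normed_sub_smul B (f := fun _ : X => (1 : ℝ))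
      (locallyIntegrable_const _) z
  have hint : ∀ (g : X → ℝ), ∫ w, g w ∂ν = ∫ w, b w * g w := by
    intro g
    rw [hν, integral_withDensity_eq_integral_toReal_smul (by fun_prop) (by simp)]
    simp [ENNReal.toReal_ofReal (hb0 _)]
  have hintb : ∀ (g : X → ℝ), Integrable (fun w => b w * g w) → Integrable g ν := by
    intro g hg
    rw [hν, integrable_withDensity_iff_integrable_smul' (by fun_prop) (by simp)]
    simpa [ENNReal.toReal_ofReal (hb0 _)] using hg
  have : IsProbabilityMeasure ν := by
    constructor
    rw [hν, withDensity_apply _ MeasurableSet.univ, setLIntegral_univ,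
      ← ofReal_integral_eq_lintegral_ofReal hbi (ae_of_all _ hb0), integral_normed_sub B z]
    simp
  have h1 : ‖moll B f z‖ ≤ ∫ w, ‖f w‖ ∂ν := by
    rw [moll_apply, hint]
    refine (norm_integral_le_integral_norm _).trans (le_of_eq ?_)
    refine integral_congr_ae (ae_of_all _ fun w => ?_)
    change ‖b w • f w‖ = b w * ‖f w‖
    rw [norm_smul, Real.norm_of_nonneg (hb0 w)]
  have h2 : (∫ w, ‖f w‖ ∂ν) ^ s ≤ ∫ w, ‖f w‖ ^ s ∂ν := by
    have hc := (convexOn_rpow hs)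
    refine hc.map_integral_le (f := fun w => ‖f w‖)
      (continuousOn_id.rpow_const fun x _ => Or.inr (by linarith)) isClosed_Ici
      (ae_of_all _ fun w => norm_nonneg _) (hintb _ ?_) (hintb _ ?_)
    · refine (integrable_normed_sub_smul B hf z).norm.congr (ae_of_all _ fun w => ?_)
      change ‖b w • f w‖ = b w * ‖f w‖
      rw [norm_smul, Real.norm_of_nonneg (hb0 w)]
    · simpa using (integrable_normed_sub_smul B hfs z)
  calc ‖moll B f z‖ ^ s ≤ (∫ w, ‖f w‖ ∂ν) ^ s := by gcongr
    _ ≤ _ := h2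
    _ = _ := by rw [hint, moll_apply]; rfl

theorem moll_nonneg (B : ContDiffBump (0 : X)) {f : X → ℝ} (hf : ∀ z, 0 ≤ f z) (z : X) :
    0 ≤ moll B f z := by
  rw [moll_apply]
  exact integral_nonneg fun w => mul_nonneg (B.nonneg_normed _) (hf w)

/-- The kernel has mass one. This is why the majorants produced by Jensen's inequality all have the
same integral, as `tendsto_lintegral_of_le_of_lintegral_eq` requires. -/
theorem lintegral_moll (B : ContDiffBump (0 : X)) {f : X → ℝ} (hf : ∀ z, 0 ≤ f z)
    (hfi : Integrable f) :
    ∫⁻ z, ENNReal.ofReal (moll B f z) = ∫⁻ z, ENNReal.ofReal (f z) := by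
  rw [← ofReal_integral_eq_lintegral_ofReal _ (ae_of_all _ (moll_nonneg B hf)),
    ← ofReal_integral_eq_lintegral_ofReal hfi (ae_of_all _ hf)]
  · congr 1
    have := integral_convolution (ContinuousLinearMap.lsmul ℝ ℝ) (μ := (volume : Measure X))
      (B.integrable_normed (μ := (volume : Measure X))) hfi
    rw [B.integral_normed] at this
    simpa [moll] using this
  · exact (B.integrable_normed (μ := (volume : Measure X))).integrable_convolution _ hfi

/-- A sequence of bump functions shrinking to the origin. -/
noncomputable def bumpSeq (X : Type*) [NormedAddCommGroup X] [NormedSpace ℝ X] (N : ℕ) :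
    ContDiffBump (0 : X) where
  rIn := 1 / (2 * ((N : ℝ) + 1))
  rOut := 1 / ((N : ℝ) + 1)
  rIn_pos := by positivity
  rIn_lt_rOut := by
    apply one_div_lt_one_div_of_lt (by positivity)
    have : (0 : ℝ) ≤ N := by positivity
    linarith

theorem tendsto_bumpSeq_rOut (X : Type*) [NormedAddCommGroup X] [NormedSpace ℝ X] : Tendsto (fun N => (bumpSeq X N).rOut) atTop (𝓝 0) :=
  tendsto_one_div_add_atTop_nhds_zero_nat

theorem ae_tendsto_moll [CompleteSpace F] {f : X → F} (hf : LocallyIntegrable f) :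
    ∀ᵐ z, Tendsto (fun N => moll (bumpSeq X N) f z) atTop (𝓝 (f z)) := by
  -- Lebesgue differentiation needs a bounded ratio of outer and inner radius; for `bumpSeq` it is
  -- always 2.
  refine ContDiffBump.ae_convolution_tendsto_right_of_locallyIntegrable (K := 2)
    (tendsto_bumpSeq_rOut X) (Eventually.of_forall fun N => ?_) hf
  have : (0 : ℝ) < N + 1 := by positivity
  simp only [bumpSeq]
  apply le_of_eq; field_simp

end Mollification

end ParabolicPQ

/-! ### The parabolic Gagliardo-Nirenberg inequality -/

namespace ParabolicPQ

/-- The constant in the parabolic Gagliardo-Nirenberg inequality. -/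
noncomputable def gnConst (n : ℕ) (p : ℝ) : ℝ≥0∞ :=
  (eLpNormLESNormFDerivOneConst (volume : Measure (E n))
    ((((n : ℝ) / (n - 1)).toNNReal : NNReal) : ℝ) *
    ENNReal.ofReal (1 + (n + 2) * (p - 1) / n)) ^ p

theorem gnConst_ne_top (n : ℕ) {p : ℝ} (hp : 0 ≤ p) : gnConst n p ≠ ⊤ :=
  ENNReal.rpow_ne_top_of_nonneg hp (ENNReal.mul_ne_top ENNReal.coe_ne_top ENNReal.ofReal_ne_top)

/-- The Gagliardo-Nirenberg inequality with the parabolic exponent `p (n + 2) / n`. -/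
theorem lintegral_rpow_le_gnConst {n : ℕ} (hn : 2 ≤ n) {p : ℝ} (hp : 1 < p)
    {v : E n → ℝ} (hv : ContDiff ℝ 1 v) (hvc : HasCompactSupport v)
    (hv0 : ∀ x, 0 ≤ v x) :
    ∫⁻ x, ENNReal.ofReal (v x) ^ (p * (n + 2) / n) ≤
      gnConst n p * (∫⁻ x, ENNReal.ofReal (v x) ^ (2 : ℝ)) ^ (p / n) *
        ∫⁻ x, ‖fderiv ℝ v x‖ₑ ^ p := by
  have hn' : (2 : ℝ) ≤ n := by exact_mod_cast hn
  have hn0 : (0 : ℝ) < n := by linarith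
  have hn1 : (0 : ℝ) < n - 1 := by linarith
  have hp0 : 0 < p := by linarith
  set m : ℝ := p * (n + 2) / n with hm
  have hm0 : 0 < m := by positivity
  set γ : ℝ := 1 + (n + 2) * (p - 1) / n with hγ
  have hγ1 : 1 < γ := by
    have : 0 < ((n : ℝ) + 2) * (p - 1) / n := by
      have : 0 < p - 1 := by linarith
      positivity
    linarith
  set P : NNReal := ((n : ℝ) / (n - 1)).toNNReal with hP
  have hPr : (P : ℝ) = n / (n - 1) := Real.coe_toNNReal _ (by positivity)
  have hconj : NNReal.HolderConjugate (Module.finrank ℝ (E n) : ℕ) P := by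
    rw [finrank_euclideanSpace_fin, ← NNReal.holderConjugate_coe_iff, hPr]
    rw [Real.holderConjugate_iff]
    constructor
    · simp; linarith
    · simp; field_simp; ring
  set V : E n → ℝ≥0∞ := fun x => ENNReal.ofReal (v x) with hV
  have hVm : Measurable V := hv.continuous.measurable.ennreal_ofReal
  set D : E n → ℝ≥0∞ := fun x => ‖fderiv ℝ v x‖ₑ with hD
  have hDm : Measurable D := (hv.continuous_fderiv one_ne_zero).measurable.enorm
  set w : E n → ℝ := fun x => v x ^ γ with hw
  have hwC : ContDiff ℝ 1 w := hv.rpow_const_of_le (by simpa using hγ1.le)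
  have hwc : HasCompactSupport w := hvc.comp_left (g := fun s => s ^ γ) (Real.zero_rpow (by linarith))
  have hwd : ∀ x, ‖fderiv ℝ w x‖ₑ = ENNReal.ofReal γ * (V x ^ (γ - 1) * D x) := by
    intro x
    have h := ((hv.differentiable one_ne_zero) x).hasFDerivAt.rpow_const (p := γ) (Or.inr hγ1.le)
    rw [h.fderiv, enorm_smul, ← mul_assoc]
    congr 1
    rw [Real.enorm_eq_ofReal (by have := hv0 x; positivity), ENNReal.ofReal_mul (by linarith),
      ENNReal.ofReal_rpow_of_nonneg (hv0 x) (by linarith)]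
  have hsob := eLpNorm_le_eLpNorm_fderiv_one (volume : Measure (E n)) hwC hwc hconj
  set C₀ : ℝ≥0∞ := ((eLpNormLESNormFDerivOneConst (volume : Measure (E n)) (P : ℝ) : NNReal) : ℝ≥0∞)
    with hC₀
  set S := ∫⁻ x, V x ^ (2 : ℝ) with hS
  set I := ∫⁻ x, V x ^ m with hI
  set J := ∫⁻ x, D x ^ p with hJ
  -- Finiteness allows division by a power of I in the absorption at the end.
  have hIfin : I ≠ ⊤ := by
    have hc : Continuous fun x => v x ^ m := hv.continuous.rpow_const fun x => Or.inr hm0.le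
    have hi : Integrable fun x => v x ^ m :=
      hc.integrable_of_hasCompactSupport
        (hvc.comp_left (g := fun s => s ^ m) (Real.zero_rpow hm0.ne'))
    have := hi.lintegral_lt_top
    simp only [hI, hV]
    convert this.ne using 3
    rw [ENNReal.ofReal_rpow_of_nonneg (hv0 _) hm0.le]
  -- The Sobolev inequality for W^{1,1}, applied to v^γ, followed by Hölder's inequality on γ
  -- v^(γ-1) |∇v|.
  have h1 : (∫⁻ x, V x ^ (γ * (n / (n - 1)))) ^ (((n : ℝ) - 1) / n) ≤
      C₀ * ENNReal.ofReal γ * (I ^ (1 - 1 / p) * J ^ (1 / p)) := by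
    have hl : eLpNorm w P volume = (∫⁻ x, V x ^ (γ * (n / (n - 1)))) ^ (((n : ℝ) - 1) / n) := by
      have hP0 : P ≠ 0 := by
        have : (0 : ℝ) < P := by rw [hPr]; positivity
        exact_mod_cast this.ne'
      rw [eLpNorm_eq_lintegral_rpow_enorm_toReal (by simpa using hP0) (by simp)]
      simp only [ENNReal.coe_toReal, hPr, one_div_div]
      congr 1
      refine lintegral_congr fun x => ?_
      rw [ENNReal.rpow_mul, hw, Real.enorm_eq_ofReal (Real.rpow_nonneg (hv0 x) _),
        ENNReal.ofReal_rpow_of_nonneg (hv0 x) (by linarith)]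
    rw [← hl]
    refine hsob.trans ?_
    rw [mul_assoc]
    gcongr
    rw [eLpNorm_one_eq_lintegral_enorm]
    simp_rw [hwd]
    rw [lintegral_const_mul _ (by fun_prop)]
    gcongr
    calc ∫⁻ x, V x ^ (γ - 1) * D x = ∫⁻ x, (V x ^ m) ^ (1 - 1 / p) * (D x ^ p) ^ (1 / p) := by
          refine lintegral_congr fun x => ?_
          rw [← ENNReal.rpow_mul, ← ENNReal.rpow_mul, mul_one_div_cancel hp0.ne', ENNReal.rpow_one]
          congr 2
          rw [hγ, hm]; field_simp; ring
      _ ≤ _ := ENNReal.lintegral_mul_norm_pow_le (by fun_prop) (by fun_prop)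
          (by rw [sub_nonneg, div_le_one hp0]; exact hp.le) (by positivity) (by ring)
  -- Interpolation of v^m between v² and v^(γn/(n-1)) with weights 1/n and (n-1)/n.
  have h2 : I ≤ S ^ (1 / (n : ℝ)) *
      (∫⁻ x, V x ^ (γ * (n / (n - 1)))) ^ (((n : ℝ) - 1) / n) := by
    calc I = ∫⁻ x, (V x ^ (2 : ℝ)) ^ (1 / (n : ℝ)) *
          (V x ^ (γ * (n / (n - 1)))) ^ (((n : ℝ) - 1) / n) := by
          refine lintegral_congr fun x => ?_
          rw [← ENNReal.rpow_mul, ← ENNReal.rpow_mul, ← ENNReal.rpow_add_of_nonneg _ _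
            (by positivity) (by positivity)]
          congr 1
          rw [hγ, hm]; field_simp; ring
      _ ≤ _ := ENNReal.lintegral_mul_norm_pow_le (by fun_prop) (by fun_prop)
          (by positivity) (by positivity) (by field_simp; ring)
  have h3 : I ≤ (C₀ * ENNReal.ofReal γ * S ^ (1 / (n : ℝ)) * J ^ (1 / p)) * I ^ (1 - 1 / p) := by
    refine h2.trans ((mul_le_mul_right h1 _).trans (le_of_eq ?_))
    ring
  rcases eq_or_ne I 0 with h0 | h0
  · rw [h0]; exact zero_le
  have h4 : I ^ (1 / p) ≤ C₀ * ENNReal.ofReal γ * S ^ (1 / (n : ℝ)) * J ^ (1 / p) := by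
    have hne0 : I ^ (1 - 1 / p) ≠ 0 := (ENNReal.rpow_pos (pos_iff_ne_zero.2 h0) hIfin).ne'
    have hnet : I ^ (1 - 1 / p) ≠ ⊤ := ENNReal.rpow_ne_top_of_nonneg
      (by rw [sub_nonneg, div_le_one hp0]; exact hp.le) hIfin
    rw [← ENNReal.mul_le_mul_iff_left hne0 hnet]
    rw [← ENNReal.rpow_add _ _ h0 hIfin]
    simpa using h3
  calc I = (I ^ (1 / p)) ^ p := by
        rw [← ENNReal.rpow_mul, one_div_mul_cancel hp0.ne', ENNReal.rpow_one]
    _ ≤ (C₀ * ENNReal.ofReal γ * S ^ (1 / (n : ℝ)) * J ^ (1 / p)) ^ p := by gcongr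
    _ = _ := by
        rw [ENNReal.mul_rpow_of_nonneg _ _ hp0.le, ENNReal.mul_rpow_of_nonneg _ _ hp0.le,
          ← ENNReal.rpow_mul, ← ENNReal.rpow_mul, one_div_mul_cancel hp0.ne', ENNReal.rpow_one]
        congr 3
        ring

end ParabolicPQ

/-! ### Regularized truncations and the energy inequality for smooth functions -/

namespace ParabolicPQ

/-- `H' = h` and `h' = g`, where `h` is a regularization of the truncation `s ↦ (s - k)₊`. -/
structure IsTruncation (k : ℝ) (H h g : ℝ → ℝ) : Prop where
  hasDerivAt_H : ∀ s, HasDerivAt H (h s) s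
  hasDerivAt_h : ∀ s, HasDerivAt h (g s) s
  continuous_g : Continuous g
  g_nonneg : ∀ s, 0 ≤ g s
  g_le_one : ∀ s, g s ≤ 1
  H_eq_zero : ∀ s ≤ k, H s = 0
  h_eq_zero : ∀ s ≤ k, h s = 0
  g_eq_zero : ∀ s ≤ k, g s = 0

namespace IsTruncation

variable {k : ℝ} {H h g : ℝ → ℝ}

theorem continuous_h (T : IsTruncation k H h g) : Continuous h :=
  continuous_iff_continuousAt.2 fun s => (T.hasDerivAt_h s).continuousAt

theorem continuous_H (T : IsTruncation k H h g) : Continuous H :=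
  continuous_iff_continuousAt.2 fun s => (T.hasDerivAt_H s).continuousAt

theorem contDiff_h (T : IsTruncation k H h g) : ContDiff ℝ 1 h := by
  rw [contDiff_one_iff_deriv]
  refine ⟨fun s => (T.hasDerivAt_h s).differentiableAt, ?_⟩
  have : deriv h = g := funext fun s => (T.hasDerivAt_h s).deriv
  rw [this]; exact T.continuous_g

theorem h_nonneg (T : IsTruncation k H h g) (s : ℝ) : 0 ≤ h s := by
  rcases le_total s k with hs | hs
  · exact (T.h_eq_zero s hs).ge
  · have : Monotone h := monotone_of_deriv_nonneg (fun s => (T.hasDerivAt_h s).differentiableAt)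
      fun s => (T.hasDerivAt_h s).deriv ▸ T.g_nonneg s
    exact (T.h_eq_zero k le_rfl) ▸ this hs

theorem H_nonneg (T : IsTruncation k H h g) (s : ℝ) : 0 ≤ H s := by
  rcases le_total s k with hs | hs
  · exact (T.H_eq_zero s hs).ge
  · have : Monotone H := monotone_of_deriv_nonneg (fun s => (T.hasDerivAt_H s).differentiableAt)
      fun s => (T.hasDerivAt_H s).deriv ▸ T.h_nonneg s
    exact (T.H_eq_zero k le_rfl) ▸ this hs

theorem h_le (T : IsTruncation k H h g) (s : ℝ) : h s ≤ max (s - k) 0 := by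
  rcases le_total s k with hs | hs
  · rw [T.h_eq_zero s hs]; exact le_max_right _ _
  · have hd : ∀ s, HasDerivAt (fun s => (s - k) - h s) (1 - g s) s := fun s =>
      ((hasDerivAt_id s).sub_const k).sub (T.hasDerivAt_h s)
    have : Monotone fun s => (s - k) - h s :=
      monotone_of_deriv_nonneg (fun s => (hd s).differentiableAt)
        fun s => (hd s).deriv ▸ sub_nonneg.2 (T.g_le_one s)
    have := this hs
    simp only [sub_self, T.h_eq_zero k le_rfl] at this
    exact le_max_of_le_left (by linarith)

/-- The derivative of 2H - h² is 2h(1 - g) ≥ 0. This turns the energy term ∫ χ H(U) into the L² norm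
that the Gagliardo-Nirenberg inequality needs. -/
theorem sq_h_le (T : IsTruncation k H h g) (s : ℝ) : h s ^ 2 ≤ 2 * H s := by
  rcases le_total s k with hs | hs
  · simp [T.h_eq_zero s hs, T.H_eq_zero s hs]
  · have hd : ∀ s, HasDerivAt (fun s => 2 * H s - h s ^ 2) (2 * h s - 2 * h s * g s) s :=
      fun s => by
        have := ((T.hasDerivAt_H s).const_mul 2).sub ((T.hasDerivAt_h s).pow 2)
        simpa using! this
    have : Monotone fun s => 2 * H s - h s ^ 2 :=
      monotone_of_deriv_nonneg (fun s => (hd s).differentiableAt)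
        fun s => by
          rw [(hd s).deriv]
          nlinarith [T.h_nonneg s, T.g_le_one s]
    have := this hs
    simp only [T.h_eq_zero k le_rfl, T.H_eq_zero k le_rfl] at this
    linarith

theorem H_le (T : IsTruncation k H h g) (s : ℝ) : H s ≤ max (s - k) 0 ^ 2 / 2 := by
  rcases le_total s k with hs | hs
  · rw [T.H_eq_zero s hs]; positivity
  · have hd : ∀ s, HasDerivAt (fun s => (s - k) ^ 2 / 2 - H s) ((s - k) - h s) s := fun s => by
      have := ((((hasDerivAt_id s).sub_const k).pow 2).div_const 2).sub (T.hasDerivAt_H s)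
      simpa using! this
    have : MonotoneOn (fun s => (s - k) ^ 2 / 2 - H s) (Ici k) := by
      refine monotoneOn_of_deriv_nonneg (convex_Ici k)
        (fun s _ => (hd s).continuousAt.continuousWithinAt)
        (fun s _ => (hd s).differentiableAt.differentiableWithinAt) fun s hs => ?_
      rw [interior_Ici] at hs
      rw [(hd s).deriv]
      have := T.h_le s
      rw [max_eq_left (by have := hs.out; linarith)] at this
      linarith
    have := this (mem_Ici.2 le_rfl) (mem_Ici.2 hs) hs
    simp only [sub_self, T.H_eq_zero k le_rfl] at this
    rw [max_eq_left (by linarith)]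
    linarith

end IsTruncation

variable {n : ℕ}

/-- Coordinatewise integration by parts; the compact support of Φ alone removes boundary terms, W
being arbitrary at infinity. -/
theorem integral_mul_divergence {Φ : E n → ℝ} {W : E n → E n} (hΦ : ContDiff ℝ 1 Φ)
    (hΦc : HasCompactSupport Φ) (hW : ContDiff ℝ 1 W) :
    ∫ x, Φ x * ∑ i, fderiv ℝ W x (EuclideanSpace.single i 1) i = -∫ x, fderiv ℝ Φ x (W x) := by
  have hWi : ∀ i, ContDiff ℝ 1 fun x => W x i := fun i => by fun_prop
  have hd : ∀ i x, fderiv ℝ W x (EuclideanSpace.single i 1) i =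
      fderiv ℝ (fun x => W x i) x (EuclideanSpace.single i 1) := by
    intro i x
    have h := (hW.differentiable one_ne_zero x).hasFDerivAt
    have h2 := ((EuclideanSpace.proj i : E n →L[ℝ] ℝ).hasFDerivAt (x := W x)).comp x h
    have h3 : (fun x => W x i) = (EuclideanSpace.proj i : E n →L[ℝ] ℝ) ∘ W := by ext; rfl
    rw [h3, h2.fderiv]; rfl
  have hs : ∀ x, fderiv ℝ Φ x (W x) = ∑ i, fderiv ℝ Φ x (EuclideanSpace.single i 1) * W x i := by
    intro x
    conv_lhs => rw [← (EuclideanSpace.basisFun (Fin n) ℝ).sum_repr (W x)]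
    simp [mul_comm]
  have hc1 : ∀ i, Continuous fun x => fderiv ℝ Φ x (EuclideanSpace.single i 1) := fun i =>
    (hΦ.continuous_fderiv one_ne_zero).clm_apply continuous_const
  have hc2 : ∀ i, Continuous fun x => fderiv ℝ (fun x => W x i) x (EuclideanSpace.single i 1) :=
    fun i => ((hWi i).continuous_fderiv one_ne_zero).clm_apply continuous_const
  have hc3 : ∀ i, Continuous fun x => W x i := fun i => (hWi i).continuous
  have hs1 : ∀ i, HasCompactSupport fun x => fderiv ℝ Φ x (EuclideanSpace.single i 1) := fun i =>
    hΦc.fderiv_apply ℝ _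
  have hI1 : ∀ i, Integrable fun x => fderiv ℝ Φ x (EuclideanSpace.single i 1) * W x i := fun i =>
    ((hc1 i).mul (hc3 i)).integrable_of_hasCompactSupport (hs1 i).mul_right
  have hI2 : ∀ i, Integrable fun x =>
      Φ x * fderiv ℝ (fun x => W x i) x (EuclideanSpace.single i 1) := fun i =>
    (hΦ.continuous.mul (hc2 i)).integrable_of_hasCompactSupport hΦc.mul_right
  simp_rw [hs, hd, Finset.mul_sum]
  rw [integral_finsetSum _ fun i _ => hI2 i, integral_finsetSum _ fun i _ => hI1 i,
    ← Finset.sum_neg_distrib]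
  refine Finset.sum_congr rfl fun i _ => ?_
  exact integral_mul_fderiv_eq_neg_fderiv_mul_of_integrable (hI1 i) (hI2 i)
    ((hΦ.continuous.mul (hc3 i)).integrable_of_hasCompactSupport hΦc.mul_right)
    (fun x _ => hΦ.differentiable one_ne_zero x)
    (fun x _ => (hWi i).differentiable one_ne_zero x)

theorem fderiv_prodMk_right {F : Type*} [NormedAddCommGroup F] [NormedSpace ℝ F]
    {U : E n × ℝ → F} (hU : ContDiff ℝ 1 U) (x : E n) (t : ℝ) (ξ : E n) :
    fderiv ℝ (fun y => U (y, t)) x ξ = fderiv ℝ U (x, t) (ξ, 0) := by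
  have h := ((hU.differentiable one_ne_zero (x, t)).hasFDerivAt).comp (f := fun y => (y, t)) x
    (hasFDerivAt_prodMk_left (𝕜 := ℝ) x t)
  have h2 : (fun y => U (y, t)) = U ∘ fun y => (y, t) := rfl
  rw [h2, h.fderiv]; simp

theorem hasDerivAt_prodMk {U : E n × ℝ → ℝ} (hU : ContDiff ℝ 1 U) (x : E n) (t : ℝ) :
    HasDerivAt (fun s => U (x, s)) (fderiv ℝ U (x, t) (0, 1)) t := by
  have h := ((hU.differentiable one_ne_zero (x, t)).hasFDerivAt).comp t
    (hasFDerivAt_prodMk_right x t)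
  have := h.hasDerivAt
  simpa using! this

theorem fderiv_mul_truncation {k : ℝ} {H h g : ℝ → ℝ} (T : IsTruncation k H h g)
    {U : E n × ℝ → ℝ} (hU : ContDiff ℝ 1 U) {χ : E n → ℝ} (hχ : ContDiff ℝ 1 χ)
    (x : E n) (s : ℝ) (ξ : E n) :
    fderiv ℝ (fun x => χ x * h (U (x, s))) x ξ =
      h (U (x, s)) * fderiv ℝ χ x ξ + χ x * (g (U (x, s)) * fderiv ℝ U (x, s) (ξ, 0)) := by
  have hUs : ContDiff ℝ 1 fun x => U (x, s) := hU.comp (by fun_prop)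
  have h1 := (hχ.differentiable one_ne_zero x).hasFDerivAt
  have h2 := (T.hasDerivAt_h (U (x, s))).comp_hasFDerivAt x
    (hUs.differentiable one_ne_zero x).hasFDerivAt
  have h3 := (h1.mul h2).fderiv
  have h4 : (fun x => χ x * h (U (x, s))) = χ * (h ∘ fun x => U (x, s)) := rfl
  rw [h4, h3]
  simp only [Function.comp, add_apply, smul_apply, smul_eq_mul, fderiv_prodMk_right hU]
  ring

theorem fderiv_eq_zero_of_notMem_tsupport {χ : E n → ℝ} {x : E n} (hx : x ∉ tsupport χ) :
    fderiv ℝ χ x = 0 := by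
  have := fun h => hx (tsupport_fderiv_subset ℝ (f := χ) (subset_tsupport _ h))
  simpa using this

/-- The energy inequality for smooth subsolutions of `∂ₜU ≤ div V`. -/
theorem energy_of_contDiff {k : ℝ} {H h g : ℝ → ℝ} (T : IsTruncation k H h g)
    {U : E n × ℝ → ℝ} {V G : E n × ℝ → E n} (hU : ContDiff ℝ 1 U) (hV : ContDiff ℝ 1 V)
    (hG : Continuous G) {χ : E n → ℝ} (hχ : ContDiff ℝ 1 χ) (hχc : HasCompactSupport χ)
    (hχ0 : ∀ x, 0 ≤ χ x) {ζ : ℝ → ℝ} (hζ : ContDiff ℝ 1 ζ) (hζ0 : ∀ t, 0 ≤ ζ t)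
    {t₁ t : ℝ} (ht : t₁ ≤ t) (hζt : ζ t₁ = 0)
    (hgrad : ∀ x ∈ tsupport χ, ∀ s ∈ Icc t₁ t, ∀ ξ,
      fderiv ℝ U (x, s) (ξ, 0) = inner ℝ (G (x, s)) ξ)
    (hineq : ∀ x ∈ tsupport χ, ∀ s ∈ Icc t₁ t,
      fderiv ℝ U (x, s) (0, 1) ≤ ∑ i, fderiv ℝ V (x, s) (EuclideanSpace.single i 1, 0) i) :
    ζ t * ∫ x, χ x * H (U (x, t)) ≤ ∫ z in tsupport χ ×ˢ Icc t₁ t,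
      (deriv ζ z.2 * (χ z.1 * H (U z)) - ζ z.2 * (h (U z) * fderiv ℝ χ z.1 (V z)) -
        ζ z.2 * (χ z.1 * (g (U z) * inner ℝ (V z) (G z)))) := by
  set K := tsupport χ with hK
  have hKc : IsCompact K := hχc
  have hKm : MeasurableSet K := hKc.measurableSet
  have hIc : IsCompact (K ×ˢ Icc t₁ t) := hKc.prod isCompact_Icc
  have hcH := T.continuous_H
  have hch := T.continuous_h
  have hcg := T.continuous_g
  have hcU := hU.continuous
  have hcV := hV.continuous
  have hcχ := hχ.continuous
  have hcζ := hζ.continuous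
  have hcζ' : Continuous (deriv ζ) := hζ.continuous_deriv le_rfl
  have hcdχ : Continuous fun z : E n × ℝ => fderiv ℝ χ z.1 (V z) :=
    ((hχ.continuous_fderiv one_ne_zero).comp continuous_fst).clm_apply hcV
  have hcdU : Continuous fun z : E n × ℝ => fderiv ℝ U z (0, 1) :=
    (hU.continuous_fderiv one_ne_zero).clm_apply continuous_const
  have hcdV : Continuous fun z : E n × ℝ =>
      ∑ i, fderiv ℝ V z (EuclideanSpace.single i 1, 0) i := by
    refine continuous_finsetSum _ fun i _ => ?_
    have := (hV.continuous_fderiv one_ne_zero).clm_apply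
      (continuous_const (y := ((EuclideanSpace.single i (1 : ℝ), (0 : ℝ)) : E n × ℝ)))
    fun_prop
  have hint : ∀ f : E n × ℝ → ℝ, Continuous f →
      IntegrableOn f (K ×ˢ Icc t₁ t) (volume.prod volume) := fun f hf =>
    hf.continuousOn.integrableOn_compact hIc
  -- The fundamental theorem of calculus in time at fixed x; the initial value drops out because
  -- ζ(t₁) = 0.
  have e1 : ζ t * ∫ x, χ x * H (U (x, t)) = ∫ z in K ×ˢ Icc t₁ t,
      (deriv ζ z.2 * (χ z.1 * H (U z)) +
        ζ z.2 * (χ z.1 * (h (U z) * fderiv ℝ U z (0, 1)))) := by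
    rw [Measure.volume_eq_prod, setIntegral_prod _ (hint _ (by fun_prop)),
      ← setIntegral_eq_integral_of_forall_compl_eq_zero (s := K)
        (fun x hx => by rw [image_eq_zero_of_notMem_tsupport hx, zero_mul]),
      ← integral_const_mul]
    refine setIntegral_congr_fun hKm fun x hx => ?_
    have hd : ∀ s, HasDerivAt (fun s => ζ s * (χ x * H (U (x, s))))
        (deriv ζ s * (χ x * H (U (x, s))) +
          ζ s * (χ x * (h (U (x, s)) * fderiv ℝ U (x, s) (0, 1)))) s := fun s =>
      ((hζ.differentiable one_ne_zero s).hasDerivAt).mul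
        (((T.hasDerivAt_H (U (x, s))).comp s (hasDerivAt_prodMk hU x s)).const_mul (χ x))
    have hft := intervalIntegral.integral_eq_sub_of_hasDerivAt (a := t₁) (b := t)
      (fun s _ => hd s) (Continuous.intervalIntegrable (by fun_prop) _ _)
    rw [hζt, zero_mul, sub_zero, intervalIntegral.integral_of_le ht,
      ← integral_Icc_eq_integral_Ioc] at hft
    exact hft.symm
  -- Integration by parts on each time slice. The identity between the spatial derivative of U and G
  -- is available only on the support of χ, so all integrals are first reduced to it.
  have e2 : ∫ z in K ×ˢ Icc t₁ t, ζ z.2 * (χ z.1 * (h (U z) *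
        ∑ i, fderiv ℝ V z (EuclideanSpace.single i 1, 0) i)) =
      ∫ z in K ×ˢ Icc t₁ t, (- (ζ z.2 * (h (U z) * fderiv ℝ χ z.1 (V z))) -
        ζ z.2 * (χ z.1 * (g (U z) * inner ℝ (V z) (G z)))) := by
    rw [Measure.volume_eq_prod, ← Measure.prod_restrict, integral_prod_symm, integral_prod_symm]
    rotate_left
    · rw [Measure.prod_restrict]; exact hint _ (by fun_prop)
    · rw [Measure.prod_restrict]; exact hint _ (by fun_prop)
    refine setIntegral_congr_fun measurableSet_Icc fun s hs => ?_
    have hUs : ContDiff ℝ 1 fun x => U (x, s) := hU.comp (by fun_prop)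
    have hVs : ContDiff ℝ 1 fun x => V (x, s) := hV.comp (by fun_prop)
    have hΦ : ContDiff ℝ 1 fun x => χ x * h (U (x, s)) := hχ.mul (T.contDiff_h.comp hUs)
    have hΦc : HasCompactSupport fun x => χ x * h (U (x, s)) := hχc.mul_right
    have hdiv := integral_mul_divergence hΦ hΦc hVs
    have hVd : ∀ x ξ, fderiv ℝ (fun y => V (y, s)) x ξ = fderiv ℝ V (x, s) (ξ, 0) := fun x ξ =>
      fderiv_prodMk_right hV x s ξ
    have hΦd : ∀ x, fderiv ℝ (fun x => χ x * h (U (x, s))) x (V (x, s)) =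
        h (U (x, s)) * fderiv ℝ χ x (V (x, s)) +
          χ x * (g (U (x, s)) * fderiv ℝ U (x, s) (V (x, s), 0)) := fun x =>
      fderiv_mul_truncation T hU hχ x s _
    rw [← setIntegral_eq_integral_of_forall_compl_eq_zero (s := K)
        (fun x hx => by rw [image_eq_zero_of_notMem_tsupport hx, zero_mul, zero_mul]),
      ← setIntegral_eq_integral_of_forall_compl_eq_zero (s := K)
        (f := fun x => fderiv ℝ (fun x => χ x * h (U (x, s))) x (V (x, s)))] at hdiv
    · calc ∫ x in K, ζ s * (χ x * (h (U (x, s)) *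
            ∑ i, fderiv ℝ V (x, s) (EuclideanSpace.single i 1, 0) i))
          = ζ s * ∫ x in K, χ x * h (U (x, s)) *
            ∑ i, fderiv ℝ (fun y => V (y, s)) x (EuclideanSpace.single i 1) i := by
            rw [← integral_const_mul]
            refine integral_congr_ae (ae_of_all _ fun x => ?_)
            simp only [hVd]; ring
        _ = ∫ x in K, -(ζ s * fderiv ℝ (fun x => χ x * h (U (x, s))) x (V (x, s))) := by
            rw [hdiv, integral_neg, integral_const_mul]; ring
        _ = _ := by
            refine setIntegral_congr_fun hKm fun x hx => ?_
            simp only [hΦd, hgrad x hx s hs, real_inner_comm]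
            ring
    · intro x hx
      rw [hΦd, image_eq_zero_of_notMem_tsupport hx]
      simp [fderiv_eq_zero_of_notMem_tsupport hx]
  rw [e1]
  have i1 := hint (fun z => deriv ζ z.2 * (χ z.1 * H (U z))) (by fun_prop)
  have i2 := hint (fun z => ζ z.2 * (χ z.1 * (h (U z) * fderiv ℝ U z (0, 1)))) (by fun_prop)
  have i3 := hint (fun z => ζ z.2 * (χ z.1 * (h (U z) *
    ∑ i, fderiv ℝ V z (EuclideanSpace.single i 1, 0) i))) (by fun_prop)
  have i4 := hint (fun z => - (ζ z.2 * (h (U z) * fderiv ℝ χ z.1 (V z))) -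
        ζ z.2 * (χ z.1 * (g (U z) * inner ℝ (V z) (G z)))) (by fun_prop)
  rw [← Measure.volume_eq_prod] at i1 i2 i3 i4
  -- The pointwise inequality ∂ₜU ≤ div V times the nonnegative test function ζ χ h(U).
  have e3 : ∫ z in K ×ˢ Icc t₁ t, ζ z.2 * (χ z.1 * (h (U z) * fderiv ℝ U z (0, 1))) ≤
      ∫ z in K ×ˢ Icc t₁ t, ζ z.2 * (χ z.1 * (h (U z) *
        ∑ i, fderiv ℝ V z (EuclideanSpace.single i 1, 0) i)) := by
    refine setIntegral_mono_on i2 i3 (hKm.prod measurableSet_Icc) fun z hz => ?_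
    have := hineq z.1 hz.1 z.2 hz.2
    have h0 := T.h_nonneg (U z)
    gcongr
    · exact hζ0 _
    · exact hχ0 _
  rw [integral_add i1 i2]
  refine (add_le_add_right (e3.trans e2.le) _).trans (le_of_eq ?_)
  rw [← integral_add i1 i4]
  refine integral_congr_ae (ae_of_all _ fun z => ?_)
  ring

end ParabolicPQ

/-! ### Mollified weak subsolutions -/

namespace ParabolicPQ

variable {n : ℕ}

instance isAddHaarMeasure_volume : (volume : Measure (E n × ℝ)).IsAddHaarMeasure :=
  inferInstanceAs ((volume : Measure (E n)).prod (volume : Measure ℝ)).IsAddHaarMeasure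

/-- `u` is a weak subsolution of `∂ₜu ≤ div V` in the open set `O`, with weak spatial
gradient `G`. -/
structure IsSubsolutionOn (O : Set (E n × ℝ)) (u : E n × ℝ → ℝ) (G V : E n × ℝ → E n) : Prop where
  locallyIntegrable : LocallyIntegrable u
  locallyIntegrable_grad : LocallyIntegrable G
  locallyIntegrable_flux : LocallyIntegrable V
  integral_grad : ∀ φ : E n × ℝ → ℝ, ContDiff ℝ ∞ φ → HasCompactSupport φ → tsupport φ ⊆ O →
    ∀ ξ, ∫ z, u z * fderiv ℝ φ z (ξ, 0) = -∫ z, φ z * inner ℝ (G z) ξ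
  integral_le : ∀ φ : E n × ℝ → ℝ, ContDiff ℝ ∞ φ → HasCompactSupport φ → tsupport φ ⊆ O →
    (∀ z, 0 ≤ φ z) → ∫ z, (-(u z * fderiv ℝ φ z (0, 1)) + fderiv ℝ φ z (V z, 0)) ≤ 0

section Translate

theorem contDiff_normed_sub {X : Type*} [NormedAddCommGroup X] [NormedSpace ℝ X]
    [FiniteDimensional ℝ X] [MeasureSpace X] (B : ContDiffBump (0 : X)) (z : X) :
    ContDiff ℝ ∞ fun w => B.normed volume (z - w) :=
  (B.contDiff_normed (μ := volume)).comp (contDiff_const.sub contDiff_id)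

theorem fderiv_normed_sub {X : Type*} [NormedAddCommGroup X] [NormedSpace ℝ X]
    [FiniteDimensional ℝ X] [MeasureSpace X] (B : ContDiffBump (0 : X)) (z w v : X) :
    fderiv ℝ (fun w => B.normed volume (z - w)) w v =
      -fderiv ℝ (B.normed volume) (z - w) v := by
  have hC : ContDiff ℝ 1 (B.normed (volume : Measure X)) := B.contDiff_normed
  have h := ((hC.differentiable one_ne_zero (z - w)).hasFDerivAt).comp w
    ((hasFDerivAt_id (𝕜 := ℝ) w).const_sub z)
  have h2 : (fun w => B.normed volume (z - w)) = B.normed volume ∘ HSub.hSub z := rfl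
  rw [h2, h.fderiv]; simp

variable {X : Type*} [NormedAddCommGroup X] [NormedSpace ℝ X] [FiniteDimensional ℝ X]
  [MeasureSpace X] [BorelSpace X] [(volume : Measure X).IsAddHaarMeasure]

theorem tsupport_normed_sub (B : ContDiffBump (0 : X)) (z : X) :
    tsupport (fun w => B.normed volume (z - w)) ⊆ Metric.closedBall z B.rOut := by
  refine closure_minimal (fun w hw => ?_) Metric.isClosed_closedBall
  have : z - w ∈ Function.support (B.normed (volume : Measure X)) := hw
  rw [B.support_normed_eq] at this
  rw [Metric.mem_closedBall, dist_comm, dist_eq_norm]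
  simpa using (mem_ball_zero_iff.1 this).le

theorem hasCompactSupport_normed_sub (B : ContDiffBump (0 : X)) (z : X) :
    HasCompactSupport fun w => B.normed volume (z - w) :=
  (isCompact_closedBall z B.rOut).of_isClosed_subset (isClosed_tsupport _)
    (tsupport_normed_sub B z)

theorem integrable_fderiv_normed_sub_smul {F : Type*} [NormedAddCommGroup F] [NormedSpace ℝ F]
    (B : ContDiffBump (0 : X)) {f : X → F} (hf : LocallyIntegrable f) (z v : X) :
    Integrable fun w => fderiv ℝ (B.normed volume) (z - w) v • f w := by
  have h1 : (fun w => fderiv ℝ (B.normed volume) (z - w) v) =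
      fun w => -fderiv ℝ (fun w => B.normed volume (z - w)) w v := by
    ext w; rw [fderiv_normed_sub, neg_neg]
  have hc : Continuous fun w => fderiv ℝ (B.normed volume) (z - w) v := by
    rw [h1]
    exact (((contDiff_normed_sub B z).continuous_fderiv (by simp)).clm_apply continuous_const).neg
  have hs : HasCompactSupport fun w => fderiv ℝ (B.normed volume) (z - w) v := by
    rw [h1]
    exact ((hasCompactSupport_normed_sub B z).fderiv_apply ℝ v).neg
  exact hf.integrable_smul_left_of_hasCompactSupport hc hs

end Translate

theorem prod_zero_eq_sum (ξ : E n) :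
    ((ξ, 0) : E n × ℝ) = ∑ i, ξ i • ((EuclideanSpace.single i 1, 0) : E n × ℝ) := by
  have h3 := (EuclideanSpace.basisFun (Fin n) ℝ).sum_repr ξ
  simp only [EuclideanSpace.basisFun_repr, EuclideanSpace.basisFun_apply] at h3
  refine Prod.ext ?_ ?_
  · simp [Prod.fst_sum, h3]
  · simp [Prod.snd_sum]

namespace IsSubsolutionOn

variable {O : Set (E n × ℝ)} {u : E n × ℝ → ℝ} {G V : E n × ℝ → E n}

/-- The translated kernel w ↦ η(z - w) is an admissible test function as long as its supporting ball
lies in O, and its derivative in w is minus the derivative in z. -/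
theorem fderiv_moll_fst (hu : IsSubsolutionOn O u G V) (B : ContDiffBump (0 : E n × ℝ))
    {z : E n × ℝ} (hz : Metric.closedBall z B.rOut ⊆ O) (ξ : E n) :
    fderiv ℝ (moll B u) z (ξ, 0) = inner ℝ (moll B G z) ξ := by
  have h := hu.integral_grad _ (contDiff_normed_sub B z) (hasCompactSupport_normed_sub B z)
    ((tsupport_normed_sub B z).trans hz) ξ
  simp_rw [fderiv_normed_sub] at h
  rw [fderiv_moll B hu.locallyIntegrable, moll_apply, real_inner_comm,
    ← innerSL_apply_apply (𝕜 := ℝ), ← ContinuousLinearMap.integral_comp_comm _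
      (integrable_normed_sub_smul B hu.locallyIntegrable_grad z)]
  simp only [mul_neg, integral_neg, neg_inj] at h
  simp only [smul_eq_mul, map_smul, innerSL_apply_apply]
  simp_rw [real_inner_comm _ ξ, mul_comm _ (u _), h]

/-- The same choice of test function in the weak inequality; the kernel is nonnegative, so the
inequality survives and becomes pointwise. -/
theorem fderiv_moll_snd_le (hu : IsSubsolutionOn O u G V) (B : ContDiffBump (0 : E n × ℝ))
    {z : E n × ℝ} (hz : Metric.closedBall z B.rOut ⊆ O) :
    fderiv ℝ (moll B u) z (0, 1) ≤
      ∑ i, fderiv ℝ (moll B V) z (EuclideanSpace.single i 1, 0) i := by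
  have h := hu.integral_le _ (contDiff_normed_sub B z) (hasCompactSupport_normed_sub B z)
    ((tsupport_normed_sub B z).trans hz) fun w => B.nonneg_normed _
  simp_rw [fderiv_normed_sub] at h
  have hI : ∀ i : Fin n, Integrable fun w =>
      (fderiv ℝ (B.normed volume) (z - w) (EuclideanSpace.single i 1, 0) • V w) :=
    fun i => integrable_fderiv_normed_sub_smul B hu.locallyIntegrable_flux z _
  have hIi : ∀ i : Fin n, Integrable fun w =>
      fderiv ℝ (B.normed volume) (z - w) (EuclideanSpace.single i 1, 0) * V w i := fun i =>
    (EuclideanSpace.proj (𝕜 := ℝ) i : E n →L[ℝ] ℝ).integrable_comp (hI i)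
  have hV : ∑ i, fderiv ℝ (moll B V) z (EuclideanSpace.single i 1, 0) i =
      ∫ w, fderiv ℝ (B.normed volume) (z - w) (V w, 0) := by
    have h1 : ∀ i, fderiv ℝ (moll B V) z (EuclideanSpace.single i 1, 0) i =
        ∫ w, fderiv ℝ (B.normed volume) (z - w) (EuclideanSpace.single i 1, 0) * V w i := by
      intro i
      rw [fderiv_moll B hu.locallyIntegrable_flux]
      exact ((EuclideanSpace.proj (𝕜 := ℝ) i : E n →L[ℝ] ℝ).integral_comp_comm (hI i)).symm
    simp_rw [h1]
    rw [← integral_finsetSum _ fun i _ => hIi i]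
    refine integral_congr_ae (ae_of_all _ fun w => ?_)
    simp only
    rw [prod_zero_eq_sum, map_sum]
    simp_rw [map_smul, smul_eq_mul, mul_comm]
  have hu1 : Integrable fun w => u w * fderiv ℝ (B.normed volume) (z - w) (0, 1) := by
    simpa [mul_comm] using integrable_fderiv_normed_sub_smul B hu.locallyIntegrable z (0, 1)
  have hV1 : Integrable fun w => fderiv ℝ (B.normed volume) (z - w) (V w, 0) := by
    refine (integrable_finsetSum Finset.univ fun i _ => hIi i).congr (ae_of_all _ fun w => ?_)
    simp only
    rw [prod_zero_eq_sum, map_sum]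
    simp_rw [map_smul, smul_eq_mul, mul_comm]
  rw [hV, fderiv_moll B hu.locallyIntegrable]
  simp only [mul_neg, neg_neg] at h
  rw [show ∫ w, (u w * fderiv ℝ (B.normed volume) (z - w) (0, 1) +
      -fderiv ℝ (B.normed volume) (z - w) (V w, 0)) = _ from integral_add hu1 hV1.neg,
    integral_neg] at h
  simp only [smul_eq_mul]
  simp_rw [mul_comm _ (u _)]
  linarith

end IsSubsolutionOn

/-- By Jensen's inequality the integrand is at most C(1 + moll Θ) on S, with Θ = |u|^r + |G|^r +
|V|^r'. These majorants converge almost everywhere and have constant integral, so no fixed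
dominating function is needed. -/
theorem tendsto_setLIntegral_moll {r r' : ℝ} (hr : 1 ≤ r) (hr' : 1 ≤ r')
    {u : E n × ℝ → ℝ} {G V : E n × ℝ → E n}
    (hu : LocallyIntegrable u) (hG : LocallyIntegrable G) (hV : LocallyIntegrable V)
    (hur : Integrable fun z => ‖u z‖ ^ r) (hGr : Integrable fun z => ‖G z‖ ^ r)
    (hVr : Integrable fun z => ‖V z‖ ^ r') {S : Set (E n × ℝ)} (hS : MeasurableSet S)
    (hSfin : volume S ≠ ⊤) {Ψ : E n × ℝ → ℝ → E n → E n → ℝ}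
    (hΨc : Continuous fun y : (E n × ℝ) × ℝ × E n × E n => Ψ y.1 y.2.1 y.2.2.1 y.2.2.2)
    {C : ℝ} (hC : 0 ≤ C)
    (hΨ : ∀ z ∈ S, ∀ a b c, Ψ z a b c ≤ C * (1 + ‖a‖ ^ r + ‖b‖ ^ r + ‖c‖ ^ r')) :
    Tendsto (fun N => ∫⁻ z in S, ENNReal.ofReal (Ψ z (moll (bumpSeq _ N) u z)
        (moll (bumpSeq _ N) G z) (moll (bumpSeq _ N) V z))) atTop
      (𝓝 (∫⁻ z in S, ENNReal.ofReal (Ψ z (u z) (G z) (V z)))) ∧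
    ∫⁻ z in S, ENNReal.ofReal (Ψ z (u z) (G z) (V z)) ≠ ⊤ := by
  set Θ : E n × ℝ → ℝ := fun z => ‖u z‖ ^ r + ‖G z‖ ^ r + ‖V z‖ ^ r' with hΘ
  have hΘ0 : ∀ z, 0 ≤ Θ z := fun z => by positivity
  have hΘi : Integrable Θ := (hur.add hGr).add hVr
  have hmc : ∀ N, Continuous fun z => Ψ z (moll (bumpSeq _ N) u z)
        (moll (bumpSeq _ N) G z) (moll (bumpSeq _ N) V z) := fun N =>
    hΨc.comp (continuous_id.prodMk ((contDiff_moll _ hu).continuous.prodMk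
      ((contDiff_moll _ hG).continuous.prodMk (contDiff_moll _ hV).continuous)))
  have hΘm : ∀ N, Continuous (moll (bumpSeq _ N) Θ) := fun N =>
    (contDiff_moll _ hΘi.locallyIntegrable).continuous
  have hmΘ : ∀ N z, ‖moll (bumpSeq _ N) u z‖ ^ r + ‖moll (bumpSeq _ N) G z‖ ^ r +
      ‖moll (bumpSeq _ N) V z‖ ^ r' ≤ moll (bumpSeq _ N) Θ z := by
    intro N z
    have h1 := norm_moll_rpow_le (bumpSeq _ N) hr hu hur.locallyIntegrable z
    have h2 := norm_moll_rpow_le (bumpSeq _ N) hr hG hGr.locallyIntegrable z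
    have h3 := norm_moll_rpow_le (bumpSeq _ N) hr' hV hVr.locallyIntegrable z
    refine (add_le_add (add_le_add h1 h2) h3).trans (le_of_eq ?_)
    simp only [moll_apply, smul_eq_mul, hΘ, mul_add]
    have i1 := integrable_normed_sub_smul (bumpSeq _ N) hur.locallyIntegrable z
    have i2 := integrable_normed_sub_smul (bumpSeq _ N) hGr.locallyIntegrable z
    have i3 := integrable_normed_sub_smul (bumpSeq _ N) hVr.locallyIntegrable z
    simp only [smul_eq_mul] at i1 i2 i3
    rw [← integral_add i1 i2]
    exact (integral_add (i1.add i2) i3).symm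
  have hdom : ∀ z ∈ S, ∀ a b c θ, ‖a‖ ^ r + ‖b‖ ^ r + ‖c‖ ^ r' ≤ θ → 
      ENNReal.ofReal (Ψ z a b c) ≤ ENNReal.ofReal C * (1 + ENNReal.ofReal θ) := by
    intro z hz a b c θ hθ
    have h0 : 0 ≤ ‖a‖ ^ r + ‖b‖ ^ r + ‖c‖ ^ r' := by positivity
    rw [← ENNReal.ofReal_one, ← ENNReal.ofReal_add zero_le_one (h0.trans hθ),
      ← ENNReal.ofReal_mul hC]
    apply ENNReal.ofReal_le_ofReal
    exact (hΨ z hz a b c).trans (mul_le_mul_of_nonneg_left (by linarith) hC)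
  have hΘfin : ∫⁻ z, ENNReal.ofReal (Θ z) ≠ ⊤ := hΘi.lintegral_lt_top.ne
  have hI : ∀ f : E n × ℝ → ℝ≥0∞, Measurable f ∨ AEMeasurable f → 
      ∫⁻ z, ENNReal.ofReal C * (S.indicator 1 z + f z) =
      ENNReal.ofReal C * (volume S + ∫⁻ z, f z) := by
    intro f hf
    rw [lintegral_const_mul' _ _ ENNReal.ofReal_ne_top,
      lintegral_add_left (measurable_one.indicator hS), lintegral_indicator_one hS]
  have hGfin : ∫⁻ z, ENNReal.ofReal C * (S.indicator 1 z + ENNReal.ofReal (Θ z)) ≠ ⊤ := by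
    rw [hI _ (Or.inr hΘi.aestronglyMeasurable.aemeasurable.ennreal_ofReal)]
    exact ENNReal.mul_ne_top ENNReal.ofReal_ne_top (ENNReal.add_ne_top.2 ⟨hSfin, hΘfin⟩)
  simp_rw [← lintegral_indicator hS]
  constructor
  · refine tendsto_lintegral_of_le_of_lintegral_eq
      (g := fun N z => ENNReal.ofReal C * (S.indicator 1 z +
        ENNReal.ofReal (moll (bumpSeq _ N) Θ z)))
      (G := fun z => ENNReal.ofReal C * (S.indicator 1 z + ENNReal.ofReal (Θ z)))
      (fun N => ((hmc N).measurable.ennreal_ofReal.indicator hS).aemeasurable)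
      (fun N => (((measurable_one.indicator hS).add
        (hΘm N).measurable.ennreal_ofReal).const_mul _).aemeasurable)
      (Eventually.of_forall fun N => ae_of_all _ fun z => ?_) ?_ ?_
      (Eventually.of_forall fun N => ?_) hGfin
    · by_cases hz : z ∈ S
      · simpa [hz] using hdom z hz _ _ _ _ (hmΘ N z)
      · simp [hz]
    · filter_upwards [ae_tendsto_moll hu, ae_tendsto_moll hG, ae_tendsto_moll hV] with z h1 h2 h3
      by_cases hz : z ∈ S
      · simp only [hz, indicator_of_mem]
        exact (ENNReal.continuous_ofReal.tendsto _).comp ((hΨc.tendsto (z, u z, G z, V z)).comp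
          (tendsto_const_nhds.prodMk_nhds (h1.prodMk_nhds (h2.prodMk_nhds h3))))
      · simp [hz]
    · filter_upwards [ae_tendsto_moll hΘi.locallyIntegrable] with z h1
      exact ENNReal.Tendsto.const_mul (((ENNReal.continuous_ofReal.tendsto _).comp h1).const_add _)
        (Or.inr ENNReal.ofReal_ne_top)
    · rw [hI _ (Or.inl (hΘm N).measurable.ennreal_ofReal),
        hI _ (Or.inr hΘi.aestronglyMeasurable.aemeasurable.ennreal_ofReal),
        lintegral_moll _ hΘ0 hΘi]
  · refine ((lintegral_mono fun z => ?_).trans_lt hGfin.lt_top).ne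
    by_cases hz : z ∈ S
    · simpa only [hz, indicator_of_mem, Pi.one_apply] using
        hdom z hz (u z) (G z) (V z) (Θ z) le_rfl
    · simp [hz]

end ParabolicPQ

/-! ### Energy and Gagliardo-Nirenberg estimates for smooth subsolutions -/

namespace ParabolicPQ

variable {n : ℕ}

/-- Assumptions on a cutoff function `χ(x) ζ(t)` that vanishes at the initial time `t₁`. -/
structure IsCutoff (χ : E n → ℝ) (ζ : ℝ → ℝ) (t₁ : ℝ) : Prop where
  contDiff_space : ContDiff ℝ 1 χ
  hasCompactSupport : HasCompactSupport χ
  space_nonneg : ∀ x, 0 ≤ χ x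
  space_le_one : ∀ x, χ x ≤ 1
  contDiff_time : ContDiff ℝ 1 ζ
  time_nonneg : ∀ t, 0 ≤ ζ t
  time_le_one : ∀ t, ζ t ≤ 1
  time_eq_zero : ζ t₁ = 0

/-- The energy and Gagliardo-Nirenberg estimates for smooth subsolutions of `∂ₜU ≤ div V`. -/
theorem lintegral_estimates_of_contDiff (hn : 2 ≤ n) {k : ℝ} {H h g : ℝ → ℝ}
    (T : IsTruncation k H h g)
    {U : E n × ℝ → ℝ} {V G : E n × ℝ → E n} (hU : ContDiff ℝ 1 U) (hV : ContDiff ℝ 1 V)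
    (hG : Continuous G) {χ : E n → ℝ} {ζ : ℝ → ℝ} {t₁ τ : ℝ} (c : IsCutoff χ ζ t₁)
    (hτ : t₁ ≤ τ)
    (hgrad : ∀ x ∈ tsupport χ, ∀ s ∈ Icc t₁ τ, ∀ ξ,
      fderiv ℝ U (x, s) (ξ, 0) = inner ℝ (G (x, s)) ξ)
    (hineq : ∀ x ∈ tsupport χ, ∀ s ∈ Icc t₁ τ,
      fderiv ℝ U (x, s) (0, 1) ≤ ∑ i, fderiv ℝ V (x, s) (EuclideanSpace.single i 1, 0) i)
    {p : ℝ} (hp : 1 < p) {R : ℝ≥0∞}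
    (hR : R = ∫⁻ z in tsupport χ ×ˢ Icc t₁ τ, ENNReal.ofReal
      (|deriv ζ z.2| * (χ z.1 * H (U z)) + ζ z.2 * (h (U z) * (‖fderiv ℝ χ z.1‖ * ‖V z‖)) +
        ζ z.2 * (χ z.1 * (g (U z) * max (-inner ℝ (V z) (G z)) 0)))) :
    ∫⁻ z in tsupport χ ×ˢ Icc t₁ τ,
        ENNReal.ofReal (ζ z.2 * (χ z.1 * (g (U z) * max (inner ℝ (V z) (G z)) 0))) ≤ R ∧
    ∫⁻ z in tsupport χ ×ˢ Icc t₁ τ,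
        ENNReal.ofReal (ζ z.2 * (χ z.1 * h (U z))) ^ (p * (n + 2) / n) ≤
      gnConst n p * (2 * R) ^ (p / n) * ∫⁻ z in tsupport χ ×ˢ Icc t₁ τ,
        ENNReal.ofReal ((ζ z.2 * (χ z.1 * (g (U z) * ‖G z‖)) +
          ζ z.2 * (h (U z) * ‖fderiv ℝ χ z.1‖)) ^ p) := by
  obtain ⟨hχ, hχc, hχ0, hχ1, hζ, hζ0, hζ1, hζt⟩ := c
  set K := tsupport χ with hK
  have hKc : IsCompact K := hχc
  have hKm : MeasurableSet K := hKc.measurableSet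
  have hcH := T.continuous_H
  have hch := T.continuous_h
  have hcg := T.continuous_g
  have hcU := hU.continuous
  have hcV := hV.continuous
  have hcχ := hχ.continuous
  have hcζ := hζ.continuous
  have hcζ' : Continuous (deriv ζ) := hζ.continuous_deriv le_rfl
  have hcχ' : Continuous (fderiv ℝ χ) := hχ.continuous_fderiv one_ne_zero
  have hcdχ : Continuous fun z : E n × ℝ => fderiv ℝ χ z.1 (V z) :=
    (hcχ'.comp continuous_fst).clm_apply hcV
  have hint : ∀ (t : ℝ) (f : E n × ℝ → ℝ), Continuous f →
      IntegrableOn f (K ×ˢ Icc t₁ t) := fun t f hf =>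
    hf.continuousOn.integrableOn_compact (hKc.prod isCompact_Icc)
  have hm : ∀ t, MeasurableSet (K ×ˢ Icc t₁ t) := fun t => hKm.prod measurableSet_Icc
  have hH0 := T.H_nonneg
  have hh0 := T.h_nonneg
  have hg0 := T.g_nonneg
  -- The product of mollified flux and mollified gradient has no sign, so its negative part is moved
  -- to the right-hand side; it disappears in the limit.
  set Ψ : E n × ℝ → ℝ := fun z => |deriv ζ z.2| * (χ z.1 * H (U z)) +
    ζ z.2 * (h (U z) * (‖fderiv ℝ χ z.1‖ * ‖V z‖)) +
        ζ z.2 * (χ z.1 * (g (U z) * max (-inner ℝ (V z) (G z)) 0)) with hΨ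
  have hΨ0 : ∀ z, 0 ≤ Ψ z := fun z => by
    have := hH0 (U z); have := hh0 (U z); have := hg0 (U z); have := hχ0 z.1; have := hζ0 z.2
    positivity
  have hcΨ : Continuous Ψ := by fun_prop
  have hRreal : R = ENNReal.ofReal (∫ z in K ×ˢ Icc t₁ τ, Ψ z) := by
    rw [hR, ofReal_integral_eq_lintegral_ofReal (hint τ _ hcΨ) (ae_of_all _ hΨ0)]
  have hpt : ∀ z, -(ζ z.2 * (h (U z) * fderiv ℝ χ z.1 (V z))) ≤
      ζ z.2 * (h (U z) * (‖fderiv ℝ χ z.1‖ * ‖V z‖)) := by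
    intro z
    have h1 : -(fderiv ℝ χ z.1 (V z)) ≤ ‖fderiv ℝ χ z.1‖ * ‖V z‖ :=
      (neg_le_abs _).trans ((fderiv ℝ χ z.1).le_opNorm (V z))
    have h2 := mul_le_mul_of_nonneg_left (mul_le_mul_of_nonneg_left h1 (hh0 (U z))) (hζ0 z.2)
    linarith
  have hpt2 : ∀ z, deriv ζ z.2 * (χ z.1 * H (U z)) ≤ |deriv ζ z.2| * (χ z.1 * H (U z)) := fun z =>
    mul_le_mul_of_nonneg_right (le_abs_self _) (mul_nonneg (hχ0 _) (hH0 _))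
  have hmax : ∀ a : ℝ, a = max a 0 - max (-a) 0 := fun a => by
    rcases le_total a 0 with h | h
    · rw [max_eq_right h, max_eq_left (by linarith)]; ring
    · rw [max_eq_left h, max_eq_right (by linarith)]; ring
  have hen : ∀ t ∈ Icc t₁ τ, ζ t * ∫ x, χ x * H (U (x, t)) ≤ ∫ z in K ×ˢ Icc t₁ t,
      (deriv ζ z.2 * (χ z.1 * H (U z)) - ζ z.2 * (h (U z) * fderiv ℝ χ z.1 (V z)) -
        ζ z.2 * (χ z.1 * (g (U z) * inner ℝ (V z) (G z)))) := fun t ht =>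
    energy_of_contDiff T hU hV hG hχ hχc hχ0 hζ hζ0 ht.1 hζt
      (fun x hx s hs => hgrad x hx s ⟨hs.1, hs.2.trans ht.2⟩)
      (fun x hx s hs => hineq x hx s ⟨hs.1, hs.2.trans ht.2⟩)
  -- Enlarging the time interval to τ makes the bound uniform in t. It replaces the supremum in time
  -- in the integrated Gagliardo-Nirenberg inequality.
  have hsup : ∀ t ∈ Icc t₁ τ, ENNReal.ofReal (ζ t * ∫ x, χ x * H (U (x, t))) ≤ R := by
    intro t ht
    rw [hRreal]
    apply ENNReal.ofReal_le_ofReal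
    refine (hen t ht).trans ?_
    calc _ ≤ ∫ z in K ×ˢ Icc t₁ t, Ψ z := by
          refine setIntegral_mono_on (hint t _ (by fun_prop)) (hint t _ hcΨ) (hm t) fun z _ => ?_
          have h3 : -(ζ z.2 * (χ z.1 * (g (U z) * inner ℝ (V z) (G z)))) ≤
              ζ z.2 * (χ z.1 * (g (U z) * max (-inner ℝ (V z) (G z)) 0)) := by
            have := mul_le_mul_of_nonneg_left (mul_le_mul_of_nonneg_left
              (mul_le_mul_of_nonneg_left (le_max_left (-inner ℝ (V z) (G z)) 0) (hg0 (U z)))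
              (hχ0 z.1)) (hζ0 z.2)
            linarith
          have := hpt z; have := hpt2 z
          simp only [hΨ]; linarith
      _ ≤ ∫ z in K ×ˢ Icc t₁ τ, Ψ z := by
          refine setIntegral_mono_set (hint τ _ hcΨ) (ae_of_all _ hΨ0) (LE.le.eventuallyLE ?_)
          exact prod_mono_right (Icc_subset_Icc_right ht.2)
  constructor
  · rw [hRreal, ← ofReal_integral_eq_lintegral_ofReal (hint τ _ (by fun_prop)) (ae_of_all _ fun z =>
      mul_nonneg (hζ0 _) (mul_nonneg (hχ0 _) (mul_nonneg (hg0 _) (le_max_right _ _))))]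
    apply ENNReal.ofReal_le_ofReal
    have h1 := hen τ ⟨hτ, le_rfl⟩
    have h2 : 0 ≤ ζ τ * ∫ x, χ x * H (U (x, τ)) :=
      mul_nonneg (hζ0 _) (integral_nonneg fun x => mul_nonneg (hχ0 _) (hH0 _))
    have h3 := h2.trans h1
    have i1 := hint τ (fun z => ζ z.2 * (χ z.1 * (g (U z) * max (inner ℝ (V z) (G z)) 0)))
      (by fun_prop)
    have i2 := hint τ (fun z => deriv ζ z.2 * (χ z.1 * H (U z)) -
      ζ z.2 * (h (U z) * fderiv ℝ χ z.1 (V z)) -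
        ζ z.2 * (χ z.1 * (g (U z) * inner ℝ (V z) (G z)))) (by fun_prop)
    refine (le_add_of_nonneg_left h3).trans ?_
    rw [← integral_add i2 i1]
    refine setIntegral_mono_on (i2.add i1) (hint τ _ hcΨ) (hm τ) fun z _ => ?_
    have h4 : ζ z.2 * (χ z.1 * (g (U z) * inner ℝ (V z) (G z))) =
        ζ z.2 * (χ z.1 * (g (U z) * max (inner ℝ (V z) (G z)) 0)) -
        ζ z.2 * (χ z.1 * (g (U z) * max (-inner ℝ (V z) (G z)) 0)) := by
      conv_lhs => rw [hmax (inner ℝ (V z) (G z))]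
      ring
    have := hpt z; have := hpt2 z
    simp only [hΨ]; linarith
  · have hslice : ∀ t ∈ Icc t₁ τ,
        ∫⁻ x in K, ENNReal.ofReal (ζ t * (χ x * h (U (x, t)))) ^ (p * (n + 2) / n) ≤
        gnConst n p * (2 * R) ^ (p / n) * ∫⁻ x in K,
          ENNReal.ofReal ((ζ t * (χ x * (g (U (x, t)) * ‖G (x, t)‖)) +
          ζ t * (h (U (x, t)) * ‖fderiv ℝ χ x‖)) ^ p) := by
      intro t ht
      have hUs : ContDiff ℝ 1 fun x => U (x, t) := hU.comp (by fun_prop)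
      have hw : ContDiff ℝ 1 fun x => χ x * h (U (x, t)) := hχ.mul (T.contDiff_h.comp hUs)
      have hv : ContDiff ℝ 1 fun x => ζ t * (χ x * h (U (x, t))) := contDiff_const.mul hw
      have hvc : HasCompactSupport fun x => ζ t * (χ x * h (U (x, t))) :=
        (hχc.mul_right (f' := fun x => h (U (x, t)))).mul_left (f := fun _ => ζ t)
      have hgn := lintegral_rpow_le_gnConst hn hp hv hvc
        (fun x => mul_nonneg (hζ0 _) (mul_nonneg (hχ0 _) (hh0 _)))
      refine (setLIntegral_le_lintegral K _).trans (hgn.trans ?_)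
      refine mul_le_mul' (mul_le_mul_right (ENNReal.rpow_le_rpow ?_ (by positivity)) _) ?_
      · calc ∫⁻ x, ENNReal.ofReal (ζ t * (χ x * h (U (x, t)))) ^ (2 : ℝ)
            ≤ ∫⁻ x, ENNReal.ofReal (2 * (ζ t * (χ x * H (U (x, t))))) := by
              refine lintegral_mono fun x => ?_
              have hz := hζ0 t; have hx := hχ0 x; have h3 := hh0 (U (x, t))
              have h4 := hH0 (U (x, t))
              rw [ENNReal.ofReal_rpow_of_nonneg (by positivity) (by norm_num)]
              apply ENNReal.ofReal_le_ofReal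
              rw [Real.rpow_two]
              -- Hence (ζχ)² ≤ ζχ, and the squared test function is controlled by the energy, which
              -- carries the cutoff only once.
              have h5 : ζ t * χ x ≤ 1 := mul_le_one₀ (hζ1 t) hx (hχ1 x)
              calc (ζ t * (χ x * h (U (x, t)))) ^ 2
                  = (ζ t * χ x) * (ζ t * χ x) * h (U (x, t)) ^ 2 := by ring
                _ ≤ (ζ t * χ x) * 1 * (2 * H (U (x, t))) := by
                    gcongr
                    exact T.sq_h_le _
                _ = _ := by ring
          _ = 2 * ENNReal.ofReal (ζ t * ∫ x, χ x * H (U (x, t))) := by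
              rw [show ∀ y : ℝ≥0∞, 2 * y = ENNReal.ofReal 2 * y from fun y => by simp,
                ← ENNReal.ofReal_mul (by norm_num),
                ← integral_const_mul, ← integral_const_mul, ofReal_integral_eq_lintegral_ofReal]
              · have : Integrable fun x => χ x * H (U (x, t)) :=
                  Continuous.integrable_of_hasCompactSupport (by fun_prop) hχc.mul_right
                exact (this.const_mul _).const_mul _
              · exact ae_of_all _ fun x => by
                  have hz := hζ0 t; have hx := hχ0 x; have h4 := hH0 (U (x, t))
                  positivity
          _ ≤ 2 * R := by gcongr; exact hsup t ht
      · have hder : ∀ x ξ, fderiv ℝ (fun x => ζ t * (χ x * h (U (x, t)))) x ξ =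
            ζ t * (h (U (x, t)) * fderiv ℝ χ x ξ +
              χ x * (g (U (x, t)) * fderiv ℝ U (x, t) (ξ, 0))) := by
          intro x ξ
          rw [fderiv_const_mul (hw.differentiable one_ne_zero x), smul_apply,
            fderiv_mul_truncation T hU hχ, smul_eq_mul]
        rw [← setLIntegral_eq_of_support_subset (s := K)]
        · refine setLIntegral_mono' hKm fun x hx => ?_
          have hz := hζ0 t; have hx0 := hχ0 x; have h3 := hh0 (U (x, t)); have h4 := hg0 (U (x, t))
          rw [← ofReal_norm, ENNReal.ofReal_rpow_of_nonneg (norm_nonneg _) (by linarith)]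
          apply ENNReal.ofReal_le_ofReal
          refine Real.rpow_le_rpow (norm_nonneg _) ?_ (by linarith)
          refine ContinuousLinearMap.opNorm_le_bound _ (by positivity) fun ξ => ?_
          rw [hder, hgrad x hx t ht]
          have h5 : |fderiv ℝ χ x ξ| ≤ ‖fderiv ℝ χ x‖ * ‖ξ‖ := (fderiv ℝ χ x).le_opNorm ξ
          have h6 : |inner ℝ (G (x, t)) ξ| ≤ ‖G (x, t)‖ * ‖ξ‖ := abs_real_inner_le_norm _ _
          rw [Real.norm_eq_abs, abs_mul, abs_of_nonneg hz]
          calc _ ≤ ζ t * (h (U (x, t)) * |fderiv ℝ χ x ξ| +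
                χ x * (g (U (x, t)) * |inner ℝ (G (x, t)) ξ|)) := by
                gcongr
                refine (abs_add_le _ _).trans (le_of_eq ?_)
                rw [abs_mul, abs_mul, abs_mul, abs_of_nonneg h3, abs_of_nonneg h4,
                  abs_of_nonneg hx0]
            _ ≤ ζ t * (h (U (x, t)) * (‖fderiv ℝ χ x‖ * ‖ξ‖) +
                χ x * (g (U (x, t)) * (‖G (x, t)‖ * ‖ξ‖))) := by gcongr
            _ = _ := by ring
        · intro x hx
          by_contra hxK
          apply hx
          have : fderiv ℝ (fun x => ζ t * (χ x * h (U (x, t)))) x = 0 := by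
            ext ξ
            rw [hder, fderiv_eq_zero_of_notMem_tsupport hxK, image_eq_zero_of_notMem_tsupport hxK]
            simp
          simp only
          rw [← ofReal_norm, this, norm_zero, ENNReal.ofReal_zero,
            ENNReal.zero_rpow_of_pos (by linarith)]
    rw [Measure.volume_eq_prod, ← Measure.prod_restrict, lintegral_prod_symm', lintegral_prod_symm']
    rotate_left
    · exact (Continuous.measurable (by
        refine Continuous.rpow_const (by fun_prop) fun z => Or.inr (by linarith))).ennreal_ofReal
    · exact (Continuous.measurable (by fun_prop)).ennreal_ofReal.pow_const _
    rw [← lintegral_const_mul _]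
    · exact setLIntegral_mono' measurableSet_Icc fun t ht => hslice t ht
    · refine Measurable.lintegral_prod_left' (f := fun z : E n × ℝ => ENNReal.ofReal ((ζ z.2 * (χ z.1 * (g (U z) * ‖G z‖)) +
          ζ z.2 * (h (U z) * ‖fderiv ℝ χ z.1‖)) ^ p)) ?_
      exact (Continuous.measurable (by
        refine Continuous.rpow_const (by fun_prop) fun z => Or.inr (by linarith))).ennreal_ofReal

end ParabolicPQ

/-! ### Passage to the limit in the mollification -/

namespace ParabolicPQ

variable {n : ℕ}

theorem rpow_le_one_add_rpow {x s r : ℝ} (hx : 0 ≤ x) (hs : 0 ≤ s) (hsr : s ≤ r) :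
    x ^ s ≤ 1 + x ^ r := by
  rcases le_total x 1 with h | h
  · have := Real.rpow_le_one hx h hs
    have := Real.rpow_nonneg hx r
    linarith
  · have := Real.rpow_le_rpow_of_exponent_le h hsr
    linarith

theorem add_add_rpow_le {x y z r : ℝ} (hx : 0 ≤ x) (hy : 0 ≤ y) (hz : 0 ≤ z) (hr : 0 ≤ r) :
    (x + y + z) ^ r ≤ 3 ^ r * (x ^ r + y ^ r + z ^ r) := by
  have h1 : x + y + z ≤ 3 * max (max x y) z := by
    have := le_max_left (max x y) z; have := le_max_right (max x y) z
    have := le_max_left x y; have := le_max_right x y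
    linarith
  have hm : 0 ≤ max (max x y) z := le_max_of_le_right hz
  calc (x + y + z) ^ r ≤ (3 * max (max x y) z) ^ r := by gcongr
    _ = 3 ^ r * max (max x y) z ^ r := Real.mul_rpow (by norm_num) hm
    _ ≤ _ := by
      gcongr
      have := Real.rpow_nonneg hx r; have := Real.rpow_nonneg hy r; have := Real.rpow_nonneg hz r
      rcases max_choice (max x y) z with h | h <;> rw [h]
      · rcases max_choice x y with h | h <;> rw [h] <;> linarith
      · linarith

theorem mul_le_rpow_add_rpow {r r' x y : ℝ} (hr : r.HolderConjugate r') (hx : 0 ≤ x) (hy : 0 ≤ y) :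
    x * y ≤ x ^ r + y ^ r' := by
  refine (Real.young_inequality_of_nonneg hx hy hr).trans ?_
  exact add_le_add (div_le_self (Real.rpow_nonneg hx _) hr.lt.le)
    (div_le_self (Real.rpow_nonneg hy _) hr.symm.lt.le)

/-- The quadratic term is dominated because r ≥ 2, and the product of function and flux by Young's
inequality for conjugate exponents. This is the growth bound that `tendsto_setLIntegral_moll` asks
for. -/
theorem energy_density_le {r r' k Z D dz x ζ d a c Hv hv : ℝ} (hr : 2 ≤ r)
    (hrr' : r.HolderConjugate r') (hZ : 0 ≤ Z) (hD : 0 ≤ D) (hdz : 0 ≤ dz) (hdZ : dz ≤ Z)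
    (hx : 0 ≤ x) (hx1 : x ≤ 1) (hζ1 : ζ ≤ 1) (hd : 0 ≤ d) (hdD : d ≤ D)
    (hc : 0 ≤ c) (hv0 : 0 ≤ hv) (hH : Hv ≤ |a| ^ 2 + |k| ^ 2) (hh : hv ≤ |a| + |k|) :
    dz * (x * Hv) + ζ * (hv * (d * c)) ≤
      (Z * (1 + |k| ^ 2) + D * (1 + |k|)) * (1 + |a| ^ r + c ^ r') := by
  have a0 : 0 ≤ |a| ^ r := by positivity
  have c0 : 0 ≤ c ^ r' := by positivity
  have h1 : |a| ^ 2 ≤ 1 + |a| ^ r := by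
    have := rpow_le_one_add_rpow (abs_nonneg a) (by norm_num : (0 : ℝ) ≤ 2) hr
    rwa [Real.rpow_two] at this
  have h2 : c ≤ 1 + c ^ r' := by
    simpa using rpow_le_one_add_rpow hc zero_le_one hrr'.symm.lt.le
  have h3 := mul_le_rpow_add_rpow hrr' (abs_nonneg a) hc
  have t1 : dz * (x * Hv) ≤ Z * ((1 + |k| ^ 2) * (1 + |a| ^ r + c ^ r')) := by
    calc dz * (x * Hv) ≤ dz * (x * (|a| ^ 2 + |k| ^ 2)) := by gcongr
      _ ≤ Z * (1 * (|a| ^ 2 + |k| ^ 2)) := by gcongr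
      _ ≤ _ := by
        refine mul_le_mul_of_nonneg_left ?_ hZ
        have : 0 ≤ |k| ^ 2 * (|a| ^ r + c ^ r') := by positivity
        linarith
  have t2 : ζ * (hv * (d * c)) ≤ D * ((1 + |k|) * (1 + |a| ^ r + c ^ r')) := by
    calc ζ * (hv * (d * c)) ≤ 1 * ((|a| + |k|) * (D * c)) := by gcongr
      _ = D * (|a| * c + |k| * c) := by ring
      _ ≤ _ := by
        refine mul_le_mul_of_nonneg_left ?_ hD
        have h4 := mul_le_mul_of_nonneg_left h2 (abs_nonneg k)
        have h5 : 0 ≤ |k| * |a| ^ r := by positivity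
        linarith
  linarith

/-- The energy and Gagliardo-Nirenberg estimates for weak subsolutions and regularized
truncations. -/
theorem IsSubsolutionOn.lintegral_estimates_of_isTruncation (hn : 2 ≤ n)
    {O : Set (E n × ℝ)} (hO : IsOpen O) {u : E n × ℝ → ℝ} {G V : E n × ℝ → E n}
    (hu : IsSubsolutionOn O u G V) {r r' : ℝ} (hr : 2 ≤ r) (hrr' : r.HolderConjugate r')
    (hur : Integrable fun z => ‖u z‖ ^ r) (hGr : Integrable fun z => ‖G z‖ ^ r)
    (hVr : Integrable fun z => ‖V z‖ ^ r') (hVG : ∀ᵐ z, 0 ≤ inner ℝ (V z) (G z))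
    {k : ℝ} {H h g : ℝ → ℝ} (T : IsTruncation k H h g)
    {χ : E n → ℝ} {ζ : ℝ → ℝ} {t₁ τ : ℝ} (c : IsCutoff χ ζ t₁)
    (hτ : t₁ ≤ τ) (hSO : tsupport χ ×ˢ Icc t₁ τ ⊆ O)
    {p : ℝ} (hp : 1 < p) (hpr : p ≤ r) {R : ℝ≥0∞}
    (hR : R = ∫⁻ z in tsupport χ ×ˢ Icc t₁ τ, ENNReal.ofReal
      (|deriv ζ z.2| * (χ z.1 * H (u z)) + ζ z.2 * (h (u z) * (‖fderiv ℝ χ z.1‖ * ‖V z‖)))) :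
    ∫⁻ z in tsupport χ ×ˢ Icc t₁ τ,
        ENNReal.ofReal (ζ z.2 * (χ z.1 * (g (u z) * inner ℝ (V z) (G z)))) ≤ R ∧
    ∫⁻ z in tsupport χ ×ˢ Icc t₁ τ,
        ENNReal.ofReal (ζ z.2 * (χ z.1 * h (u z))) ^ (p * (n + 2) / n) ≤
      gnConst n p * (2 * R) ^ (p / n) * ∫⁻ z in tsupport χ ×ˢ Icc t₁ τ,
        ENNReal.ofReal ((ζ z.2 * (χ z.1 * (g (u z) * ‖G z‖)) +
          ζ z.2 * (h (u z) * ‖fderiv ℝ χ z.1‖)) ^ p) := by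
  have c' := c
  obtain ⟨hχ, hχc, hχ0, hχ1, hζ, hζ0, hζ1, hζt⟩ := c
  set K := tsupport χ with hK
  have hKc : IsCompact K := hχc
  set S := K ×ˢ Icc t₁ τ with hS
  have hSc : IsCompact S := hKc.prod isCompact_Icc
  have hSm : MeasurableSet S := hSc.measurableSet
  have hcH := T.continuous_H
  have hch := T.continuous_h
  have hcg := T.continuous_g
  have hcχ := hχ.continuous
  have hcζ := hζ.continuous
  have hcζ' : Continuous (deriv ζ) := hζ.continuous_deriv le_rfl
  have hcχ' : Continuous (fderiv ℝ χ) := hχ.continuous_fderiv one_ne_zero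
  have hH0 := T.H_nonneg
  have hh0 := T.h_nonneg
  have hg0 := T.g_nonneg
  have hn0 : (0 : ℝ) < n := by exact_mod_cast (by omega : 0 < n)
  have hp0 : 0 < p := by linarith
  have hr0 : 0 < r := by linarith
  -- bounds on the data
  obtain ⟨D, hD⟩ := (hχc.fderiv ℝ).exists_bound_of_continuous hcχ'
  have hD0 : 0 ≤ D := (norm_nonneg _).trans (hD 0)
  obtain ⟨Z, hZ⟩ := isCompact_Icc.exists_bound_of_continuousOn (s := Icc t₁ τ) hcζ'.continuousOn
  have hZ0 : 0 ≤ Z := (norm_nonneg _).trans (hZ t₁ ⟨le_rfl, hτ⟩)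
  have hmaxle : ∀ a : ℝ, max (a - k) 0 ≤ |a| + |k| := fun a =>
    max_le ((le_abs_self _).trans (abs_sub _ _)) (by positivity)
  have hhle : ∀ a, h a ≤ |a| + |k| := fun a => (T.h_le a).trans (hmaxle a)
  have hHle : ∀ a, H a ≤ |a| ^ 2 + |k| ^ 2 := fun a => by
    have h1 := hmaxle a
    have h2 : (0 : ℝ) ≤ max (a - k) 0 := le_max_right _ _
    have h3 := T.H_le a
    nlinarith [sq_nonneg (|a| - |k|)]
  -- convergence of the mollified integrals
  have conv1 := tendsto_setLIntegral_moll hrr'.lt.le hrr'.symm.lt.le hu.locallyIntegrable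
    hu.locallyIntegrable_grad hu.locallyIntegrable_flux hur hGr hVr hSm hSc.measure_lt_top.ne
    (Ψ := fun z a b c => |deriv ζ z.2| * (χ z.1 * H a) +
      ζ z.2 * (h a * (‖fderiv ℝ χ z.1‖ * ‖c‖)) + ζ z.2 * (χ z.1 * (g a * max (-inner ℝ c b) 0)))
    (by fun_prop) (C := Z * (1 + |k| ^ 2) + D * (1 + |k|) + 1) (by positivity) (by
      intro z hz a b c
      have e1 : |deriv ζ z.2| ≤ Z := hZ z.2 hz.2
      have e2 : ‖fderiv ℝ χ z.1‖ ≤ D := hD z.1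
      have e3 := hχ0 z.1; have e4 := hχ1 z.1; have e5 := hζ0 z.2; have e6 := hζ1 z.2
      have e7 := hH0 a; have e8 := hh0 a; have e9 := hg0 a; have e10 := T.g_le_one a
      have e12 := mul_le_rpow_add_rpow hrr' (norm_nonneg b) (norm_nonneg c)
      have e13 : max (-inner ℝ c b) 0 ≤ ‖b‖ * ‖c‖ := by
        refine max_le ((neg_le_abs _).trans ((abs_real_inner_le_norm _ _).trans ?_))
          (by positivity)
        rw [mul_comm]
      have a0 : 0 ≤ |a| ^ r := by positivity
      have b0 : 0 ≤ ‖b‖ ^ r := by positivity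
      have c0 : 0 ≤ ‖c‖ ^ r' := by positivity
      have t1 := energy_density_le hr hrr' hZ0 hD0 (abs_nonneg (deriv ζ z.2)) e1 e3 e4 e6
        (norm_nonneg (fderiv ℝ χ z.1)) e2 (norm_nonneg c) e8 (hHle a) (hhle a)
      have t2 : 0 ≤ (Z * (1 + |k| ^ 2) + D * (1 + |k|)) * ‖b‖ ^ r := by positivity
      have t3 : ζ z.2 * (χ z.1 * (g a * max (-inner ℝ c b) 0)) ≤
          1 * (1 + |a| ^ r + ‖b‖ ^ r + ‖c‖ ^ r') := by
        have e14 : (0 : ℝ) ≤ max (-inner ℝ c b) 0 := le_max_right _ _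
        calc ζ z.2 * (χ z.1 * (g a * max (-inner ℝ c b) 0)) ≤ 1 * (1 * (1 * (‖b‖ * ‖c‖))) := by
              gcongr
          _ ≤ _ := by linarith
      simp only [Real.norm_eq_abs]
      linarith)
  have conv2 := tendsto_setLIntegral_moll hrr'.lt.le hrr'.symm.lt.le hu.locallyIntegrable
    hu.locallyIntegrable_grad hu.locallyIntegrable_flux hur hGr hVr hSm hSc.measure_lt_top.ne
    (Ψ := fun z a b c => ζ z.2 * (χ z.1 * (g a * max (inner ℝ c b) 0)))
    (by fun_prop) (C := 1) (by positivity) (by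
      intro z hz a b c
      have e3 := hχ0 z.1; have e4 := hχ1 z.1; have e5 := hζ0 z.2; have e6 := hζ1 z.2
      have e9 := hg0 a; have e10 := T.g_le_one a
      have e12 := mul_le_rpow_add_rpow hrr' (norm_nonneg b) (norm_nonneg c)
      have e13 : max (inner ℝ c b) 0 ≤ ‖b‖ * ‖c‖ := by
        refine max_le ((le_abs_self _).trans ((abs_real_inner_le_norm _ _).trans ?_))
          (by positivity)
        rw [mul_comm]
      have a0 : 0 ≤ ‖a‖ ^ r := by positivity
      have e14 : (0 : ℝ) ≤ max (inner ℝ c b) 0 := le_max_right _ _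
      calc ζ z.2 * (χ z.1 * (g a * max (inner ℝ c b) 0)) ≤ 1 * (1 * (1 * (‖b‖ * ‖c‖))) := by
            gcongr
        _ ≤ _ := by linarith)
  have conv3 := tendsto_setLIntegral_moll hrr'.lt.le hrr'.symm.lt.le hu.locallyIntegrable
    hu.locallyIntegrable_grad hu.locallyIntegrable_flux hur hGr hVr hSm hSc.measure_lt_top.ne
    (Ψ := fun z a b c => (ζ z.2 * (χ z.1 * (g a * ‖b‖)) + ζ z.2 * (h a * ‖fderiv ℝ χ z.1‖)) ^ p)
    (Continuous.rpow_const (by fun_prop) fun _ => Or.inr hp0.le)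
    (C := 1 + 3 ^ r * (1 + D ^ r + (D * |k|) ^ r)) (by positivity) (by
      intro z hz a b c
      have e2 : ‖fderiv ℝ χ z.1‖ ≤ D := hD z.1
      have e3 := hχ0 z.1; have e4 := hχ1 z.1; have e5 := hζ0 z.2; have e6 := hζ1 z.2
      have e8 := hh0 a; have e9 := hg0 a; have e10 := T.g_le_one a
      have a0 : 0 ≤ |a| ^ r := by positivity
      have b0 : 0 ≤ ‖b‖ ^ r := by positivity
      have c0 : 0 ≤ ‖c‖ ^ r' := by positivity
      have D1 : 0 ≤ D ^ r := by positivity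
      have D2 : 0 ≤ (D * |k|) ^ r := by positivity
      calc _ ≤ (‖b‖ + D * |a| + D * |k|) ^ p := by
            refine Real.rpow_le_rpow (by positivity) ?_ hp0.le
            calc _ ≤ 1 * (1 * (1 * ‖b‖)) + 1 * ((|a| + |k|) * D) := by
                  gcongr
                  exact hhle a
              _ = _ := by ring
        _ ≤ 1 + (‖b‖ + D * |a| + D * |k|) ^ r :=
            rpow_le_one_add_rpow (by positivity) hp0.le hpr
        _ ≤ 1 + 3 ^ r * (‖b‖ ^ r + (D * |a|) ^ r + (D * |k|) ^ r) := by
            gcongr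
            exact add_add_rpow_le (by positivity) (by positivity) (by positivity) hr0.le
        _ ≤ 1 * (1 + |a| ^ r + ‖b‖ ^ r + ‖c‖ ^ r') +
            3 ^ r * ((1 + D ^ r + (D * |k|) ^ r) * (1 + |a| ^ r + ‖b‖ ^ r + ‖c‖ ^ r')) := by
            refine add_le_add (by linarith) (mul_le_mul_of_nonneg_left ?_ (by positivity))
            rw [Real.mul_rpow hD0 (abs_nonneg a)]
            have f1 : 0 ≤ D ^ r * (1 + ‖b‖ ^ r + ‖c‖ ^ r') := by positivity
            have f2 : 0 ≤ (D * |k|) ^ r * (|a| ^ r + ‖b‖ ^ r + ‖c‖ ^ r') := by positivity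
            linarith
        _ = _ := by simp only [Real.norm_eq_abs]; ring)
  -- the estimates for the mollified functions
  obtain ⟨δ, hδ, hδO⟩ := hSc.exists_cthickening_subset_open hO hSO
  have hev : ∀ᶠ N in atTop, ∀ z ∈ S, Metric.closedBall z (bumpSeq (E n × ℝ) N).rOut ⊆ O := by
    filter_upwards [(tendsto_bumpSeq_rOut (E n × ℝ)).eventually (ge_mem_nhds hδ)] with N hN z hz
    exact ((Metric.closedBall_subset_closedBall hN).trans
      (Metric.closedBall_subset_cthickening hz δ)).trans hδO
  have hest : ∀ᶠ N in atTop, _ := hev.mono fun N hN =>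
    lintegral_estimates_of_contDiff hn T
      ((contDiff_moll (bumpSeq _ N) hu.locallyIntegrable).of_le (by simp))
      ((contDiff_moll (bumpSeq _ N) hu.locallyIntegrable_flux).of_le (by simp))
      (contDiff_moll (bumpSeq _ N) hu.locallyIntegrable_grad).continuous c' hτ
      (fun x hx s hs => hu.fderiv_moll_fst _ (hN (x, s) ⟨hx, hs⟩))
      (fun x hx s hs => hu.fderiv_moll_snd_le _ (hN (x, s) ⟨hx, hs⟩)) hp rfl
  -- Without mollification ⟨V, G⟩ ≥ 0 almost everywhere, so the term with the negative part
  -- vanishes.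
  have hR' : ∫⁻ z in S, ENNReal.ofReal (|deriv ζ z.2| * (χ z.1 * H (u z)) +
      ζ z.2 * (h (u z) * (‖fderiv ℝ χ z.1‖ * ‖V z‖)) +
      ζ z.2 * (χ z.1 * (g (u z) * max (-inner ℝ (V z) (G z)) 0))) = R := by
    rw [hR]
    refine lintegral_congr_ae (ae_restrict_of_ae (hVG.mono fun z hz => ?_))
    simp only
    rw [max_eq_right (by linarith)]
    simp
  rw [hR'] at conv1
  constructor
  · have h1 : ∫⁻ z in S, ENNReal.ofReal (ζ z.2 * (χ z.1 * (g (u z) * inner ℝ (V z) (G z)))) =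
        ∫⁻ z in S, ENNReal.ofReal (ζ z.2 * (χ z.1 * (g (u z) * max (inner ℝ (V z) (G z)) 0))) :=
      lintegral_congr_ae (ae_restrict_of_ae (hVG.mono fun z hz => by
        simp only
        rw [max_eq_left hz]))
    rw [h1]
    exact le_of_tendsto_of_tendsto conv2.1 conv1.1 (hest.mono fun N hN => hN.1)
  · have hlim := ENNReal.Tendsto.mul (ENNReal.Tendsto.const_mul (a := gnConst n p)
      (((ENNReal.continuous_rpow_const (y := p / n)).tendsto _).comp
        (ENNReal.Tendsto.const_mul (a := 2) conv1.1 (Or.inr ENNReal.ofNat_ne_top)))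
      (Or.inr (gnConst_ne_top n hp0.le))) (Or.inr conv3.2) conv3.1
      (Or.inr (ENNReal.mul_ne_top (gnConst_ne_top n hp0.le) (ENNReal.rpow_ne_top_of_nonneg
        (by positivity) (ENNReal.mul_ne_top ENNReal.ofNat_ne_top conv1.2))))
    refine le_trans ?_ (le_of_eq hlim.liminf_eq)
    refine le_trans ?_ (liminf_le_liminf (hest.mono fun N hN => hN.2))
    -- Only Fatou's lemma is used on the left: the exponent p(n+2)/n need not be at most r, so u
    -- alone provides no majorant.
    refine le_trans (le_of_eq ?_) (lintegral_liminf_le' fun N => ?_)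
    · refine lintegral_congr_ae (ae_restrict_of_ae ?_)
      filter_upwards [ae_tendsto_moll hu.locallyIntegrable] with z hz
      refine (Tendsto.liminf_eq ?_).symm
      exact ((ENNReal.continuous_rpow_const.comp ENNReal.continuous_ofReal).tendsto _).comp
        ((((hch.tendsto _).comp hz).const_mul _).const_mul _)
    · have := (contDiff_moll (bumpSeq _ N) hu.locallyIntegrable).continuous
      exact ((Continuous.measurable (by fun_prop)).ennreal_ofReal.pow_const _).aemeasurable

end ParabolicPQ

/-! ### Removal of the regularization of the truncation -/

namespace ParabolicPQ

variable {n : ℕ}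

/-- The function g is a ramp of slope j + 1 starting at k, and h and H are its successive primitives
based at k. Starting at k, rather than centring there, makes everything vanish below k. -/
theorem exists_seq_isTruncation (k : ℝ) : ∃ H h g : ℕ → ℝ → ℝ,
    (∀ j, IsTruncation k (H j) (h j) (g j)) ∧
    (∀ s, Tendsto (fun j => h j s) atTop (𝓝 (max (s - k) 0))) ∧
    (∀ s, Tendsto (fun j => g j s) atTop (𝓝 (if k < s then 1 else 0))) := by
  set g : ℕ → ℝ → ℝ := fun j s => min (max (((j : ℝ) + 1) * (s - k)) 0) 1 with hg
  have hgc : ∀ j, Continuous (g j) := fun j => by fun_prop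
  have hg0 : ∀ j s, 0 ≤ g j s := fun j s => le_min (le_max_right _ _) zero_le_one
  have hg1 : ∀ j s, g j s ≤ 1 := fun j s => min_le_right _ _
  have hgk : ∀ j, ∀ s ≤ k, g j s = 0 := fun j s hs => by
    have : ((j : ℝ) + 1) * (s - k) ≤ 0 :=
      mul_nonpos_of_nonneg_of_nonpos (by positivity) (by linarith)
    simp [hg, max_eq_right this]
  set h : ℕ → ℝ → ℝ := fun j s => ∫ x in k..s, g j x with hh
  have hhd : ∀ j s, HasDerivAt (h j) (g j s) s := fun j s =>
    intervalIntegral.integral_hasDerivAt_right ((hgc j).intervalIntegrable _ _)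
      ((hgc j).stronglyMeasurableAtFilter _ _) (hgc j).continuousAt
  have hhc : ∀ j, Continuous (h j) := fun j =>
    continuous_iff_continuousAt.2 fun s => (hhd j s).continuousAt
  have hhk : ∀ j, ∀ s ≤ k, h j s = 0 := fun j s hs => by
    simp only [hh]
    rw [intervalIntegral.integral_congr (g := fun _ => 0)]
    · simp
    · intro x hx
      rw [uIcc_of_ge hs] at hx
      exact hgk j x hx.2
  have hgt : ∀ s, Tendsto (fun j => g j s) atTop (𝓝 (if k < s then 1 else 0)) := by
    intro s
    split_ifs with hs
    · obtain ⟨N, hN⟩ := exists_nat_gt (1 / (s - k))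
      refine tendsto_const_nhds.congr' (eventually_atTop.2 ⟨N, fun j hj => ?_⟩)
      have h1 : (N : ℝ) ≤ j := by exact_mod_cast hj
      have h2 : 0 < s - k := by linarith
      have h3 : 1 ≤ ((j : ℝ) + 1) * (s - k) := by
        rw [div_lt_iff₀ h2] at hN
        nlinarith
      simp only [hg]
      rw [max_eq_left (by linarith), min_eq_right h3]
    · refine tendsto_const_nhds.congr fun j => (hgk j s (not_lt.1 hs)).symm
  refine ⟨fun j s => ∫ x in k..s, h j x, h, g, fun j => ?_, fun s => ?_, hgt⟩
  · refine ⟨fun s => intervalIntegral.integral_hasDerivAt_right ((hhc j).intervalIntegrable _ _)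
      ((hhc j).stronglyMeasurableAtFilter _ _) (hhc j).continuousAt, hhd j, hgc j, hg0 j, hg1 j,
      fun s hs => ?_, hhk j, hgk j⟩
    simp only
    rw [intervalIntegral.integral_congr (g := fun _ => 0)]
    · simp
    · intro x hx
      rw [uIcc_of_ge hs] at hx
      exact hhk j x hx.2
  · rcases le_or_gt s k with hs | hs
    · rw [max_eq_right (by linarith)]
      exact tendsto_const_nhds.congr fun j => (hhk j s hs).symm
    · rw [max_eq_left (by linarith)]
      have : s - k = ∫ x in k..s, (1 : ℝ) := by simp
      rw [this]
      refine intervalIntegral.tendsto_integral_filter_of_dominated_convergence (fun _ => 1)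
        (Eventually.of_forall fun j => (hgc j).aestronglyMeasurable)
        (Eventually.of_forall fun j => ae_of_all _ fun x _ => ?_)
        intervalIntegrable_const (ae_of_all _ fun x hx => ?_)
      · rw [Real.norm_of_nonneg (hg0 j x)]; exact hg1 j x
      · rw [uIoc_of_le hs.le] at hx
        simpa [hx.1] using hgt x

/-- The energy and Gagliardo-Nirenberg estimates for the truncations `(u - k)₊` of weak
subsolutions. -/
theorem IsSubsolutionOn.lintegral_estimates (hn : 2 ≤ n)
    {O : Set (E n × ℝ)} (hO : IsOpen O) {u : E n × ℝ → ℝ} {G V : E n × ℝ → E n}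
    (hu : IsSubsolutionOn O u G V) {r r' : ℝ} (hr : 2 ≤ r) (hrr' : r.HolderConjugate r')
    (hur : Integrable fun z => ‖u z‖ ^ r) (hGr : Integrable fun z => ‖G z‖ ^ r)
    (hVr : Integrable fun z => ‖V z‖ ^ r') (hVG : ∀ᵐ z, 0 ≤ inner ℝ (V z) (G z))
    (k : ℝ) {χ : E n → ℝ} {ζ : ℝ → ℝ} {t₁ t₀ : ℝ} (c : IsCutoff χ ζ t₁)
    (ht : t₁ < t₀) (hSO : tsupport χ ×ˢ Ico t₁ t₀ ⊆ O)
    {p : ℝ} (hp : 1 < p) (hpr : p ≤ r) {R : ℝ≥0∞}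
    (hR : R = ∫⁻ z in tsupport χ ×ˢ Ico t₁ t₀, ENNReal.ofReal
      (|deriv ζ z.2| * (χ z.1 * (max (u z - k) 0 ^ 2 / 2)) +
        ζ z.2 * (max (u z - k) 0 * (‖fderiv ℝ χ z.1‖ * ‖V z‖)))) :
    R ≠ ⊤ ∧
    ∫⁻ z in tsupport χ ×ˢ Ico t₁ t₀, ENNReal.ofReal
        (ζ z.2 * (χ z.1 * ((if k < u z then 1 else 0) * inner ℝ (V z) (G z)))) ≤ R ∧
    ∫⁻ z in tsupport χ ×ˢ Ico t₁ t₀,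
        ENNReal.ofReal (ζ z.2 * (χ z.1 * max (u z - k) 0)) ^ (p * (n + 2) / n) ≤
      gnConst n p * (2 * R) ^ (p / n) * ∫⁻ z in tsupport χ ×ˢ Ico t₁ t₀,
        ENNReal.ofReal ((ζ z.2 * (χ z.1 * ((if k < u z then 1 else 0) * ‖G z‖)) +
          ζ z.2 * (max (u z - k) 0 * ‖fderiv ℝ χ z.1‖)) ^ p) := by
  obtain ⟨H, h, g, hT, hlim, glim⟩ := exists_seq_isTruncation k
  set S := tsupport χ ×ˢ Ico t₁ t₀ with hS
  have hKm : MeasurableSet (tsupport χ) := (isClosed_tsupport χ).measurableSet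
  have hSm : MeasurableSet S := hKm.prod measurableSet_Ico
  have hn0 : (0 : ℝ) < n := by exact_mod_cast (by omega : 0 < n)
  have hp0 : 0 < p := by linarith
  have hcχ := c.contDiff_space.continuous
  have hcζ := c.contDiff_time.continuous
  have hcζ' : Continuous (deriv ζ) := c.contDiff_time.continuous_deriv le_rfl
  have hcχ' : Continuous (fderiv ℝ χ) := c.contDiff_space.continuous_fderiv one_ne_zero
  have hζ0 := c.time_nonneg
  have hχ0 := c.space_nonneg
  have hum : AEMeasurable u := hu.locallyIntegrable.aestronglyMeasurable.aemeasurable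
  have hVm : AEMeasurable V := hu.locallyIntegrable_flux.aestronglyMeasurable.aemeasurable
  have hGm : AEMeasurable G := hu.locallyIntegrable_grad.aestronglyMeasurable.aemeasurable
  constructor
  · obtain ⟨D, hD⟩ := (c.hasCompactSupport.fderiv ℝ).exists_bound_of_continuous hcχ'
    have hD0 : 0 ≤ D := (norm_nonneg _).trans (hD 0)
    obtain ⟨Z, hZ⟩ := isCompact_Icc.exists_bound_of_continuousOn (s := Icc t₁ t₀) hcζ'.continuousOn
    have hZ0 : 0 ≤ Z := (norm_nonneg _).trans (hZ t₁ ⟨le_rfl, ht.le⟩)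
    have hSfin : volume S ≠ ⊤ := ((measure_mono (prod_mono_right Ico_subset_Icc_self)).trans_lt
      (c.hasCompactSupport.isCompact.prod isCompact_Icc).measure_lt_top).ne
    rw [hR]
    refine (tendsto_setLIntegral_moll hrr'.lt.le hrr'.symm.lt.le hu.locallyIntegrable
      hu.locallyIntegrable_grad hu.locallyIntegrable_flux hur hGr hVr hSm hSfin
      (Ψ := fun z a b c => |deriv ζ z.2| * (χ z.1 * (max (a - k) 0 ^ 2 / 2)) +
        ζ z.2 * (max (a - k) 0 * (‖fderiv ℝ χ z.1‖ * ‖c‖)))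
      (by fun_prop) (C := Z * (1 + |k| ^ 2) + D * (1 + |k|)) (by positivity) ?_).2
    intro z hz a b d
    have h1 : max (a - k) 0 ≤ |a| + |k| :=
      max_le ((le_abs_self _).trans (abs_sub _ _)) (by positivity)
    have h2 : (0 : ℝ) ≤ max (a - k) 0 := le_max_right _ _
    have h3 : max (a - k) 0 ^ 2 / 2 ≤ |a| ^ 2 + |k| ^ 2 := by
      nlinarith [sq_nonneg (|a| - |k|)]
    refine (energy_density_le hr hrr' hZ0 hD0 (abs_nonneg (deriv ζ z.2))
      (hZ z.2 ⟨hz.2.1, hz.2.2.le⟩) (hχ0 z.1) (c.space_le_one z.1) (c.time_le_one z.2)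
        (norm_nonneg (fderiv ℝ χ z.1)) (hD z.1) (norm_nonneg d) h2 h3 h1).trans ?_
    refine mul_le_mul_of_nonneg_left ?_ (by positivity)
    have : 0 ≤ ‖b‖ ^ r := by positivity
    rw [Real.norm_eq_abs]
    linarith
  -- The final time t₀ may lie on the boundary of O, where the mollification is not available; the
  -- half-open time interval is exhausted by compact ones.
  set τ : ℕ → ℝ := fun j => t₀ - (t₀ - t₁) / ((j : ℝ) + 1) with hτ
  have hτ1 : ∀ j, t₁ ≤ τ j := fun j => by
    have h1 : (0 : ℝ) < (j : ℝ) + 1 := by positivity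
    have : (t₀ - t₁) / ((j : ℝ) + 1) ≤ t₀ - t₁ :=
      div_le_self (by linarith) (by linarith [(Nat.cast_nonneg j : (0 : ℝ) ≤ j)])
    simp only [hτ]; linarith
  have hτ2 : ∀ j, τ j < t₀ := fun j => by
    have : 0 < (t₀ - t₁) / ((j : ℝ) + 1) := div_pos (by linarith) (by positivity)
    simp only [hτ]; linarith
  have hτ3 : Tendsto τ atTop (𝓝 t₀) := by
    have : Tendsto (fun j : ℕ => (t₀ - t₁) / ((j : ℝ) + 1)) atTop (𝓝 0) := by
      have := (tendsto_one_div_add_atTop_nhds_zero_nat (𝕜 := ℝ)).const_mul (t₀ - t₁)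
      simpa [div_eq_mul_inv] using this
    simpa using tendsto_const_nhds.sub this
  set A : ℕ → Set (E n × ℝ) := fun j => tsupport χ ×ˢ Icc t₁ (τ j) with hA
  have hAm : ∀ j, MeasurableSet (A j) := fun j => hKm.prod measurableSet_Icc
  have hAS : ∀ j, A j ⊆ S := fun j =>
    prod_mono_right fun t ht' => ⟨ht'.1, ht'.2.trans_lt (hτ2 j)⟩
  have hAev : ∀ z ∈ S, ∀ᶠ j in atTop, z ∈ A j := fun z hz => by
    filter_upwards [hτ3.eventually (lt_mem_nhds hz.2.2)] with j hj
    exact ⟨hz.1, hz.2.1, hj.le⟩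
  -- The regularized quantities stay below their limits, so the right-hand side needs no convergence
  -- argument.
  have hRj : ∀ j, ∫⁻ z in A j, ENNReal.ofReal (|deriv ζ z.2| * (χ z.1 * H j (u z)) +
      ζ z.2 * (h j (u z) * (‖fderiv ℝ χ z.1‖ * ‖V z‖))) ≤ R := by
    intro j
    rw [hR]
    refine (lintegral_mono_set (hAS j)).trans (lintegral_mono fun z => ENNReal.ofReal_le_ofReal ?_)
    have h1 := (hT j).H_le (u z); have h2 := (hT j).h_le (u z)
    have h3 := hζ0 z.2; have h4 := hχ0 z.1
    gcongr
  have hest := fun j => hu.lintegral_estimates_of_isTruncation hn hO hr hrr' hur hGr hVr hVG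
    (hT j) c (hτ1 j) ((hAS j).trans hSO) hp hpr rfl
  -- Fatou's lemma on increasing sets
  have fatou : ∀ (f : ℕ → E n × ℝ → ℝ≥0∞) (F : E n × ℝ → ℝ≥0∞) (B : ℝ≥0∞),
      (∀ j, AEMeasurable (f j)) → (∀ z, Tendsto (fun j => f j z) atTop (𝓝 (F z))) →
      (∀ j, ∫⁻ z in A j, f j z ≤ B) → ∫⁻ z in S, F z ≤ B := by
    intro f F B hf hfF hB
    rw [← lintegral_indicator hSm]
    calc ∫⁻ z, S.indicator F z ≤ ∫⁻ z, liminf (fun j => (A j).indicator (f j) z) atTop := by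
          refine lintegral_mono fun z => ?_
          by_cases hz : z ∈ S
          · rw [indicator_of_mem hz]
            refine ((hfF z).congr' ?_).liminf_eq.ge
            filter_upwards [hAev z hz] with j hj
            rw [indicator_of_mem hj]
          · rw [indicator_of_notMem hz]; exact zero_le
      _ ≤ liminf (fun j => ∫⁻ z, (A j).indicator (f j) z) atTop :=
          lintegral_liminf_le' fun j => (hf j).indicator (hAm j)
      _ ≤ B := by
          refine liminf_le_of_frequently_le' (Eventually.frequently (Eventually.of_forall fun j => ?_))
          rw [lintegral_indicator (hAm j)]
          exact hB j
  constructor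
  · refine fatou (fun j z => ENNReal.ofReal
      (ζ z.2 * (χ z.1 * (g j (u z) * inner ℝ (V z) (G z))))) _ R (fun j => ?_) (fun z => ?_)
      fun j => (hest j).1.trans (hRj j)
    · have h1 : AEMeasurable fun z => g j (u z) := (hT j).continuous_g.measurable.comp_aemeasurable hum
      have h2 : AEMeasurable fun z => inner ℝ (V z) (G z) := hVm.inner hGm
      exact ((by fun_prop : Measurable fun z : E n × ℝ => ζ z.2).aemeasurable.mul
        ((by fun_prop : Measurable fun z : E n × ℝ => χ z.1).aemeasurable.mul
          (h1.mul h2))).ennreal_ofReal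
    · exact (ENNReal.continuous_ofReal.tendsto _).comp
        ((((glim (u z)).mul_const _).const_mul _).const_mul _)
  · refine fatou (fun j z => ENNReal.ofReal (ζ z.2 * (χ z.1 * h j (u z))) ^ (p * (n + 2) / n)) _ _
      (fun j => ?_) (fun z => ?_) fun j => (hest j).2.trans ?_
    · have h1 : AEMeasurable fun z => h j (u z) := (hT j).continuous_h.measurable.comp_aemeasurable hum
      exact ((by fun_prop : Measurable fun z : E n × ℝ => ζ z.2).aemeasurable.mul
        ((by fun_prop : Measurable fun z : E n × ℝ => χ z.1).aemeasurable.mul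
          h1)).ennreal_ofReal.pow_const _
    · exact ((ENNReal.continuous_rpow_const.comp ENNReal.continuous_ofReal).tendsto _).comp
        (((hlim (u z)).const_mul _).const_mul _)
    · refine mul_le_mul' (mul_le_mul_right (ENNReal.rpow_le_rpow (mul_le_mul_right (hRj j) _)
        (by positivity)) _) ?_
      refine (lintegral_mono_set (hAS j)).trans (lintegral_mono fun z => ENNReal.ofReal_le_ofReal ?_)
      have h1 : g j (u z) ≤ if k < u z then 1 else 0 := by
        split_ifs with hk
        · exact (hT j).g_le_one _
        · exact ((hT j).g_eq_zero _ (not_lt.1 hk)).le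
      have h2 := (hT j).h_le (u z)
      have h3 := hζ0 z.2; have h4 := hχ0 z.1; have h5 := (hT j).g_nonneg (u z)
      have h6 := (hT j).h_nonneg (u z)
      refine Real.rpow_le_rpow (by positivity) ?_ hp0.le
      gcongr

end ParabolicPQ

/-! ### From the equation to a subsolution with gradient and flux on the whole space-time -/

namespace ParabolicPQ

variable {n : ℕ}

/-- For simple f the composition is a finite sum of the measurable functions A(·, y) restricted to
level sets; continuity in the second variable passes this to limits of simple functions. -/
theorem aestronglyMeasurable_caratheodory {Z X Y : Type*} [MeasurableSpace Z]
    [TopologicalSpace X] [NormedAddCommGroup Y] {ν : Measure Z} {A : Z → X → Y}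
    (hA : ∀ ξ, AEStronglyMeasurable (fun z => A z ξ) ν) (hc : ∀ᵐ z ∂ν, Continuous (A z))
    {f : Z → X} (hf : AEStronglyMeasurable f ν) :
    AEStronglyMeasurable (fun z => A z (f z)) ν := by
  classical
  obtain ⟨f', hf', hff'⟩ := hf
  have h1 : ∀ N, AEStronglyMeasurable (fun z => A z (hf'.approx N z)) ν := by
    intro N
    set s := hf'.approx N
    have : (fun z => A z (s z)) =
        fun z => ∑ y ∈ s.range, (s ⁻¹' {y}).indicator (fun z => A z y) z := by
      ext z
      rw [Finset.sum_eq_single (s z)]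
      · simp
      · intro y _ hy
        exact indicator_of_notMem (fun h => hy (by simpa using h.symm)) _
      · intro h; exact (h (s.mem_range_self z)).elim
    rw [this]
    exact Finset.aestronglyMeasurable_fun_sum _ fun y _ =>
      (hA y).indicator (s.measurableSet_preimage {y})
  refine aestronglyMeasurable_of_tendsto_ae atTop h1 ?_
  filter_upwards [hc, hff'] with z hz hz'
  rw [hz']
  exact (hz.tendsto _).comp (hf'.tendsto_approx z)

theorem measurableSet_spaceTime {Ω : Set (E n)} (hΩ : IsOpen Ω) (T : ℝ) :
    MeasurableSet (spaceTime Ω T) := hΩ.measurableSet.prod measurableSet_Ioo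

theorem isOpen_spaceTime {Ω : Set (E n)} (hΩ : IsOpen Ω) (T : ℝ) :
    IsOpen (spaceTime Ω T) := hΩ.prod isOpen_Ioo

theorem inner_gradient_slice {φ : E n × ℝ → ℝ} (hφ : ContDiff ℝ ∞ φ) (x : E n) (t : ℝ) (ξ : E n) :
    inner ℝ ξ (gradient (fun y => φ (y, t)) x) = fderiv ℝ φ (x, t) (ξ, 0) := by
  rw [real_inner_comm, ← fderiv_prodMk_right (hφ.of_le (by simp))]
  rw [gradient, InnerProductSpace.toDual_symm_apply]

/-- The weak gradient in the spatial variables, tested with functions of space and time. -/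
theorem MemBochnerSobolev.integral_indicator_grad {Ω : Set (E n)} (hΩ : IsOpen Ω) {T r : ℝ}
    (hr : 1 ≤ r) {u : E n × ℝ → ℝ} {Du : E n × ℝ → E n} (hu : MemBochnerSobolev Ω T r u Du)
    {φ : E n × ℝ → ℝ} (hφ : ContDiff ℝ ∞ φ) (hφc : HasCompactSupport φ)
    (hφs : tsupport φ ⊆ spaceTime Ω T) (ξ : E n) :
    ∫ z, (spaceTime Ω T).indicator u z * fderiv ℝ φ z (ξ, 0) =
      -∫ z, φ z * inner ℝ ((spaceTime Ω T).indicator Du z) ξ := by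
  have hm := measurableSet_spaceTime hΩ T
  have hr1 : (1 : ℝ≥0∞) ≤ ENNReal.ofReal r := by simpa using ENNReal.ofReal_le_ofReal hr
  have hul : LocallyIntegrable ((spaceTime Ω T).indicator u) :=
    ((memLp_indicator_iff_restrict hm).2 hu.memLp).locallyIntegrable hr1
  have hDl : LocallyIntegrable ((spaceTime Ω T).indicator Du) :=
    ((memLp_indicator_iff_restrict hm).2 hu.memLp_grad).locallyIntegrable hr1
  have hφ1 : ContDiff ℝ 1 φ := hφ.of_le (by simp)
  have hdc : Continuous fun z => fderiv ℝ φ z (ξ, 0) :=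
    (hφ1.continuous_fderiv one_ne_zero).clm_apply continuous_const
  have i1 : Integrable fun z => (spaceTime Ω T).indicator u z * fderiv ℝ φ z (ξ, 0) :=
    hul.integrable_smul_right_of_hasCompactSupport hdc (hφc.fderiv_apply ℝ _)
  have i2 : Integrable fun z => φ z * inner ℝ ((spaceTime Ω T).indicator Du z) ξ := by
    have := (hDl.integrable_smul_left_of_hasCompactSupport hφ.continuous hφc).inner_const
      (𝕜 := ℝ) ξ
    simpa [real_inner_smul_left] using this
  rw [Measure.volume_eq_prod, integral_prod_symm _ i1, integral_prod_symm _ i2, ← integral_neg]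
  refine integral_congr_ae ?_
  have hsl := hu.slice
  rw [ae_restrict_iff' measurableSet_Ioo] at hsl
  filter_upwards [hsl] with t ht
  by_cases htT : t ∈ Ioo 0 T
  · have hS := ht htT
    have hind : ∀ {F : Type} [NormedAddCommGroup F] (f : E n × ℝ → F) (x : E n),
        (spaceTime Ω T).indicator f (x, t) = Ω.indicator (fun x => f (x, t)) x := by
      intro F _ f x
      by_cases hx : x ∈ Ω
      · have hxt : (x, t) ∈ spaceTime Ω T := ⟨hx, htT⟩
        rw [indicator_of_mem hx, indicator_of_mem hxt]
      · rw [indicator_of_notMem hx, indicator_of_notMem fun h => hx h.1]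
    have hψ : ContDiff ℝ ∞ fun x => φ (x, t) := hφ.comp (by fun_prop)
    have hψs : tsupport (fun x => φ (x, t)) ⊆ (fun x => (x, t)) ⁻¹' tsupport φ :=
      tsupport_comp_subset_preimage (f := fun x : E n => (x, t)) φ (by fun_prop)
    have hψc : HasCompactSupport fun x => φ (x, t) := by
      refine (hφc.isCompact.image continuous_fst).of_isClosed_subset (isClosed_tsupport _)
        fun x hx => ⟨(x, t), hψs hx, rfl⟩
    have h := hS.integral_eq _ hψ hψc fun x hx => (hφs (hψs hx)).1
    have hgrad : ∀ x, inner ℝ ξ (gradient (fun y => φ (y, t)) x) = fderiv ℝ φ (x, t) (ξ, 0) :=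
      fun x => inner_gradient_slice hφ x t ξ
    have hgc : Continuous fun x => gradient (fun y => φ (y, t)) x :=
      (InnerProductSpace.toDual ℝ (E n)).symm.continuous.comp
        ((hψ.of_le (m := 1) (by simp)).continuous_fderiv one_ne_zero)
    have hgs : HasCompactSupport fun x => gradient (fun y => φ (y, t)) x :=
      (hψc.fderiv ℝ).comp_left (g := (InnerProductSpace.toDual ℝ (E n)).symm) (map_zero _)
    have j1 : Integrable (fun x => u (x, t) • gradient (fun y => φ (y, t)) x)
        (volume.restrict Ω) :=
      (hS.memLp.locallyIntegrable hr1).integrable_smul_right_of_hasCompactSupport hgc hgs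
    have j2 : Integrable (fun x => φ (x, t) • Du (x, t)) (volume.restrict Ω) :=
      (hS.memLp_grad.locallyIntegrable hr1).integrable_smul_left_of_hasCompactSupport
        hψ.continuous hψc
    have h' := congrArg (fun y => inner ℝ ξ y) h
    simp only [inner_neg_right] at h'
    rw [← integral_inner j1, ← integral_inner j2] at h'
    simp only [hind]
    convert h' using 1
    · rw [← integral_indicator hΩ.measurableSet]
      refine integral_congr_ae (ae_of_all _ fun x => ?_)
      by_cases hx : x ∈ Ω
      · simp [hx, real_inner_smul_right, hgrad]
      · simp [hx]
    · rw [← integral_indicator hΩ.measurableSet]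
      congr 1
      refine integral_congr_ae (ae_of_all _ fun x => ?_)
      by_cases hx : x ∈ Ω
      · simp [hx, real_inner_smul_right, real_inner_comm]
      · simp [hx]
  · have h0 : ∀ x, (x, t) ∉ spaceTime Ω T := fun x h => htT h.2
    simp [h0]

theorem indicator_norm_rpow {X F : Type*} [NormedAddCommGroup F] {s : ℝ} (hs : 0 < s) (S : Set X)
    (f : X → F) : (fun z => ‖S.indicator f z‖ ^ s) = S.indicator fun z => ‖f z‖ ^ s := by
  ext z
  by_cases hz : z ∈ S
  · simp [hz]
  · simp [hz, Real.zero_rpow hs.ne']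

/-- A weak subsolution of the equation with `p,q`-growth, extended by zero to the whole
space-time, together with its spatial gradient `G` and its flux `V`. -/
theorem IsWeakSubsolution.exists_isSubsolutionOn {p q α β : ℝ} (hp : 2 ≤ p) (hpq : p ≤ q)
    (hβ : 1 < β) {Ω : Set (E n)} {T μ : ℝ} {a b : E n × ℝ → ℝ} {𝒜 : E n × ℝ → E n → E n}
    {u : E n × ℝ → ℝ} (hΩ : IsOpen Ω) (hΩb : Bornology.IsBounded Ω)
    (hμ : 0 ≤ μ) (hμ1 : μ ≤ 1) (hA : IsCaratheodory Ω T 𝒜) (hg : HasPQGrowth Ω T p q α β μ a b 𝒜)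
    (hu : IsWeakSubsolution Ω T (qExp q β) 𝒜 u) {r' : ℝ} (hr' : (qExp q β).HolderConjugate r') :
    ∃ G V : E n × ℝ → E n,
      IsSubsolutionOn (spaceTime Ω T) ((spaceTime Ω T).indicator u) G V ∧
      (Integrable fun z => ‖(spaceTime Ω T).indicator u z‖ ^ qExp q β) ∧
      (Integrable fun z => ‖G z‖ ^ qExp q β) ∧ (Integrable fun z => ‖V z‖ ^ r') ∧
      (∀ᵐ z, 0 ≤ inner ℝ (V z) (G z)) ∧
      ∀ᵐ z ∂(volume.restrict (spaceTime Ω T)), a z * ‖G z‖ ^ p ≤ inner ℝ (V z) (G z) ∧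
        ‖V z‖ ≤ b z * (1 + ‖G z‖) ^ (q - 1) := by
  obtain ⟨Du, hB, -, hweak⟩ := hu
  set S := spaceTime Ω T with hS
  have hm : MeasurableSet S := measurableSet_spaceTime hΩ T
  set r := qExp q β with hr
  have hr1 : 1 < r := hr'.lt
  have hr0 : 0 < r := by linarith
  have hr'0 : 0 < r' := hr'.symm.pos
  have hβ0 : 0 < β := by linarith
  have hr1' : (1 : ℝ≥0∞) ≤ ENNReal.ofReal r := by simpa using ENNReal.ofReal_le_ofReal hr1.le
  have hSfin : volume S ≠ ⊤ := by
    have h1 : volume S = volume Ω * volume (Ioo 0 T) := by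
      rw [hS, spaceTime, Measure.volume_eq_prod, Measure.prod_prod]
    rw [h1]
    exact ENNReal.mul_ne_top hΩb.measure_lt_top.ne (by simp)
  have : IsFiniteMeasure (volume.restrict S) := ⟨by simpa using hSfin.lt_top⟩
  set W : E n × ℝ → E n := fun z => 𝒜 z (Du z) with hW
  have hWm : AEStronglyMeasurable W (volume.restrict S) :=
    aestronglyMeasurable_caratheodory hA.measurable hA.continuous hB.memLp_grad.1
  -- Since 0 ≤ μ ≤ 1, μ² + |ξ|² ≤ (1 + |ξ|)².
  have hWle : ∀ᵐ z ∂(volume.restrict S), ‖W z‖ ≤ b z * (1 + ‖Du z‖) ^ (q - 1) := by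
    filter_upwards [hg.growth, hg.b_nonneg] with z hz hb
    refine (hz (Du z)).trans (mul_le_mul_of_nonneg_left ?_ hb)
    have h1 : (1 + ‖Du z‖) ^ (q - 1) = ((1 + ‖Du z‖) ^ 2) ^ ((q - 1) / 2) := by
      rw [← Real.rpow_two, ← Real.rpow_mul (by positivity)]
      congr 1; ring
    rw [h1]
    refine Real.rpow_le_rpow (by positivity) ?_ (by linarith)
    nlinarith [norm_nonneg (Du z)]
  -- As p ≥ 2, μ² may be dropped from the coercivity. A vanishing gradient is treated apart because
  -- the powers are split by a rule for positive bases.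
  have hWc : ∀ᵐ z ∂(volume.restrict S), a z * ‖Du z‖ ^ p ≤ inner ℝ (W z) (Du z) := by
    filter_upwards [hg.coercive, hg.a_pos] with z hz ha
    refine le_trans ?_ (hz (Du z))
    rcases (norm_nonneg (Du z)).eq_or_lt with h0 | h0
    · rw [← h0, Real.zero_rpow (by linarith)]; simp
    · have h1 : ‖Du z‖ ^ p = (‖Du z‖ ^ 2) ^ ((p - 2) / 2) * ‖Du z‖ ^ 2 := by
        rw [← Real.rpow_two, ← Real.rpow_mul h0.le, ← Real.rpow_add h0]
        congr 1; ring
      rw [h1, mul_assoc]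
      gcongr
      nlinarith [sq_nonneg μ]
  have hDr : Integrable (fun z => ‖Du z‖ ^ r) (volume.restrict S) := by
    have := hB.memLp_grad.integrable_norm_rpow (by simpa using hr0) (by simp)
    rwa [ENNReal.toReal_ofReal hr0.le] at this
  have hur : Integrable (fun z => ‖u z‖ ^ r) (volume.restrict S) := by
    have := hB.memLp.integrable_norm_rpow (by simpa using hr0) (by simp)
    rwa [ENNReal.toReal_ofReal hr0.le] at this
  have hbr : Integrable (fun z => ‖b z‖ ^ β) (volume.restrict S) := by
    have := hg.memLp_b.integrable_norm_rpow (by simpa using hβ0) (by simp)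
    rwa [ENNReal.toReal_ofReal hβ0.le] at this
  have hWr : Integrable (fun z => ‖W z‖ ^ r') (volume.restrict S) := by
    -- With r = q_β one has 1/r' = 1/β + (q-1)/r. These are the weights of the arithmetic-geometric
    -- mean inequality that puts b(1 + |Du|)^(q-1) in L^r'.
    have hexp : r' / β + (q - 1) * r' / r = 1 := by
      have h1 : 1 / r' = 1 - 1 / r := by
        have := hr'.inv_add_inv_eq_one
        simp only [one_div]; linarith
      have h2 : 1 / r = (β - 1) / (q * β) := by
        rw [hr, qExp, one_div_div]
      have h3 : r' / β + (q - 1) * r' / r = r' * (1 / β + (q - 1) * (1 / r)) := by ring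
      have h4 : 1 / β + (q - 1) * (1 / r) = 1 / r' := by
        rw [h1, h2]
        have : q ≠ 0 := by linarith
        field_simp
        ring
      rw [h3, h4, mul_one_div_cancel hr'0.ne']
    refine Integrable.mono' (hbr.add (((integrable_const (1 : ℝ)).add hDr).const_mul (3 ^ r)))
      (hWm.norm.aemeasurable.pow_const _).aestronglyMeasurable ?_
    filter_upwards [hWle, hg.b_nonneg] with z hz hb
    have hy : (0 : ℝ) ≤ 1 + ‖Du z‖ := by positivity
    rw [Real.norm_of_nonneg (by positivity)]
    calc ‖W z‖ ^ r' ≤ (b z * (1 + ‖Du z‖) ^ (q - 1)) ^ r' := by gcongr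
      _ = (b z ^ β) ^ (r' / β) * ((1 + ‖Du z‖) ^ r) ^ ((q - 1) * r' / r) := by
          rw [Real.mul_rpow hb (by positivity), ← Real.rpow_mul hb, ← Real.rpow_mul hy,
            ← Real.rpow_mul hy]
          congr 2 <;> field_simp
      _ ≤ r' / β * b z ^ β + (q - 1) * r' / r * (1 + ‖Du z‖) ^ r :=
          Real.geom_mean_le_arith_mean2_weighted (by positivity)
            (div_nonneg (mul_nonneg (by linarith) hr'0.le) hr0.le) (by positivity) (by positivity)
            hexp
      _ ≤ 1 * b z ^ β + 1 * (1 + ‖Du z‖) ^ r := by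
          have h1 : 0 ≤ r' / β := by positivity
          have h2 : 0 ≤ (q - 1) * r' / r := div_nonneg (mul_nonneg (by linarith) hr'0.le) hr0.le
          gcongr <;> linarith
      _ ≤ ‖b z‖ ^ β + 3 ^ r * (1 + ‖Du z‖ ^ r) := by
          rw [one_mul, one_mul, Real.norm_of_nonneg hb]
          gcongr
          have := add_add_rpow_le zero_le_one (norm_nonneg (Du z)) le_rfl hr0.le
          simpa [Real.zero_rpow hr0.ne'] using this
  have hWL : MemLp W (ENNReal.ofReal r') (volume.restrict S) := by
    rw [← integrable_norm_rpow_iff hWm (by simpa using hr'0) (by simp),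
      ENNReal.toReal_ofReal hr'0.le]
    exact hWr
  have hr1'' : (1 : ℝ≥0∞) ≤ ENNReal.ofReal r' := by
    simpa using ENNReal.ofReal_le_ofReal hr'.symm.lt.le
  refine ⟨S.indicator Du, S.indicator W, ⟨?_, ?_, ?_, ?_, ?_⟩, ?_, ?_, ?_, ?_, ?_⟩
  · exact ((memLp_indicator_iff_restrict hm).2 hB.memLp).locallyIntegrable hr1'
  · exact ((memLp_indicator_iff_restrict hm).2 hB.memLp_grad).locallyIntegrable hr1'
  · exact ((memLp_indicator_iff_restrict hm).2 hWL).locallyIntegrable hr1''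
  · intro φ hφ hφc hφs ξ
    exact hB.integral_indicator_grad hΩ hr1.le hφ hφc hφs ξ
  · intro φ hφ hφc hφs hφ0
    refine le_trans (le_of_eq ?_) (hweak φ hφ hφc hφs hφ0)
    rw [← integral_indicator hm]
    refine integral_congr_ae (ae_of_all _ fun z => ?_)
    by_cases hz : z ∈ S
    · simp only [hz, indicator_of_mem]
      have h1 := (hasDerivAt_prodMk (hφ.of_le (m := 1) (by simp)) z.1 z.2).deriv
      rw [inner_gradient_slice hφ, h1]
    · simp only [hz, not_false_eq_true, indicator_of_notMem, zero_mul, neg_zero, zero_add]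
      exact map_zero _
  · rw [indicator_norm_rpow hr0, integrable_indicator_iff hm]; exact hur
  · rw [indicator_norm_rpow hr0, integrable_indicator_iff hm]; exact hDr
  · rw [indicator_norm_rpow hr'0, integrable_indicator_iff hm]; exact hWr
  · have h1 : ∀ᵐ z ∂(volume.restrict S), 0 ≤ inner ℝ (W z) (Du z) := by
      filter_upwards [hWc, hg.a_pos] with z hz ha
      exact le_trans (by positivity) hz
    rw [ae_restrict_iff' hm] at h1
    filter_upwards [h1] with z hz
    by_cases hzS : z ∈ S
    · simpa [hzS] using hz hzS
    · simp [hzS]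
  · filter_upwards [hWc, hWle, ae_restrict_mem hm] with z h1 h2 hzS
    simpa [hzS] using ⟨h1, h2⟩

end ParabolicPQ

/-! ### Cutoff functions -/

namespace ParabolicPQ

variable {n : ℕ}

theorem hasDerivAt_max_zero_rpow {γ : ℝ} (hγ : 1 < γ) (s : ℝ) :
    HasDerivAt (fun s => max s 0 ^ γ) (γ * max s 0 ^ (γ - 1)) s := by
  have hne : ∀ s : ℝ, s ≠ 0 → HasDerivAt (fun s => max s 0 ^ γ) (γ * max s 0 ^ (γ - 1)) s := by
    intro s hs
    rcases lt_or_gt_of_ne hs with h | h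
    · rw [max_eq_right h.le, Real.zero_rpow (by linarith), mul_zero]
      refine (hasDerivAt_const s (0 : ℝ)).congr_of_eventuallyEq ?_
      filter_upwards [gt_mem_nhds h] with x hx
      rw [max_eq_right hx.le, Real.zero_rpow (by linarith)]
    · rw [max_eq_left h.le]
      refine (Real.hasDerivAt_rpow_const (Or.inl hs)).congr_of_eventuallyEq ?_
      filter_upwards [lt_mem_nhds h] with x hx
      rw [max_eq_left hx.le]
  rcases eq_or_ne s 0 with rfl | hs
  · refine hasDerivAt_of_hasDerivAt_of_ne (fun y hy => hne y hy) ?_ ?_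
    · exact ((continuous_id.max continuous_const).rpow_const
        fun _ => Or.inr (by linarith)).continuousAt
    · exact (continuous_const.mul ((continuous_id.max continuous_const).rpow_const
        fun _ => Or.inr (by linarith))).continuousAt
  · exact hne s hs

/-- A cutoff profile: `1` on `(-∞, 0]`, `0` on `[1, ∞)`. -/
noncomputable def profile (N τ : ℝ) : ℝ := max (1 - max τ 0 ^ (2 : ℝ)) 0 ^ N

/-- The derivative of the cutoff profile. -/
noncomputable def profileDeriv (N τ : ℝ) : ℝ :=
  N * max (1 - max τ 0 ^ (2 : ℝ)) 0 ^ (N - 1) * -(2 * max τ 0 ^ ((2 : ℝ) - 1))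

theorem hasDerivAt_profile {N : ℝ} (hN : 1 < N) (τ : ℝ) :
    HasDerivAt (profile N) (profileDeriv N τ) τ := by
  have h1 := (hasDerivAt_max_zero_rpow (by norm_num : (1 : ℝ) < 2) τ).const_sub 1
  exact (hasDerivAt_max_zero_rpow hN (1 - max τ 0 ^ (2 : ℝ))).comp τ h1

theorem contDiff_profile {N : ℝ} (hN : 1 < N) : ContDiff ℝ 1 (profile N) := by
  rw [contDiff_one_iff_deriv]
  refine ⟨fun s => (hasDerivAt_profile hN s).differentiableAt, ?_⟩
  have : deriv (profile N) = profileDeriv N := funext fun s => (hasDerivAt_profile hN s).deriv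
  rw [this]
  have h1 : Continuous fun τ : ℝ => max τ 0 ^ (2 : ℝ) :=
    (continuous_id.max continuous_const).rpow_const fun _ => Or.inr (by norm_num)
  have h2 : Continuous fun τ : ℝ => max τ 0 ^ ((2 : ℝ) - 1) :=
    (continuous_id.max continuous_const).rpow_const fun _ => Or.inr (by norm_num)
  exact (continuous_const.mul (((continuous_const.sub h1).max continuous_const).rpow_const
    fun _ => Or.inr (by linarith))).mul (continuous_const.mul h2).neg

theorem profile_nonneg (N τ : ℝ) : 0 ≤ profile N τ := Real.rpow_nonneg (le_max_right _ _) _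

theorem profile_le_one {N : ℝ} (hN : 1 < N) (τ : ℝ) : profile N τ ≤ 1 := by
  refine Real.rpow_le_one (le_max_right _ _) (max_le ?_ zero_le_one) (by linarith)
  have : 0 ≤ max τ 0 ^ (2 : ℝ) := Real.rpow_nonneg (le_max_right _ _) _
  linarith

theorem profile_of_nonpos {N τ : ℝ} (hτ : τ ≤ 0) : profile N τ = 1 := by
  simp [profile, max_eq_right hτ]

theorem profile_of_one_le {N τ : ℝ} (hN : 1 < N) (hτ : 1 ≤ τ) : profile N τ = 0 := by
  have h : 1 ≤ max τ 0 ^ (2 : ℝ) := Real.one_le_rpow (le_max_of_le_left hτ) (by norm_num)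
  rw [profile, max_eq_right (by linarith), Real.zero_rpow (by linarith)]

theorem profileDeriv_of_one_le {N τ : ℝ} (hN : 1 < N) (hτ : 1 ≤ τ) : profileDeriv N τ = 0 := by
  have h : 1 ≤ max τ 0 ^ (2 : ℝ) := Real.one_le_rpow (le_max_of_le_left hτ) (by norm_num)
  rw [profileDeriv, max_eq_right (by linarith), Real.zero_rpow (by linarith)]
  simp

/-- Differentiating an N-th power lowers it by one, that is, to the power 1 - 1/N of the profile.
For N = `scaleExp p q` this exponent is (q-1)/p. -/
theorem abs_profileDeriv_le {N : ℝ} (hN : 1 < N) (τ : ℝ) :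
    |profileDeriv N τ| ≤ 2 * N * profile N τ ^ (1 - 1 / N) := by
  rcases le_total 1 τ with h | h
  · rw [profileDeriv_of_one_le hN h, abs_zero]
    have := profile_nonneg N τ
    positivity
  · have h0 : (0 : ℝ) ≤ max τ 0 := le_max_right _ _
    have h1 : max τ 0 ≤ 1 := max_le h zero_le_one
    have h2 : 0 ≤ max (1 - max τ 0 ^ (2 : ℝ)) 0 := le_max_right _ _
    have h3 : (profile N τ) ^ (1 - 1 / N) = max (1 - max τ 0 ^ (2 : ℝ)) 0 ^ (N - 1) := by
      rw [profile, ← Real.rpow_mul h2]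
      congr 1; field_simp
    rw [h3, profileDeriv, abs_mul, abs_neg, abs_of_nonneg (by positivity),
      abs_of_nonneg (by positivity)]
    have h4 : max τ 0 ^ ((2 : ℝ) - 1) ≤ 1 := Real.rpow_le_one h0 h1 (by norm_num)
    have h5 : 0 ≤ N * max (1 - max τ 0 ^ (2 : ℝ)) 0 ^ (N - 1) := by positivity
    calc _ ≤ N * max (1 - max τ 0 ^ (2 : ℝ)) 0 ^ (N - 1) * (2 * 1) := by gcongr
      _ = _ := by ring

/-- The profile is composed with an affine function of |x - x₀|², smooth at the centre, whose
gradient on the ball is at most 2R₂/(R₂² - R₁²) ≤ 2/(R₂ - R₁). The factor χ^(1-1/N) kept in the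
gradient bound is what later makes the flux term absorbable; in time a plain bound suffices. -/
theorem exists_isCutoff {N : ℝ} (hN : 1 < N) (x₀ : E n) {R₁ R₂ : ℝ} (hR₁ : 0 ≤ R₁) (hR : R₁ < R₂)
    (t₀ : ℝ) {σ₁ σ₂ : ℝ} (hσ : σ₁ < σ₂) :
    ∃ (χ : E n → ℝ) (ζ : ℝ → ℝ), IsCutoff χ ζ (t₀ - σ₂) ∧ tsupport χ ⊆ Metric.closedBall x₀ R₂ ∧
      (∀ x ∈ Metric.ball x₀ R₁, χ x = 1) ∧ (∀ t, t₀ - σ₁ ≤ t → ζ t = 1) ∧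
      (∀ x, ‖fderiv ℝ χ x‖ ≤ 4 * N / (R₂ - R₁) * χ x ^ (1 - 1 / N)) ∧
      ∀ t, |deriv ζ t| ≤ 2 * N / (σ₂ - σ₁) := by
  have hd : 0 < R₂ - R₁ := by linarith
  have hR₂ : 0 < R₂ := by linarith
  have hd2 : 0 < R₂ ^ 2 - R₁ ^ 2 := by nlinarith
  have hσd : 0 < σ₂ - σ₁ := by linarith
  set f : E n → ℝ := fun x => (‖x - x₀‖ ^ 2 - R₁ ^ 2) / (R₂ ^ 2 - R₁ ^ 2) with hf
  have hfC : ContDiff ℝ 1 f :=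
    ((((contDiff_id.sub contDiff_const).norm_sq ℝ).sub contDiff_const).div_const _)
  have hfd : ∀ x, HasFDerivAt f ((R₂ ^ 2 - R₁ ^ 2)⁻¹ • (2 • (innerSL ℝ (x - x₀)))) x := by
    intro x
    have h1 := (((hasFDerivAt_id x).sub_const x₀).norm_sq).sub_const (R₁ ^ 2)
    have h2 := h1.const_smul (R₂ ^ 2 - R₁ ^ 2)⁻¹
    have h3 : f = (R₂ ^ 2 - R₁ ^ 2)⁻¹ • fun x => ‖x - x₀‖ ^ 2 - R₁ ^ 2 := by
      ext y; simp [hf, div_eq_inv_mul]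
    rw [h3]
    convert! h2 using 1
  set g : ℝ → ℝ := fun t => (t₀ - σ₁ - t) / (σ₂ - σ₁) with hg
  have hgC : ContDiff ℝ 1 g := by fun_prop
  have hgd : ∀ t, HasDerivAt g (-1 / (σ₂ - σ₁)) t := fun t =>
    ((hasDerivAt_id t).const_sub (t₀ - σ₁)).div_const _
  have hf1 : ∀ x, R₂ ≤ ‖x - x₀‖ → 1 ≤ f x := by
    intro x hx
    rw [hf, le_div_iff₀ hd2]
    nlinarith
  have hsupp : tsupport (fun x => profile N (f x)) ⊆ Metric.closedBall x₀ R₂ := by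
    refine closure_minimal (fun x hx => ?_) Metric.isClosed_closedBall
    rw [Metric.mem_closedBall, dist_eq_norm]
    by_contra hc
    exact hx (profile_of_one_le hN (hf1 x (not_le.1 hc).le))
  refine ⟨fun x => profile N (f x), fun t => profile N (g t),
    ⟨(contDiff_profile hN).comp hfC, ?_, fun x => profile_nonneg _ _, fun x => profile_le_one hN _,
      (contDiff_profile hN).comp hgC, fun x => profile_nonneg _ _, fun x => profile_le_one hN _,
      ?_⟩, hsupp, ?_, ?_, ?_, ?_⟩
  · exact (isCompact_closedBall x₀ R₂).of_isClosed_subset (isClosed_tsupport _) hsupp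
  · refine profile_of_one_le hN (le_of_eq ?_)
    simp only [hg]; field_simp; ring
  · intro x hx
    refine profile_of_nonpos (div_nonpos_of_nonpos_of_nonneg ?_ hd2.le)
    rw [Metric.mem_ball, dist_eq_norm] at hx
    nlinarith [norm_nonneg (x - x₀)]
  · intro t ht
    exact profile_of_nonpos (div_nonpos_of_nonpos_of_nonneg (by linarith) hσd.le)
  · intro x
    have h := (hasDerivAt_profile hN (f x)).comp_hasFDerivAt x (hfd x)
    have h2 : (fun x => profile N (f x)) = profile N ∘ f := rfl
    rw [h2, h.fderiv, norm_smul, Real.norm_eq_abs]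
    have hp0 : 0 ≤ profile N (f x) ^ (1 - 1 / N) := Real.rpow_nonneg (profile_nonneg _ _) _
    rcases le_total R₂ ‖x - x₀‖ with hx | hx
    · rw [profileDeriv_of_one_le hN (hf1 x hx)]
      simp only [abs_zero, zero_mul, Function.comp]
      positivity
    · have h3 : ‖(R₂ ^ 2 - R₁ ^ 2)⁻¹ • (2 • (innerSL ℝ (x - x₀)))‖ ≤ 2 / (R₂ - R₁) := by
        rw [norm_smul, Real.norm_of_nonneg (by positivity)]
        have h4 : ‖2 • innerSL ℝ (x - x₀)‖ ≤ 2 * R₂ := by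
          rw [two_nsmul]
          refine (norm_add_le _ _).trans ?_
          rw [innerSL_apply_norm]
          linarith
        calc _ ≤ (R₂ ^ 2 - R₁ ^ 2)⁻¹ * (2 * R₂) := by gcongr
          _ ≤ 2 / (R₂ - R₁) := by
            rw [inv_mul_eq_div, div_le_div_iff₀ hd2 hd]
            nlinarith
      calc _ ≤ (2 * N * profile N (f x) ^ (1 - 1 / N)) * (2 / (R₂ - R₁)) := by
            gcongr
            exact abs_profileDeriv_le hN _
        _ = _ := by simp only [Function.comp]; ring
  · intro t
    have h := (hasDerivAt_profile hN (g t)).comp t (hgd t)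
    have h2 : (fun t => profile N (g t)) = profile N ∘ g := rfl
    rw [h2, h.deriv, abs_mul]
    have h3 : |-1 / (σ₂ - σ₁)| = 1 / (σ₂ - σ₁) := by
      rw [abs_div, abs_of_pos hσd]; simp
    rw [h3]
    have h4 : |profileDeriv N (g t)| ≤ 2 * N := by
      refine (abs_profileDeriv_le hN _).trans ?_
      have := Real.rpow_le_one (profile_nonneg N (g t)) (profile_le_one hN _)
        (by rw [sub_nonneg, div_le_one (by linarith)]; linarith : (0 : ℝ) ≤ 1 - 1 / N)
      nlinarith
    calc _ ≤ 2 * N * (1 / (σ₂ - σ₁)) := by gcongr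
      _ = _ := by ring

end ParabolicPQ

/-! ### Estimates between concentric cylinders -/

namespace ParabolicPQ

variable {n : ℕ}

theorem measurableSet_cyl (z₀ : E n × ℝ) (ρ σ : ℝ) : MeasurableSet (cyl z₀ ρ σ) :=
  Metric.isOpen_ball.measurableSet.prod measurableSet_Ioo

theorem cyl_subset_cyl (z₀ : E n × ℝ) {ρ₁ ρ₂ σ₁ σ₂ : ℝ} (hρ : ρ₁ ≤ ρ₂) (hσ : σ₁ ≤ σ₂) :
    cyl z₀ ρ₁ σ₁ ⊆ cyl z₀ ρ₂ σ₂ :=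
  prod_mono (Metric.ball_subset_ball hρ) (Ioo_subset_Ioo (by linarith) le_rfl)

/-- The support of the cutoff may touch the sphere and the initial time, which are null sets; hence
integrals may be taken over open cylinders. -/
theorem cyl_ae_eq (z₀ : E n × ℝ) {ρ : ℝ} (hρ : 0 < ρ) (σ : ℝ) :
    (Metric.closedBall z₀.1 ρ ×ˢ Ico (z₀.2 - σ) z₀.2 : Set (E n × ℝ)) =ᵐ[volume] cyl z₀ ρ σ := by
  rw [Measure.volume_eq_prod]
  refine Measure.set_prod_ae_eq ?_ Ioo_ae_eq_Ico.symm
  refine (ae_eq_of_subset_of_measure_ge Metric.ball_subset_closedBall ?_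
    Metric.isOpen_ball.measurableSet.nullMeasurableSet ?_).symm
  · rw [Measure.addHaar_closedBall _ _ hρ.le, Measure.addHaar_ball_of_pos _ _ hρ]
  · exact (isCompact_closedBall _ _).measure_lt_top.ne

/-- Energy and Gagliardo-Nirenberg estimates between two concentric cylinders. -/
theorem IsSubsolutionOn.cyl_estimates (hn : 2 ≤ n)
    {O : Set (E n × ℝ)} (hO : IsOpen O) {u : E n × ℝ → ℝ} {G V : E n × ℝ → E n}
    (hu : IsSubsolutionOn O u G V) {r r' : ℝ} (hr : 2 ≤ r) (hrr' : r.HolderConjugate r')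
    (hur : Integrable fun z => ‖u z‖ ^ r) (hGr : Integrable fun z => ‖G z‖ ^ r)
    (hVr : Integrable fun z => ‖V z‖ ^ r') (hVG : ∀ᵐ z, 0 ≤ inner ℝ (V z) (G z))
    (k : ℝ) {p : ℝ} (hp : 1 < p) (hpr : p ≤ r) {N : ℝ} (hN : 1 < N) (z₀ : E n × ℝ)
    {R₁ R₂ σ₁ σ₂ : ℝ} (hR₁ : 0 ≤ R₁) (hR : R₁ < R₂) (hσ₁ : 0 ≤ σ₁) (hσ : σ₁ < σ₂)
    (hSO : Metric.closedBall z₀.1 R₂ ×ˢ Ico (z₀.2 - σ₂) z₀.2 ⊆ O) {L L' : ℝ}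
    (hL : 4 * N / (R₂ - R₁) ≤ L) (hL' : 2 * N / (σ₂ - σ₁) ≤ L') :
    ∃ (φ : E n × ℝ → ℝ) (R : ℝ≥0∞), Measurable φ ∧ (∀ z, 0 ≤ φ z) ∧ (∀ z, φ z ≤ 1) ∧ R ≠ ⊤ ∧
      R ≤ ∫⁻ z in cyl z₀ R₂ σ₂, ENNReal.ofReal (L' * max (u z - k) 0 ^ 2 +
        L * (φ z ^ (1 - 1 / N) * (max (u z - k) 0 * ‖V z‖))) ∧
      ∫⁻ z in cyl z₀ R₂ σ₂, ENNReal.ofReal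
        (φ z * ((if k < u z then 1 else 0) * inner ℝ (V z) (G z))) ≤ R ∧
      ∫⁻ z in cyl z₀ R₁ σ₁, ENNReal.ofReal (max (u z - k) 0) ^ (p * (n + 2) / n) ≤
        gnConst n p * (2 * R) ^ (p / n) * ∫⁻ z in cyl z₀ R₂ σ₂, ENNReal.ofReal
          ((φ z * ((if k < u z then 1 else 0) * ‖G z‖) + L * max (u z - k) 0) ^ p) := by
  obtain ⟨χ, ζ, c, hsupp, hχ1, hζ1, hdχ, hdζ⟩ := exists_isCutoff hN z₀.1 hR₁ hR z₀.2 hσ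
  set S := tsupport χ ×ˢ Ico (z₀.2 - σ₂) z₀.2 with hS
  have hSC : S ⊆ Metric.closedBall z₀.1 R₂ ×ˢ Ico (z₀.2 - σ₂) z₀.2 := prod_mono hsupp Subset.rfl
  have hSm : MeasurableSet S := (isClosed_tsupport χ).measurableSet.prod measurableSet_Ico
  obtain ⟨h1, h2, h3⟩ := hu.lintegral_estimates hn hO hr hrr' hur hGr hVr hVG k c (by linarith)
    (hSC.trans hSO) hp hpr rfl
  have hcyl : ∀ f : E n × ℝ → ℝ≥0∞, ∫⁻ z in S, f z ≤ ∫⁻ z in cyl z₀ R₂ σ₂, f z := by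
    intro f
    rw [← setLIntegral_congr (cyl_ae_eq z₀ (by linarith : 0 < R₂) σ₂)]
    exact lintegral_mono_set hSC
  have hcyl' : ∀ {R σ : ℝ}, R ≤ R₂ → σ ≤ σ₂ → ∀ f : E n × ℝ → ℝ≥0∞, (∀ z, χ z.1 = 0 → f z = 0) →
      ∫⁻ z in cyl z₀ R σ, f z ≤ ∫⁻ z in S, f z := by
    intro R σ hR' hσ' f hf
    rw [← lintegral_indicator hSm, ← lintegral_indicator (measurableSet_cyl _ _ _)]
    refine lintegral_mono fun z => indicator_apply_le' (fun hz => ?_) fun _ => zero_le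
    by_cases hzS : z ∈ S
    · rw [indicator_of_mem hzS]
    · have : z.1 ∉ tsupport χ := fun h => hzS
        ⟨h, (by linarith [hz.2.1] : z₀.2 - σ₂ ≤ z.2), hz.2.2⟩
      rw [hf z (image_eq_zero_of_notMem_tsupport this)]
      exact zero_le
  have hN' : 1 / N ≤ 1 := by rw [div_le_one (by linarith)]; exact hN.le
  have hs0 : 0 ≤ 1 - 1 / N := by linarith
  have hs1 : 1 - 1 / N ≤ 1 := by have : 0 < 1 / N := by positivity
                                 linarith
  have hL0 : 0 ≤ L := le_trans (by have := sub_pos.2 hR; positivity) hL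
  have hL0' : 0 ≤ L' := le_trans (by have := sub_pos.2 hσ; positivity) hL'
  have hdχ' : ∀ x, ‖fderiv ℝ χ x‖ ≤ L * χ x ^ (1 - 1 / N) := fun x => (hdχ x).trans
    (mul_le_mul_of_nonneg_right hL (Real.rpow_nonneg (c.space_nonneg x) _))
  refine ⟨fun z => ζ z.2 * χ z.1, _, ?_, fun z => mul_nonneg (c.time_nonneg _) (c.space_nonneg _),
    fun z => mul_le_one₀ (c.time_le_one _) (c.space_nonneg _) (c.space_le_one _), h1, ?_, ?_, ?_⟩
  · exact (c.contDiff_time.continuous.measurable.comp measurable_snd).mul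
      (c.contDiff_space.continuous.measurable.comp measurable_fst)
  · refine (hcyl _).trans (lintegral_mono fun z => ENNReal.ofReal_le_ofReal ?_)
    have hw : 0 ≤ max (u z - k) 0 := le_max_right _ _
    have hζ0 := c.time_nonneg z.2
    have hζ1 := c.time_le_one z.2
    have hχ0 := c.space_nonneg z.1
    have hχ1 := c.space_le_one z.1
    refine add_le_add ?_ ?_
    · have : χ z.1 * (max (u z - k) 0 ^ 2 / 2) ≤ max (u z - k) 0 ^ 2 := by
        nlinarith [sq_nonneg (max (u z - k) 0)]
      exact mul_le_mul ((hdζ _).trans hL') this (by positivity) hL0'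
    -- The time cutoff satisfies 0 ≤ ζ ≤ 1, so it can be lowered to the power that the spatial
    -- gradient bound carries, giving one power of φ = ζχ.
    · have h5 : ζ z.2 ≤ ζ z.2 ^ (1 - 1 / N) := by
        rcases hζ0.eq_or_lt with h | h
        · rw [← h]; positivity
        · simpa using Real.rpow_le_rpow_of_exponent_ge h hζ1 hs1
      calc ζ z.2 * (max (u z - k) 0 * (‖fderiv ℝ χ z.1‖ * ‖V z‖)) ≤
            ζ z.2 ^ (1 - 1 / N) * (max (u z - k) 0 * (L * χ z.1 ^ (1 - 1 / N) * ‖V z‖)) := by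
            gcongr
            exact hdχ' _
        _ = _ := by rw [Real.mul_rpow hζ0 hχ0]; ring
  · refine (hcyl' le_rfl le_rfl _ fun z hz => by simp [hz]).trans (le_of_eq_of_le ?_ h2)
    exact lintegral_congr fun z => by rw [mul_assoc]
  · calc ∫⁻ z in cyl z₀ R₁ σ₁, ENNReal.ofReal (max (u z - k) 0) ^ (p * (n + 2) / n)
        = ∫⁻ z in cyl z₀ R₁ σ₁,
            ENNReal.ofReal (ζ z.2 * (χ z.1 * max (u z - k) 0)) ^ (p * (n + 2) / n) := by
          refine setLIntegral_congr_fun (measurableSet_cyl _ _ _) fun z hz => ?_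
          simp only [hχ1 _ hz.1, hζ1 _ hz.2.1.le, one_mul]
      _ ≤ _ := hcyl' hR.le hσ.le _ fun z hz => by
          have : 0 < p * (n + 2) / n := by positivity
          simp [hz, this]
      _ ≤ _ := h3
      _ ≤ _ := by
        refine mul_le_mul_right ?_ _
        refine (hcyl _).trans (lintegral_mono fun z => ENNReal.ofReal_le_ofReal ?_)
        have hw : 0 ≤ max (u z - k) 0 := le_max_right _ _
        have hζ0 := c.time_nonneg z.2
        have hζ1 := c.time_le_one z.2
        have hχ0 := c.space_nonneg z.1
        have hχ1 := c.space_le_one z.1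
        have hi : (0 : ℝ) ≤ if k < u z then 1 else 0 := by split_ifs <;> norm_num
        have h5 : ‖fderiv ℝ χ z.1‖ ≤ L := (hdχ' _).trans
          (mul_le_of_le_one_right hL0 (Real.rpow_le_one hχ0 hχ1 hs0))
        refine Real.rpow_le_rpow (by positivity) ?_ (by linarith)
        refine add_le_add (le_of_eq (by ring)) ?_
        calc _ ≤ 1 * (max (u z - k) 0 * L) := by gcongr
          _ = _ := by ring

end ParabolicPQ

/-! ### Room around the cylinder and integrability of the positive part -/

namespace ParabolicPQ

variable {n : ℕ}

/-- Positive distance to the parabolic boundary forces the closed ball into Ω and the initial time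
to be positive; compactness then leaves room sideways and downwards. Upwards there may be none,
since t₀ = T is allowed. -/
theorem exists_cyl_subset_spaceTime {Ω : Set (E n)} {T : ℝ} (hΩ : IsOpen Ω) {z₀ : E n × ℝ}
    {ρ σ : ℝ} (hρ : 0 < ρ) (hσ : 0 < σ) (hsub : cyl z₀ ρ σ ⊆ spaceTime Ω T)
    (hsep : Metric.AreSeparated (cyl z₀ ρ σ) (parBoundary Ω T)) :
    ∃ ρ' σ', ρ < ρ' ∧ σ < σ' ∧
      Metric.closedBall z₀.1 ρ' ×ˢ Ico (z₀.2 - σ') z₀.2 ⊆ spaceTime Ω T := by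
  obtain ⟨x₀, t₀⟩ := z₀
  simp only
  obtain ⟨r, hr0, hr⟩ := hsep
  have hxball : x₀ ∈ Metric.ball x₀ ρ := Metric.mem_ball_self hρ
  have htmem : t₀ - σ / 2 ∈ Ioo (t₀ - σ) t₀ := ⟨by linarith, by linarith⟩
  have hballΩ : Metric.ball x₀ ρ ⊆ Ω := fun x hx => (hsub (a := (x, t₀ - σ / 2)) ⟨hx, htmem⟩).1
  have hIoo : Ioo (t₀ - σ) t₀ ⊆ Ioo 0 T := fun t ht => (hsub (a := (x₀, t)) ⟨hxball, ht⟩).2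
  have hT : 0 < T := by have := hIoo htmem; exact this.1.trans this.2
  have hIcc : Icc (t₀ - σ) t₀ ⊆ Icc 0 T := by
    have := closure_mono hIoo
    rwa [closure_Ioo (by linarith), closure_Ioo hT.ne] at this
  have hcl : Metric.closedBall x₀ ρ ⊆ Ω := by
    intro x hx
    by_contra hxΩ
    have hxc : x ∈ closure (Metric.ball x₀ ρ) := by rwa [closure_ball _ hρ.ne']
    have hxf : x ∈ frontier Ω := by
      rw [hΩ.frontier_eq]; exact ⟨closure_mono hballΩ hxc, hxΩ⟩
    obtain ⟨y, hy, hyx⟩ := EMetric.mem_closure_iff.1 hxc r (pos_iff_ne_zero.2 hr0)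
    have := hr (y, t₀ - σ / 2) ⟨hy, htmem⟩ (x, t₀ - σ / 2)
      (Or.inr ⟨hxf, (hIoo htmem).1, (hIoo htmem).2.le⟩)
    rw [Prod.edist_eq, edist_self, max_eq_left zero_le, edist_comm] at this
    exact absurd this (not_le.2 hyx)
  have ht0 : 0 < t₀ - σ := by
    refine lt_of_le_of_ne (hIcc ⟨le_rfl, by linarith⟩).1 fun h => ?_
    have h0 : (0 : ℝ) ∈ closure (Ioo (t₀ - σ) t₀) := by
      rw [closure_Ioo (by linarith)]; exact ⟨h.ge, by linarith⟩
    obtain ⟨t, ht, htr⟩ := EMetric.mem_closure_iff.1 h0 r (pos_iff_ne_zero.2 hr0)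
    have := hr (x₀, t) ⟨hxball, ht⟩ (x₀, 0) (Or.inl ⟨subset_closure (hballΩ hxball), rfl⟩)
    rw [Prod.edist_eq, edist_self, max_eq_right zero_le, edist_comm] at this
    exact absurd this (not_le.2 htr)
  obtain ⟨δ, hδ, hδΩ⟩ := (isCompact_closedBall x₀ ρ).exists_cthickening_subset_open hΩ hcl
  rw [cthickening_closedBall hδ.le hρ.le] at hδΩ
  -- The new initial time is t₀ - (σ + t₀)/2 = (t₀ - σ)/2, which is positive and earlier than t₀ -
  -- σ.
  refine ⟨δ + ρ, (σ + t₀) / 2, by linarith, by linarith, ?_⟩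
  refine prod_mono hδΩ fun t ht => ⟨by linarith [ht.1], ht.2.trans_le (hIcc ⟨by linarith, le_rfl⟩).2⟩

theorem volume_cyl_ne_top (z₀ : E n × ℝ) (ρ σ : ℝ) : volume (cyl z₀ ρ σ) ≠ ⊤ := by
  rw [cyl, Measure.volume_eq_prod, Measure.prod_prod]
  exact ENNReal.mul_ne_top Metric.isBounded_ball.measure_lt_top.ne (by simp)

/-- The Gagliardo-Nirenberg estimate at level 0, with a slightly larger outer cylinder, has a finite
right-hand side because u and G are in L^r and p ≤ r. This is how the integrability reaches all of
Q. -/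
theorem IsSubsolutionOn.lintegral_posPart_ne_top (hn : 2 ≤ n)
    {O : Set (E n × ℝ)} (hO : IsOpen O) {u : E n × ℝ → ℝ} {G V : E n × ℝ → E n}
    (hu : IsSubsolutionOn O u G V) {r r' : ℝ} (hr : 2 ≤ r) (hrr' : r.HolderConjugate r')
    (hur : Integrable fun z => ‖u z‖ ^ r) (hGr : Integrable fun z => ‖G z‖ ^ r)
    (hVr : Integrable fun z => ‖V z‖ ^ r') (hVG : ∀ᵐ z, 0 ≤ inner ℝ (V z) (G z))
    {p : ℝ} (hp : 1 < p) (hpr : p ≤ r) (z₀ : E n × ℝ)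
    {R₁ R₂ σ₁ σ₂ : ℝ} (hR₁ : 0 ≤ R₁) (hR : R₁ < R₂) (hσ₁ : 0 ≤ σ₁) (hσ : σ₁ < σ₂)
    (hSO : Metric.closedBall z₀.1 R₂ ×ˢ Ico (z₀.2 - σ₂) z₀.2 ⊆ O) :
    ∫⁻ z in cyl z₀ R₁ σ₁, ENNReal.ofReal (max (u z) 0) ^ (p * (n + 2) / n) ≠ ⊤ := by
  obtain ⟨φ, R, -, hφ0, hφ1, hR', -, -, h⟩ := hu.cyl_estimates hn hO hr hrr' hur hGr hVr hVG 0 hp hpr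
    one_lt_two z₀ hR₁ hR hσ₁ hσ hSO le_rfl le_rfl
  simp only [sub_zero] at h
  refine ne_top_of_le_ne_top ?_ h
  set L : ℝ := 4 * 2 / (R₂ - R₁)
  have hL0 : 0 ≤ L := by have := sub_pos.2 hR; positivity
  refine ENNReal.mul_ne_top (ENNReal.mul_ne_top (gnConst_ne_top n (by linarith))
    (ENNReal.rpow_ne_top_of_nonneg (by positivity) (by finiteness))) ?_
  have hint : Integrable (fun z => 1 + 3 ^ r * (‖G z‖ ^ r + L ^ r * ‖u z‖ ^ r))
      (volume.restrict (cyl z₀ R₂ σ₂)) := by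
    have : IsFiniteMeasure (volume.restrict (cyl z₀ R₂ σ₂)) :=
      isFiniteMeasure_restrict.2 (volume_cyl_ne_top _ _ _)
    exact (integrable_const _).add ((hGr.restrict.add (hur.restrict.const_mul _)).const_mul _)
  refine ne_top_of_le_ne_top hint.lintegral_lt_top.ne
    (lintegral_mono fun z => ENNReal.ofReal_le_ofReal ?_)
  have hw : 0 ≤ max (u z) 0 := le_max_right _ _
  have hw' : max (u z) 0 ≤ ‖u z‖ := max_le (le_abs_self _) (norm_nonneg _)
  have h0 := hφ0 z
  have hi0 : (0 : ℝ) ≤ if 0 < u z then 1 else 0 := by split_ifs <;> norm_num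
  have hi1 : (if 0 < u z then 1 else 0 : ℝ) ≤ 1 := by split_ifs <;> norm_num
  have h1 : φ z * ((if 0 < u z then 1 else 0) * ‖G z‖) + L * max (u z) 0 ≤
      ‖G z‖ + L * ‖u z‖ + 0 := by
    rw [add_zero]
    gcongr
    calc _ ≤ 1 * (1 * ‖G z‖) := by
          gcongr
          exact hφ1 z
      _ = _ := by ring
  calc _ ≤ (‖G z‖ + L * ‖u z‖ + 0) ^ p := Real.rpow_le_rpow (by positivity) h1 (by linarith)
    _ ≤ 1 + (‖G z‖ + L * ‖u z‖ + 0) ^ r := rpow_le_one_add_rpow (by positivity) (by linarith) hpr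
    _ ≤ 1 + 3 ^ r * (‖G z‖ ^ r + (L * ‖u z‖) ^ r + 0 ^ r) := by
      gcongr
      exact add_add_rpow_le (by positivity) (by positivity) le_rfl (by linarith)
    _ = _ := by
      rw [Real.zero_rpow (by linarith), Real.mul_rpow hL0 (norm_nonneg _), add_zero]

end ParabolicPQ

/-! ### Level set estimates -/

namespace ParabolicPQ

section LevelSets

variable {X : Type*} [MeasurableSpace X] {ν : Measure X}

theorem add_rpow_le_two_rpow_mul (x y : ℝ≥0∞) {r : ℝ} (hr : 0 ≤ r) :
    (x + y) ^ r ≤ 2 ^ r * (x ^ r + y ^ r) := by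
  have h : x + y ≤ 2 * max x y := by
    rw [two_mul]; exact add_le_add (le_max_left _ _) (le_max_right _ _)
  calc (x + y) ^ r ≤ (2 * max x y) ^ r := ENNReal.rpow_le_rpow h hr
    _ = 2 ^ r * (max x y) ^ r := ENNReal.mul_rpow_of_nonneg _ _ hr
    _ ≤ 2 ^ r * (x ^ r + y ^ r) := by
      gcongr
      rcases le_total x y with h | h
      · rw [max_eq_right h]; exact le_add_self
      · rw [max_eq_left h]; exact le_self_add

/-- Chebyshev's argument: in the application W and W' are truncations at levels l' > l and e = 1/(l'
- l), so eW' ≥ 1 where W lives, and missing powers of W' are bought with powers of e. -/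
theorem lintegral_rpow_le_of_one_le_mul {W W' : X → ℝ≥0∞} {e : ℝ≥0∞} (he : e ≠ ⊤)
    (hW : ∀ x, W x ≤ W' x) (heW : ∀ x, W x ≠ 0 → 1 ≤ e * W' x) {s m : ℝ} (hs : 0 < s)
    (hsm : s ≤ m) : ∫⁻ x, W x ^ s ∂ν ≤ e ^ (m - s) * ∫⁻ x, W' x ^ m ∂ν := by
  rw [← lintegral_const_mul' _ _ (ENNReal.rpow_ne_top_of_nonneg (by linarith) he)]
  refine lintegral_mono fun x => ?_
  by_cases h0 : W x = 0
  · simp [h0, hs]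
  · calc W x ^ s ≤ W' x ^ s * 1 := by rw [mul_one]; exact ENNReal.rpow_le_rpow (hW x) hs.le
      _ ≤ W' x ^ s * (e * W' x) ^ (m - s) := by
        gcongr
        simpa using ENNReal.rpow_le_rpow (heW x h0) (sub_nonneg.2 hsm)
      _ = e ^ (m - s) * W' x ^ m := by
        rw [ENNReal.mul_rpow_of_nonneg _ _ (by linarith), mul_left_comm,
          ← ENNReal.rpow_add_of_nonneg _ _ hs.le (by linarith)]
        ring_nf

theorem lintegral_ite_le_of_one_le_mul {W W' : X → ℝ≥0∞} {e : ℝ≥0∞} (he : e ≠ ⊤)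
    (heW : ∀ x, W x ≠ 0 → 1 ≤ e * W' x) {m : ℝ} (hm : 0 ≤ m) :
    ∫⁻ x, (if W x = 0 then 0 else 1) ∂ν ≤ e ^ m * ∫⁻ x, W' x ^ m ∂ν := by
  rw [← lintegral_const_mul' _ _ (ENNReal.rpow_ne_top_of_nonneg hm he)]
  refine lintegral_mono fun x => ?_
  split_ifs with h0
  · exact zero_le
  · rw [← ENNReal.mul_rpow_of_nonneg _ _ hm]
    simpa using ENNReal.rpow_le_rpow (heW x h0) hm

theorem lintegral_mul_mul_rpow_le {f g h : X → ℝ≥0∞} (hf : AEMeasurable f ν)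
    (hg : AEMeasurable g ν) (hh : AEMeasurable h ν) {r s t : ℝ} (hr : 0 ≤ r) (hs : 0 ≤ s)
    (ht : 0 ≤ t) (hrst : r + s + t = 1) :
    ∫⁻ x, f x ^ r * g x ^ s * h x ^ t ∂ν ≤
      (∫⁻ x, f x ∂ν) ^ r * (∫⁻ x, g x ∂ν) ^ s * (∫⁻ x, h x ∂ν) ^ t := by
  have := ENNReal.lintegral_prod_norm_pow_le (μ := ν) (Finset.univ : Finset (Fin 3))
    (f := ![f, g, h]) (p := ![r, s, t]) (by intro i _; fin_cases i <;> simpa)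
    (by simpa [Fin.sum_univ_three] using hrst) (by intro i _; fin_cases i <;> simpa)
  simpa [Fin.prod_univ_three] using this

variable {W W' F φ b d S : X → ℝ≥0∞} {p q α β ϱ m : ℝ} {e L L' R : ℝ≥0∞}

/-- Hölder's inequality with weights α/(α+1) and 1/(α+1), applied to (φS)·d, where d plays the role
of 1/a. It explains the exponent p_α = pα/(α+1): the energy of order p against the degenerate
coefficient controls only this power. -/
theorem lintegral_weighted_rpow_le (hφm : AEMeasurable φ ν) (hdm : AEMeasurable d ν)
    (hSm : AEMeasurable S ν) (hα : 0 < α)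
    (hFS : ∀ᵐ x ∂ν, F x ^ p ≤ d x * S x) (hSR : ∫⁻ x, φ x * S x ∂ν ≤ R) :
    ∫⁻ x, φ x ^ (α / (α + 1)) * F x ^ pExp p α ∂ν ≤
      R ^ (α / (α + 1)) * (∫⁻ x, d x ^ α ∂ν) ^ (1 / (α + 1)) := by
  have ha : 0 ≤ α / (α + 1) := by positivity
  calc ∫⁻ x, φ x ^ (α / (α + 1)) * F x ^ pExp p α ∂ν
      ≤ ∫⁻ x, (φ x * S x) ^ (α / (α + 1)) * (d x ^ α) ^ (1 / (α + 1)) ∂ν := by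
        refine lintegral_mono_ae ?_
        filter_upwards [hFS] with x hx
        have h1 : F x ^ pExp p α = (F x ^ p) ^ (α / (α + 1)) := by
          rw [← ENNReal.rpow_mul]; congr 1; rw [pExp]; ring
        rw [h1, ← ENNReal.rpow_mul (d x), mul_one_div, ENNReal.mul_rpow_of_nonneg _ _ ha, mul_assoc,
          ← ENNReal.mul_rpow_of_nonneg (S x) _ ha, mul_comm (S x)]
        gcongr
    _ ≤ (∫⁻ x, φ x * S x ∂ν) ^ (α / (α + 1)) * (∫⁻ x, d x ^ α ∂ν) ^ (1 / (α + 1)) :=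
      ENNReal.lintegral_mul_norm_pow_le (hφm.mul hSm) (hdm.pow_const _) ha (by positivity)
        (by field_simp)
    _ ≤ _ := by gcongr

/-- The level set estimate for the energy. -/
theorem energy_level_le (hWm : AEMeasurable W ν) (hFm : AEMeasurable F ν) (hφm : AEMeasurable φ ν)
    (hbm : AEMeasurable b ν) (hdm : AEMeasurable d ν) (hSm : AEMeasurable S ν)
    (he : e ≠ ⊤) (hW : ∀ x, W x ≤ W' x) (heW : ∀ x, W x ≠ 0 → 1 ≤ e * W' x) (hφ : ∀ x, φ x ≤ 1)
    (hp : 0 < p) (hq : 1 < q) (hα : 0 < α) (hβ : 0 < β) (hϱ : 0 < ϱ) (hϱm : ϱ ≤ m) (hm : 2 ≤ m)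
    (hsum : 1 / ϱ + 1 / β + (q - 1) / pExp p α = 1)
    (hFS : ∀ᵐ x ∂ν, F x ^ p ≤ d x * S x) (hSR : ∫⁻ x, φ x * S x ∂ν ≤ R)
    (hR : R ≤ L' * ∫⁻ x, W x ^ (2 : ℝ) ∂ν +
      L * ∫⁻ x, φ x ^ ((q - 1) / p) * (W x * (b x * (1 + F x) ^ (q - 1))) ∂ν) :
    R ≤ L' * (e ^ (m - 2) * ∫⁻ x, W' x ^ m ∂ν) +
      L * (2 ^ (q - 1) * ((e ^ (m - ϱ) * ∫⁻ x, W' x ^ m ∂ν) ^ (1 / ϱ) *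
        (∫⁻ x, b x ^ β ∂ν) ^ (1 / β) * (R ^ ((q - 1) / p) *
          (∫⁻ x, d x ^ α ∂ν) ^ ((q - 1) / (p * α)) +
            (e ^ m * ∫⁻ x, W' x ^ m ∂ν) ^ ((q - 1) / pExp p α)))) := by
  have hpa : 0 < pExp p α := by rw [pExp]; positivity
  have hq0 : 0 < q - 1 := by linarith
  refine hR.trans ?_
  gcongr
  · exact lintegral_rpow_le_of_one_le_mul he hW heW two_pos hm
  -- The factor 1 + F is split. The gradient part carries exactly the weight φ^(α/(α+1)) of the
  -- weighted estimate, and the constant part is replaced by the indicator of {W ≠ 0}, so that both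
  -- parts submit to Hölder's inequality with the same three exponents.
  · have hpt : ∀ x, φ x ^ ((q - 1) / p) * (W x * (b x * (1 + F x) ^ (q - 1))) ≤
        2 ^ (q - 1) * ((W x ^ ϱ) ^ (1 / ϱ) * (b x ^ β) ^ (1 / β) *
            (φ x ^ (α / (α + 1)) * F x ^ pExp p α) ^ ((q - 1) / pExp p α) +
          (W x ^ ϱ) ^ (1 / ϱ) * (b x ^ β) ^ (1 / β) *
            (if W x = 0 then 0 else 1) ^ ((q - 1) / pExp p α)) := by
      intro x
      rw [← ENNReal.rpow_mul, mul_one_div_cancel hϱ.ne', ← ENNReal.rpow_mul,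
        mul_one_div_cancel hβ.ne', ENNReal.rpow_one, ENNReal.rpow_one,
        ENNReal.mul_rpow_of_nonneg _ _ (by positivity), ← ENNReal.rpow_mul, ← ENNReal.rpow_mul,
        mul_div_cancel₀ _ hpa.ne']
      have h1 : α / (α + 1) * ((q - 1) / pExp p α) = (q - 1) / p := by rw [pExp]; field_simp
      rw [h1]
      by_cases h0 : W x = 0
      · simp [h0]
      · rw [if_neg h0, ENNReal.one_rpow, mul_one]
        calc φ x ^ ((q - 1) / p) * (W x * (b x * (1 + F x) ^ (q - 1)))
            ≤ φ x ^ ((q - 1) / p) * (W x * (b x * (2 ^ (q - 1) * (1 ^ (q - 1) + F x ^ (q - 1))))) := by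
              gcongr
              exact add_rpow_le_two_rpow_mul _ _ hq0.le
          _ = 2 ^ (q - 1) * (W x * b x * (φ x ^ ((q - 1) / p) * F x ^ (q - 1)) +
                W x * b x * φ x ^ ((q - 1) / p)) := by rw [ENNReal.one_rpow]; ring
          _ ≤ 2 ^ (q - 1) * (W x * b x * (φ x ^ ((q - 1) / p) * F x ^ (q - 1)) +
                W x * b x * 1) := by
              gcongr
              exact ENNReal.rpow_le_one (hφ x) (by positivity)
          _ = _ := by rw [mul_one]
    refine (lintegral_mono hpt).trans ?_
    rw [lintegral_const_mul' _ _ (by finiteness)]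
    gcongr
    have hIm : AEMeasurable (fun x => if W x = 0 then (0 : ℝ≥0∞) else 1) ν := by
      have : Measurable fun y : ℝ≥0∞ => if y = 0 then (0 : ℝ≥0∞) else 1 :=
        Measurable.ite (measurableSet_singleton 0) measurable_const measurable_const
      exact this.comp_aemeasurable hWm
    rw [lintegral_add_left' (by fun_prop), mul_add]
    have hWϱ := lintegral_rpow_le_of_one_le_mul (ν := ν) he hW heW hϱ hϱm
    refine add_le_add ?_ ?_
    · refine (lintegral_mul_mul_rpow_le (by fun_prop) (by fun_prop) (by fun_prop) (by positivity)
        (by positivity) (by positivity) hsum).trans ?_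
      gcongr
      refine (ENNReal.rpow_le_rpow (lintegral_weighted_rpow_le hφm hdm hSm hα hFS hSR)
        (by positivity)).trans (le_of_eq ?_)
      rw [ENNReal.mul_rpow_of_nonneg _ _ (by positivity), ← ENNReal.rpow_mul, ← ENNReal.rpow_mul]
      congr 2
      · rw [pExp]; field_simp
      · rw [pExp]; field_simp
    · refine (lintegral_mul_mul_rpow_le (by fun_prop) (by fun_prop) hIm (by positivity)
        (by positivity) (by positivity) hsum).trans ?_
      gcongr
      exact lintegral_ite_le_of_one_le_mul he heW (by linarith)

/-- The level set estimate for the gradient. -/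
theorem gradient_level_le (hWm : AEMeasurable W ν) (hφm : AEMeasurable φ ν)
    (hdm : AEMeasurable d ν) (hSm : AEMeasurable S ν)
    (he : e ≠ ⊤) (hL : L ≠ ⊤) (hW : ∀ x, W x ≤ W' x) (heW : ∀ x, W x ≠ 0 → 1 ≤ e * W' x)
    (hφ : ∀ x, φ x ≤ 1) (hp : 1 ≤ p) (hα : 0 < α) (hm : pExp p α ≤ m)
    (hFS : ∀ᵐ x ∂ν, F x ^ p ≤ d x * S x) (hSR : ∫⁻ x, φ x * S x ∂ν ≤ R) :
    ∫⁻ x, (φ x * F x + L * W x) ^ pExp p α ∂ν ≤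
      2 ^ pExp p α * (R ^ (α / (α + 1)) * (∫⁻ x, d x ^ α ∂ν) ^ (1 / (α + 1)) +
        L ^ pExp p α * (e ^ (m - pExp p α) * ∫⁻ x, W' x ^ m ∂ν)) := by
  have hpa : 0 < pExp p α := by rw [pExp]; positivity
  have hpt : ∀ x, (φ x * F x + L * W x) ^ pExp p α ≤ 2 ^ pExp p α *
      (φ x ^ (α / (α + 1)) * F x ^ pExp p α + L ^ pExp p α * W x ^ pExp p α) := by
    intro x
    refine (add_rpow_le_two_rpow_mul _ _ hpa.le).trans ?_
    rw [ENNReal.mul_rpow_of_nonneg _ _ hpa.le, ENNReal.mul_rpow_of_nonneg _ _ hpa.le]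
    gcongr _ * (?_ * _ + _)
    -- As φ ≤ 1 and p_α ≥ α/(α+1), the power of the cutoff may be lowered to the one in the energy.
    refine ENNReal.rpow_le_rpow_of_exponent_ge (hφ x) ?_
    rw [pExp, mul_div_assoc]
    exact le_mul_of_one_le_left (by positivity) hp
  refine (lintegral_mono hpt).trans ?_
  rw [lintegral_const_mul' _ _ (by finiteness), lintegral_add_right' _ (by fun_prop),
    lintegral_const_mul' _ _ (by finiteness)]
  gcongr
  · exact lintegral_weighted_rpow_le hφm hdm hSm hα hFS hSR
  · exact lintegral_rpow_le_of_one_le_mul he hW heW hpa hm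

end LevelSets

end ParabolicPQ

/-! ### Real inequalities for one step and for the iteration -/

namespace ParabolicPQ

section Numeric

/-- One of the two summands is at least R/2. With θ = (q-1)/p the exponent 1/(1-θ) is p/(p+1-q), the
source of the nonstandard scaling in the theorem. -/
theorem le_of_le_add_mul_rpow {R X₀ X₁ θ : ℝ} (hR : 0 ≤ R) (h₀ : 0 ≤ X₀) (h₁ : 0 ≤ X₁)
    (hθ : θ < 1) (h : R ≤ X₀ + X₁ * R ^ θ) : R ≤ 2 * X₀ + (2 * X₁) ^ (1 / (1 - θ)) := by
  have hd : 0 < 1 - θ := by linarith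
  have h2 : 0 ≤ (2 * X₁) ^ (1 / (1 - θ)) := by positivity
  rcases le_total (X₁ * R ^ θ) X₀ with h3 | h3
  · linarith
  · rcases hR.eq_or_lt with rfl | hR'
    · positivity
    have h4 : R ≤ 2 * X₁ * R ^ θ := by linarith
    have h5 : R ^ (1 - θ) ≤ 2 * X₁ := by
      rw [Real.rpow_sub hR', Real.rpow_one, div_le_iff₀ (by positivity)]
      exact h4
    have h6 : R = (R ^ (1 - θ)) ^ (1 / (1 - θ)) := by
      rw [← Real.rpow_mul hR, mul_one_div_cancel hd.ne', Real.rpow_one]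
    have h7 : R ≤ (2 * X₁) ^ (1 / (1 - θ)) := by
      rw [h6]; exact Real.rpow_le_rpow (by positivity) h5 (by positivity)
    linarith

theorem rpow_mul_rpow_mul_le {Γ k δ e m s : ℝ} (hΓ : 1 ≤ Γ) (hk : 0 < k) (hδ : 0 ≤ δ) (he : 0 ≤ e)
    (heΓ : e ≤ Γ / k) (hs : 0 ≤ s) (hsm : s ≤ m) :
    e ^ (m - s) * (k ^ m * δ) ≤ Γ ^ m * (k ^ s * δ) := by
  have hΓ0 : 0 < Γ := by linarith
  calc e ^ (m - s) * (k ^ m * δ) ≤ (Γ / k) ^ (m - s) * (k ^ m * δ) := by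
        gcongr
    _ = Γ ^ (m - s) * (k ^ s * δ) := by
      rw [Real.div_rpow hΓ0.le hk.le, Real.rpow_sub hk m s]
      field_simp
    _ ≤ _ := by
      gcongr
      linarith

variable {Γ k ρ σ δ e L L' A B R Y m ϱ β π g p s t κ : ℝ}

/-- All constants are swallowed by powers of Γ. Since δ ≤ 1, κ is bounded by each power of δ that
occurs: 1 from the time derivative, 1/ϱ + t from the measure of the superlevel set, and π/ϱ from
absorbing R^(g/p). The assumption on k²/σ puts the time term on the same scale (k/ρ)^π as the
others. -/
theorem energy_numeric (hΓ : 2 ≤ Γ) (hk : 0 < k) (hρ : 0 < ρ) (hρk : ρ ≤ k) (hσ : 0 < σ)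
    (hδ : 0 ≤ δ) (hδ1 : δ ≤ 1) (he : 0 ≤ e) (heΓ : e ≤ Γ / k) (hLΓ : L ≤ Γ / ρ)
    (hLΓ' : L' ≤ Γ / σ) (hA : 0 ≤ A) (hAΓ : A ≤ Γ) (hB : 0 ≤ B) (hBΓ : B ≤ Γ) (hR0 : 0 ≤ R)
    (hkσ : k ^ 2 / σ ≤ Γ * (k / ρ) ^ π) (hm : 2 ≤ m) (hϱ : 0 < ϱ) (hϱm : ϱ ≤ m) (hβ : 0 < β)
    (hπ : 1 ≤ π) (hg : 0 ≤ g) (hgp : g / p = 1 - 1 / π) (hs : 0 ≤ s) (ht : 0 ≤ t)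
    (hκ : κ ≤ 1 / ϱ + t) (hκ' : κ ≤ π * (1 / ϱ)) (hκ1 : κ ≤ 1)
    (hR : R ≤ L' * (e ^ (m - 2) * (k ^ m * δ)) +
      L * (2 ^ g * ((e ^ (m - ϱ) * (k ^ m * δ)) ^ (1 / ϱ) * B ^ (1 / β) *
        (R ^ (g / p) * A ^ s + (e ^ m * (k ^ m * δ)) ^ t)))) :
    R ≤ Γ ^ (3 + π + (1 + π) * (m + 2 + g + m / ϱ + 1 / β + s + m * t)) *
      ((k / ρ) ^ π * δ ^ κ) := by
  have hΓ1 : 1 ≤ Γ := by linarith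
  have hΓ0 : 0 < Γ := by linarith
  have hπ0 : 0 < π := by linarith
  have hm0 : 0 < m := by linarith
  -- For δ = 0 the right-hand side of the hypothesis vanishes; afterwards δ > 0 makes the rules for
  -- real powers applicable.
  rcases hδ.eq_or_lt with rfl | hδ0
  · have h : R ≤ 0 := by
      refine hR.trans (le_of_eq ?_)
      rw [mul_zero, mul_zero, mul_zero, mul_zero, Real.zero_rpow (by positivity)]
      ring
    exact h.trans (by positivity)
  set c := m + 2 + g + m / ϱ + 1 / β + s + m * t with hc
  have hc0 : 0 ≤ c := by positivity
  clear_value c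
  set x := k / ρ with hx
  have hx1 : 1 ≤ x := (one_le_div hρ).2 hρk
  have hx0 : 0 < x := by linarith
  have hxπ : x ≤ x ^ π := by simpa using Real.rpow_le_rpow_of_exponent_le hx1 hπ
  have hδκ : δ ≤ δ ^ κ := by simpa using Real.rpow_le_rpow_of_exponent_ge hδ0 hδ1 hκ1
  have hfirst : L' * (e ^ (m - 2) * (k ^ m * δ)) ≤ Γ ^ c * (x ^ π * δ ^ κ) := by
    calc L' * (e ^ (m - 2) * (k ^ m * δ)) ≤ Γ / σ * (Γ ^ m * (k ^ (2 : ℝ) * δ)) :=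
          mul_le_mul hLΓ' (rpow_mul_rpow_mul_le hΓ1 hk hδ he heΓ two_pos.le hm) (by positivity)
            (by positivity)
      _ = Γ ^ (m + 1) * ((k ^ 2 / σ) * δ) := by
        rw [Real.rpow_two, Real.rpow_add_one hΓ0.ne']; ring
      _ ≤ Γ ^ (m + 1) * ((Γ * x ^ π) * δ ^ κ) := by gcongr
      _ = Γ ^ (m + 1 + 1) * (x ^ π * δ ^ κ) := by rw [Real.rpow_add_one hΓ0.ne' (m + 1)]; ring
      _ ≤ _ := by
        gcongr
        have : 0 ≤ g + m / ϱ + 1 / β + s + m * t := by positivity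
        linarith
  have hsecond : L * (2 ^ g * ((e ^ (m - ϱ) * (k ^ m * δ)) ^ (1 / ϱ) * B ^ (1 / β) *
        (R ^ (g / p) * A ^ s + (e ^ m * (k ^ m * δ)) ^ t))) ≤
      Γ ^ c * (x * δ ^ (1 / ϱ)) * (R ^ (g / p) + δ ^ t) := by
    have h1 : (e ^ (m - ϱ) * (k ^ m * δ)) ^ (1 / ϱ) ≤ Γ ^ (m / ϱ) * (k * δ ^ (1 / ϱ)) := by
      refine (Real.rpow_le_rpow (by positivity)
        (rpow_mul_rpow_mul_le hΓ1 hk hδ he heΓ hϱ.le hϱm) (by positivity)).trans (le_of_eq ?_)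
      rw [Real.mul_rpow (by positivity) (by positivity), Real.mul_rpow (by positivity)
        (by positivity), ← Real.rpow_mul hΓ0.le, ← Real.rpow_mul hk.le, mul_one_div,
        mul_one_div_cancel hϱ.ne', Real.rpow_one]
    have h2 : (e ^ m * (k ^ m * δ)) ^ t ≤ Γ ^ (m * t) * δ ^ t := by
      have := rpow_mul_rpow_mul_le hΓ1 hk hδ he heΓ le_rfl hm0.le
      rw [sub_zero, Real.rpow_zero, one_mul] at this
      refine (Real.rpow_le_rpow (by positivity) this ht).trans (le_of_eq ?_)
      rw [Real.mul_rpow (by positivity) (by positivity), ← Real.rpow_mul hΓ0.le]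
    have h3 : R ^ (g / p) * A ^ s + (e ^ m * (k ^ m * δ)) ^ t ≤
        Γ ^ (s + m * t) * (R ^ (g / p) + δ ^ t) := by
      have h4 : A ^ s ≤ Γ ^ (s + m * t) := (Real.rpow_le_rpow hA hAΓ hs).trans
        (Real.rpow_le_rpow_of_exponent_le hΓ1 (le_add_of_nonneg_right (by positivity)))
      have h5 : Γ ^ (m * t) ≤ Γ ^ (s + m * t) :=
        Real.rpow_le_rpow_of_exponent_le hΓ1 (le_add_of_nonneg_left (by positivity))
      calc _ ≤ R ^ (g / p) * Γ ^ (s + m * t) + Γ ^ (s + m * t) * δ ^ t := by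
            gcongr
            exact h2.trans (by gcongr)
        _ = _ := by ring
    calc _ ≤ Γ / ρ * (Γ ^ g * (Γ ^ (m / ϱ) * (k * δ ^ (1 / ϱ)) * Γ ^ (1 / β) *
            (Γ ^ (s + m * t) * (R ^ (g / p) + δ ^ t)))) := by gcongr
      _ = Γ ^ (1 + g + m / ϱ + 1 / β + (s + m * t)) * (x * δ ^ (1 / ϱ)) *
            (R ^ (g / p) + δ ^ t) := by
          rw [Real.rpow_add hΓ0 _ (s + m * t), Real.rpow_add hΓ0 _ (1 / β),
            Real.rpow_add hΓ0 _ (m / ϱ), Real.rpow_add hΓ0 1 g, Real.rpow_one, hx]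
          ring
      _ ≤ _ := by
        gcongr
        rw [hc]; linarith
  have hsum : R ≤ 2 * (Γ ^ c * (x ^ π * δ ^ κ)) + Γ ^ c * (x * δ ^ (1 / ϱ)) * R ^ (g / p) := by
    have h1 : Γ ^ c * (x * δ ^ (1 / ϱ)) * δ ^ t ≤ Γ ^ c * (x ^ π * δ ^ κ) := by
      rw [mul_assoc, mul_assoc, ← Real.rpow_add hδ0]
      gcongr ?_ * (?_ * ?_)
      exact Real.rpow_le_rpow_of_exponent_ge hδ0 hδ1 hκ
    have h2 := hR.trans (add_le_add hfirst hsecond)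
    rw [mul_add] at h2
    linarith
  have hθ : g / p < 1 := by rw [hgp]; have : 0 < 1 / π := by positivity
                            linarith
  have hres := le_of_le_add_mul_rpow hR0 (by positivity) (by positivity) hθ hsum
  have hπe : 1 / (1 - g / p) = π := by rw [hgp]; field_simp; ring
  rw [hπe] at hres
  have h1 : (2 * (Γ ^ c * (x * δ ^ (1 / ϱ)))) ^ π ≤ Γ ^ (π + c * π) * (x ^ π * δ ^ κ) := by
    rw [Real.mul_rpow two_pos.le (by positivity), Real.mul_rpow (by positivity) (by positivity),
      Real.mul_rpow (by positivity) (by positivity), ← Real.rpow_mul hΓ0.le, ← Real.rpow_mul hδ,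
      ← mul_assoc, Real.rpow_add hΓ0 π]
    gcongr ?_ ^ π * _ * (_ * ?_)
    refine Real.rpow_le_rpow_of_exponent_ge hδ0 hδ1 ?_
    linarith
  have h2 : 2 * (2 * (Γ ^ c * (x ^ π * δ ^ κ))) ≤ Γ ^ (2 + c) * (x ^ π * δ ^ κ) := by
    rw [Real.rpow_add hΓ0 2 c, Real.rpow_two]
    have : 4 ≤ Γ ^ 2 := by
      calc (4 : ℝ) = 2 ^ 2 := by norm_num
        _ ≤ _ := by gcongr
    calc _ = 4 * Γ ^ c * (x ^ π * δ ^ κ) := by ring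
      _ ≤ _ := by gcongr
  set D := 2 + π + (1 + π) * c with hD
  have hcπ : 0 ≤ π * c := by positivity
  have h3 : Γ ^ (2 + c) ≤ Γ ^ D := Real.rpow_le_rpow_of_exponent_le hΓ1 (by rw [hD, add_mul]; linarith)
  have h4 : Γ ^ (π + c * π) ≤ Γ ^ D := Real.rpow_le_rpow_of_exponent_le hΓ1 (by rw [hD, add_mul]; linarith)
  have hX : 0 ≤ x ^ π * δ ^ κ := by positivity
  calc R ≤ Γ ^ (2 + c) * (x ^ π * δ ^ κ) + Γ ^ (π + c * π) * (x ^ π * δ ^ κ) :=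
        hres.trans (add_le_add h2 h1)
    _ ≤ Γ ^ D * (x ^ π * δ ^ κ) + Γ ^ D * (x ^ π * δ ^ κ) := by gcongr
    _ = 2 * Γ ^ D * (x ^ π * δ ^ κ) := by ring
    _ ≤ Γ * Γ ^ D * (x ^ π * δ ^ κ) := by gcongr
    _ = _ := by
      rw [mul_comm Γ, ← Real.rpow_add_one hΓ0.ne']
      congr 2; rw [hD]; ring

/-- Inserting the energy bound into the Gagliardo-Nirenberg estimate multiplies its N-th power by
its a-th power. The term with L from differentiating the cutoff is no worse, because pa ≤ πa, κa ≤
1, k/ρ ≥ 1 and δ ≤ 1. -/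
theorem decay_numeric {v w pa a a' N N' c₁ : ℝ} (hΓ : 2 ≤ Γ) (hk : 0 < k) (hρ : 0 < ρ) (hρk : ρ ≤ k)
    (hδ : 0 ≤ δ) (hδ1 : δ ≤ 1) (he : 0 ≤ e) (heΓ : e ≤ Γ / k) (hL : 0 ≤ L) (hLΓ : L ≤ Γ / ρ)
    (hA : 0 ≤ A) (hAΓ : A ≤ Γ) (hR0 : 0 ≤ R) (hpa : 0 ≤ pa) (hpam : pa ≤ m) (ha : 0 ≤ a)
    (ha' : 0 ≤ a') (ha'1 : a' ≤ 1) (hN : 0 ≤ N) (hπ : pa ≤ π * a) (hκ0 : 0 ≤ κ) (hκ1 : κ * a ≤ 1)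
    (hv : 0 ≤ v) (hw : 0 ≤ w) (hvw : v ≤ Γ * w) (hN' : N' ≤ Γ) (hc₁ : 0 ≤ c₁)
    (hR : R ≤ Γ ^ c₁ * ((k / ρ) ^ π * δ ^ κ))
    (hY : Y ≤ N' * (2 * R * v) ^ N *
      (2 ^ pa * (R ^ a * A ^ a' + L ^ pa * (e ^ (m - pa) * (k ^ m * δ))))) :
    Y ≤ Γ ^ (3 + (2 + c₁) * N + 2 * pa + c₁ * a + m) *
      (w ^ N * ((k / ρ) ^ (π * (N + a)) * δ ^ (κ * (N + a)))) := by
  have hΓ1 : 1 ≤ Γ := by linarith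
  have hΓ0 : 0 < Γ := by linarith
  have hm0 : 0 ≤ m := hpa.trans hpam
  set x := k / ρ with hx
  have hx1 : 1 ≤ x := (one_le_div hρ).2 hρk
  have hx0 : 0 < x := by linarith
  have h1 : (2 * R * v) ^ N ≤ Γ ^ ((2 + c₁) * N) * (w ^ N * (x ^ (π * N) * δ ^ (κ * N))) := by
    have : 2 * R * v ≤ Γ ^ (2 + c₁) * (w * (x ^ π * δ ^ κ)) := by
      calc 2 * R * v ≤ Γ * (Γ ^ c₁ * (x ^ π * δ ^ κ)) * (Γ * w) := by gcongr
        _ = _ := by rw [Real.rpow_add hΓ0, Real.rpow_two]; ring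
    refine (Real.rpow_le_rpow (by positivity) this hN).trans (le_of_eq ?_)
    rw [Real.mul_rpow (by positivity) (by positivity), Real.mul_rpow (by positivity)
      (by positivity), Real.mul_rpow (by positivity) (by positivity), ← Real.rpow_mul hΓ0.le,
      ← Real.rpow_mul hx0.le, ← Real.rpow_mul hδ]
  have hδκ : δ ≤ δ ^ (κ * a) := by
    rcases hδ.eq_or_lt with rfl | hδ0
    · positivity
    · simpa using Real.rpow_le_rpow_of_exponent_ge hδ0 hδ1 hκ1
  have h2 : R ^ a * A ^ a' ≤ Γ ^ (1 + pa + c₁ * a + m) * (x ^ (π * a) * δ ^ (κ * a)) := by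
    calc R ^ a * A ^ a' ≤ (Γ ^ c₁ * (x ^ π * δ ^ κ)) ^ a * Γ ^ a' := by gcongr
      _ = Γ ^ (c₁ * a + a') * (x ^ (π * a) * δ ^ (κ * a)) := by
        rw [Real.mul_rpow (by positivity) (by positivity), Real.mul_rpow (by positivity)
          (by positivity), ← Real.rpow_mul hΓ0.le,
          ← Real.rpow_mul hx0.le, ← Real.rpow_mul hδ, Real.rpow_add hΓ0]
        ring
      _ ≤ _ := by
        refine mul_le_mul_of_nonneg_right (Real.rpow_le_rpow_of_exponent_le hΓ1 ?_) (by positivity)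
        linarith
  have h3 : L ^ pa * (e ^ (m - pa) * (k ^ m * δ)) ≤
      Γ ^ (1 + pa + c₁ * a + m) * (x ^ (π * a) * δ ^ (κ * a)) := by
    calc L ^ pa * (e ^ (m - pa) * (k ^ m * δ)) ≤ (Γ / ρ) ^ pa * (Γ ^ m * (k ^ pa * δ)) := by
          gcongr ?_ ^ pa * ?_
          exact rpow_mul_rpow_mul_le hΓ1 hk hδ he heΓ hpa hpam
      _ = Γ ^ (pa + m) * (x ^ pa * δ) := by
        rw [Real.div_rpow hΓ0.le hρ.le, hx, Real.div_rpow hk.le hρ.le, Real.rpow_add hΓ0]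
        ring
      _ ≤ _ := by
        have : 0 ≤ c₁ * a := by positivity
        gcongr
        · linarith
  set X := Γ ^ (1 + pa + c₁ * a + m) * (x ^ (π * a) * δ ^ (κ * a)) with hX
  calc Y ≤ Γ * (Γ ^ ((2 + c₁) * N) * (w ^ N * (x ^ (π * N) * δ ^ (κ * N)))) *
        (Γ ^ pa * (X + X)) := by
        refine hY.trans ?_
        gcongr
    _ ≤ Γ * (Γ ^ ((2 + c₁) * N) * (w ^ N * (x ^ (π * N) * δ ^ (κ * N)))) * (Γ ^ pa * (Γ * X)) := by
        have : 0 ≤ X := by positivity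
        gcongr
        rw [← two_mul]
        gcongr
    _ = _ := by
      have e1 : 3 + (2 + c₁) * N + 2 * pa + c₁ * a + m =
        (2 + c₁) * N + pa + (1 + pa + c₁ * a + m) + 2 := by ring
      rw [e1, hX, Real.rpow_add hΓ0 _ 2, Real.rpow_add hΓ0 _ (1 + pa + c₁ * a + m),
        Real.rpow_add hΓ0 _ pa,
        Real.rpow_two, mul_add π, mul_add κ, Real.rpow_add hx0,
        Real.rpow_add_of_nonneg hδ (by positivity) (by positivity)]
      ring

/-- Fast geometric convergence. -/
theorem tendsto_zero_of_le_mul_rpow {y : ℕ → ℝ} {K b ε : ℝ} (hy : ∀ j, 0 ≤ y j) (hb : 1 < b)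
    (hε : 0 < ε) (hK : 0 ≤ K) (h : ∀ j, y (j + 1) ≤ K * b ^ j * y j ^ (1 + ε))
    (h0 : K * y 0 ^ ε ≤ b ^ (-(1 / ε))) : Tendsto y atTop (𝓝 0) := by
  have hb0 : 0 < b := by linarith
  -- With this ratio b r^ε = 1, which makes the induction y_j ≤ y_0 r^j close under the smallness
  -- condition.
  set r := b ^ (-(1 / ε)) with hr
  have hr0 : 0 < r := by positivity
  have hr1 : r < 1 := Real.rpow_lt_one_of_one_lt_of_neg hb (by simpa using hε)
  have hrε : r ^ ε = b⁻¹ := by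
    rw [hr, ← Real.rpow_mul hb0.le, neg_mul, one_div_mul_cancel hε.ne', Real.rpow_neg_one]
  have hdecay : ∀ j, y j ≤ y 0 * r ^ j := by
    intro j
    induction j with
    | zero => simp
    | succ j ih =>
      calc y (j + 1) ≤ K * b ^ j * y j ^ (1 + ε) := h j
        _ ≤ K * b ^ j * (y 0 * r ^ j) ^ (1 + ε) := by
          have := hy j
          gcongr
        _ = (K * y 0 ^ ε) * (y 0 * r ^ j) * (b ^ j * (r ^ ε) ^ j) := by
          rw [Real.rpow_one_add' (by have := hy 0; positivity) (by linarith),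
            Real.mul_rpow (hy 0) (by positivity), ← Real.rpow_natCast r j, ← Real.rpow_mul hr0.le,
            mul_comm (j : ℝ) ε, Real.rpow_mul hr0.le, Real.rpow_natCast, Real.rpow_natCast]
          ring
        _ = (K * y 0 ^ ε) * (y 0 * r ^ j) := by
          rw [hrε, ← mul_pow, mul_inv_cancel₀ hb0.ne', one_pow, mul_one]
        _ ≤ r * (y 0 * r ^ j) := by
          have := hy 0
          gcongr
        _ = _ := by ring
  refine squeeze_zero hy hdecay ?_
  simpa using (tendsto_pow_atTop_nhds_zero_of_lt_one hr0.le hr1).const_mul (y 0)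

end Numeric

end ParabolicPQ

/-! ### Algebra of the exponents -/

namespace ParabolicPQ

/-- The admissible exponents. -/
structure Admissible (n : ℕ) (p q α β : ℝ) : Prop where
  two_le_dim : 2 ≤ n
  two_le_p : 2 ≤ p
  p_le_q : p ≤ q
  one_lt_α : 1 < α
  one_lt_β : 1 < β
  gap : q < p * (α / (α + 1)) * ((β - 1) / β) + 2 / ((n : ℝ) + 2)

/-- The exponent `p / (p + 1 - q)` of the intrinsic scaling. -/
noncomputable def scaleExp (p q : ℝ) : ℝ := p / (p + 1 - q)

/-- The Hölder exponent complementary to `1 / β` and `(q - 1) / p_α`. -/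
noncomputable def compExp (p q α β : ℝ) : ℝ := 1 - 1 / β - (q - 1) / pExp p α

/-- The exponent gained in the energy estimate. -/
noncomputable def energyExp (p q α β : ℝ) : ℝ := min (1 - 1 / β) (scaleExp p q * compExp p q α β)

/-- The superlinearity exponent of the iteration. -/
noncomputable def iterExp (n : ℕ) (p q α β : ℝ) : ℝ :=
  energyExp p q α β * (pExp p α / n + pExp p α / p) - 1

/-- The exponent of the level in the iteration. -/
noncomputable def levelExp (n : ℕ) (p q : ℝ) : ℝ := (p - 2 + (n + 2) * (q - p)) / (n * (p + 1 - q))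

namespace Admissible

variable {n : ℕ} {p q α β : ℝ}

theorem dim_pos (h : Admissible n p q α β) : (0 : ℝ) < n := by
  have := h.two_le_dim
  exact_mod_cast (by omega : 0 < n)

theorem two_le_cast (h : Admissible n p q α β) : (2 : ℝ) ≤ n := by exact_mod_cast h.two_le_dim

theorem pExp_pos (h : Admissible n p q α β) : 0 < pExp p α := by
  have := h.two_le_p; have := h.one_lt_α
  rw [pExp]; positivity

theorem pExp_le (h : Admissible n p q α β) : pExp p α ≤ p := by
  have := h.two_le_p; have := h.one_lt_α
  rw [pExp, div_le_iff₀ (by linarith)]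
  nlinarith

theorem lt_pExp_mul (h : Admissible n p q α β) :
    q - 2 / ((n : ℝ) + 2) < pExp p α * (1 - 1 / β) := by
  have h1 := h.gap
  have hβ := h.one_lt_β
  have h2 : p * (α / (α + 1)) * ((β - 1) / β) = pExp p α * (1 - 1 / β) := by
    rw [pExp]; field_simp
  linarith

theorem one_sub_pos (h : Admissible n p q α β) : 0 < 1 - 1 / β := by
  have hβ := h.one_lt_β
  rw [sub_pos, div_lt_one (by linarith)]; exact hβ

theorem one_sub_lt (h : Admissible n p q α β) : 1 - 1 / β < 1 := by
  have hβ := h.one_lt_β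
  have : 0 < 1 / β := by positivity
  linarith

theorem lt_pExp (h : Admissible n p q α β) : q - 2 / ((n : ℝ) + 2) < pExp p α := by
  nlinarith [h.lt_pExp_mul, h.one_sub_lt, h.pExp_pos]

theorem two_div_le (h : Admissible n p q α β) : 2 / ((n : ℝ) + 2) ≤ 1 / 2 := by
  have := h.two_le_cast
  rw [div_le_div_iff₀ (by linarith) (by norm_num)]
  linarith

/-- From p_α ≤ p the gap condition gives q - p < 2/(n+2) ≤ 1/2. Thus (q-1)/p < 1 and the absorption
is possible. -/
theorem gap_pos (h : Admissible n p q α β) : 0 < p + 1 - q := by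
  have := h.lt_pExp; have := h.pExp_le; have := h.two_div_le
  linarith

theorem one_lt_pExp (h : Admissible n p q α β) : 1 < pExp p α := by
  have := h.lt_pExp; have := h.two_le_p; have := h.two_div_le; have := h.p_le_q
  linarith

theorem p_le_scaleExp (h : Admissible n p q α β) : p ≤ scaleExp p q := by
  have := h.two_le_p; have := h.p_le_q
  rw [scaleExp, le_div_iff₀ h.gap_pos]
  nlinarith

theorem scaleExp_pos (h : Admissible n p q α β) : 0 < scaleExp p q := by
  linarith [h.p_le_scaleExp, h.two_le_p]

theorem div_eq_one_sub (h : Admissible n p q α β) : (q - 1) / p = 1 - 1 / scaleExp p q := by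
  have := h.two_le_p; have := h.gap_pos
  rw [scaleExp]; field_simp; ring

/-- The left-hand product is p_α(1 - 1/β) - (q - 1) and n/(n+2) = 1 - 2/(n+2): this is the gap
condition rewritten for use in Hölder's inequality. -/
theorem compExp_mul (h : Admissible n p q α β) :
    (n : ℝ) / (n + 2) < compExp p q α β * pExp p α := by
  have h1 := h.lt_pExp_mul
  have h0 := h.pExp_pos
  have hn := h.dim_pos
  have h2 : compExp p q α β * pExp p α = pExp p α * (1 - 1 / β) - (q - 1) := by
    rw [compExp]; field_simp
  have h3 : (n : ℝ) / (n + 2) = 1 - 2 / ((n : ℝ) + 2) := by field_simp; ring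
  linarith

theorem compExp_pos (h : Admissible n p q α β) : 0 < compExp p q α β := by
  have h1 := h.compExp_mul
  have hn := h.dim_pos
  have : 0 < compExp p q α β * pExp p α := lt_trans (by positivity) h1
  exact pos_of_mul_pos_left this h.pExp_pos.le

theorem two_le_mExp (h : Admissible n p q α β) : 2 ≤ mExp n p α := by
  have h1 := h.lt_pExp; have := h.two_le_p; have := h.p_le_q
  have hn := h.dim_pos
  rw [mExp, le_div_iff₀ hn]
  have h2 : (2 - 2 / ((n : ℝ) + 2)) * (n + 2) = 2 * n + 2 := by field_simp; ring
  have h3 : (2 - 2 / ((n : ℝ) + 2)) * (n + 2) ≤ pExp p α * (n + 2) := by gcongr; linarith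
  linarith

theorem pExp_le_mExp (h : Admissible n p q α β) : pExp p α ≤ mExp n p α := by
  have hn := h.dim_pos
  rw [mExp, le_div_iff₀ hn]
  nlinarith [h.pExp_pos]

/-- Since m = p_α(n+2)/n, this is again `compExp_mul`: the power of (u - k)₊ left over by Hölder's
inequality does not exceed the one gained by Gagliardo-Nirenberg. -/
theorem inv_compExp_le (h : Admissible n p q α β) : 1 / compExp p q α β ≤ mExp n p α := by
  have h1 := h.compExp_mul
  have hn := h.dim_pos
  rw [div_le_iff₀ h.compExp_pos, mExp]
  rw [div_lt_iff₀ (by linarith)] at h1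
  rw [div_mul_eq_mul_div, le_div_iff₀ hn]
  nlinarith

theorem energyExp_pos (h : Admissible n p q α β) : 0 < energyExp p q α β :=
  lt_min h.one_sub_pos (mul_pos h.scaleExp_pos h.compExp_pos)

theorem energyExp_le_one (h : Admissible n p q α β) : energyExp p q α β ≤ 1 :=
  (min_le_left _ _).trans h.one_sub_lt.le

theorem levelExp_nonneg (h : Admissible n p q α β) : 0 ≤ levelExp n p q := by
  have := h.two_le_p; have := h.p_le_q; have := h.gap_pos; have hn := h.dim_pos
  refine div_nonneg ?_ (by positivity)
  have : 0 ≤ ((n : ℝ) + 2) * (q - p) := mul_nonneg (by positivity) (by linarith)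
  linarith

/-- After division by (n+p)/(np) the claim reads np/((n+2)(p+1-q)) < κ p_α with κ = `energyExp`. If
κ = π · `compExp`, this is `compExp_mul`. If κ = 1 - 1/β, it follows from `lt_pExp_mul`, because q -
2/(n+2) is at least the left-hand side: the difference has the sign of (2 - (q-p)(n+2))(q-1). -/
theorem levelExp_mul_lt_iterExp (h : Admissible n p q α β) :
    levelExp n p q * (n / (n + 2)) < iterExp n p q α β := by
  have hp := h.two_le_p; have hpq := h.p_le_q; have hd := h.gap_pos; have hn := h.dim_pos
  have hP := h.pExp_pos
  have h1 : 1 + levelExp n p q * (n / (n + 2)) = (n + p) / ((n + 2) * (p + 1 - q)) := by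
    rw [levelExp]; field_simp; ring
  have h2 : pExp p α / n + pExp p α / p = pExp p α * ((n + p) / (n * p)) := by field_simp; ring
  rw [iterExp, lt_sub_iff_add_lt', h1, h2, ← mul_assoc]
  have h3 : ((n : ℝ) + p) / ((n + 2) * (p + 1 - q)) =
      n * p / ((n + 2) * (p + 1 - q)) * ((n + p) / (n * p)) := by field_simp
  rw [h3]
  refine mul_lt_mul_of_pos_right ?_ (by positivity)
  rw [energyExp]
  rcases min_cases (1 - 1 / β) (scaleExp p q * compExp p q α β) with ⟨h4, -⟩ | ⟨h4, -⟩
  · rw [h4, mul_comm (1 - 1 / β)]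
    refine lt_of_le_of_lt ?_ h.lt_pExp_mul
    rw [div_le_iff₀ (by positivity)]
    have h5 : (q - 2 / ((n : ℝ) + 2)) * ((n + 2) * (p + 1 - q)) - n * p =
        (2 - (q - p) * (n + 2)) * (q - 1) := by field_simp; ring
    have h6 : (q - p) * (n + 2) ≤ 2 := by
      rw [← le_div_iff₀ (by linarith)]
      linarith [h.lt_pExp, h.pExp_le]
    have h7 : 0 ≤ (2 - (q - p) * (n + 2)) * (q - 1) := mul_nonneg (by linarith) (by linarith)
    linarith
  · rw [h4, mul_assoc, scaleExp]
    have h5 : (n : ℝ) * p / ((n + 2) * (p + 1 - q)) = p / (p + 1 - q) * (n / (n + 2)) := by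
      field_simp
    rw [h5]
    exact mul_lt_mul_of_pos_left h.compExp_mul (by positivity)

theorem iterExp_pos (h : Admissible n p q α β) : 0 < iterExp n p q α β :=
  lt_of_le_of_lt (mul_nonneg h.levelExp_nonneg (by positivity)) h.levelExp_mul_lt_iterExp

/-- Positivity of this number means that raising k improves the smallness condition: the gain
k^(-mε) from y_0^ε beats the growth k^(l p_α) of the recursion constant. -/
theorem mExp_sub_pos (h : Admissible n p q α β) :
    0 < mExp n p α - levelExp n p q * pExp p α / iterExp n p q α β := by
  have hn := h.dim_pos
  have h1 := h.levelExp_mul_lt_iterExp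
  have hP := h.pExp_pos
  rw [sub_pos, div_lt_iff₀ h.iterExp_pos, mExp]
  rw [mul_div_assoc', div_lt_iff₀ (by linarith)] at h1
  rw [div_mul_eq_mul_div, lt_div_iff₀ hn]
  nlinarith

/-- The smallness condition of the iteration holds for all levels above a threshold. -/
theorem iteration_condition (h : Admissible n p q α β) {Λ k ρ σ μ θ : ℝ}
    (hθ : θ = 1 / (mExp n p α - levelExp n p q * pExp p α / iterExp n p q α β))
    (hΛ : 0 ≤ Λ) (hk : 0 < k) (hρ : 0 < ρ) (hσ : 0 < σ) (hμ : 0 ≤ μ)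
    (hkΛ : Λ ^ (θ / iterExp n p q α β) *
      ((σ / ρ ^ (p / (p + 1 - q))) ^ (pExp p α * θ / (n * iterExp n p q α β)) *
        (1 / ρ ^ ((q - p) * (pExp p α * θ / ((p + 1 - q) * iterExp n p q α β)))) * μ ^ θ) ≤ k) :
    Λ * (k ^ (-mExp n p α) * ((ρ ^ (n : ℝ) * σ) ^ (pExp p α / n) *
      (k / ρ) ^ (scaleExp p q * (pExp p α / n + pExp p α / p)))) *
        (μ / k ^ mExp n p α) ^ iterExp n p q α β ≤ 1 := by
  have hp := h.two_le_p; have hpq := h.p_le_q; have hd := h.gap_pos; have hn := h.dim_pos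
  have hP := h.pExp_pos
  have hε := h.iterExp_pos
  have hden := h.mExp_sub_pos
  have hθ0 : 0 < θ := by rw [hθ]; positivity
  set ε := iterExp n p q α β with hεdef
  set P := pExp p α with hPdef
  set l := levelExp n p q with hl
  have hθε : (θ / ε) * (ε * mExp n p α - l * P) = 1 := by
    rw [hθ]
    have : ε * mExp n p α - l * P = ε * (mExp n p α - l * P / ε) := by field_simp
    rw [this, div_mul_eq_mul_div, one_div_mul_eq_div, div_div, mul_comm _ ε,
      div_self (mul_pos hε hden).ne']
  set m := mExp n p α with hm
  have hpos : 0 < ε * m - l * P := pos_of_mul_pos_right (hθε ▸ one_pos) (by positivity)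
  set s := (σ / ρ ^ (p / (p + 1 - q))) ^ (P / n) * ρ ^ (-((q - p) * P / (p + 1 - q))) with hs
  have hs0 : 0 < s := by positivity
  -- The stated lower bound for k, with the powers of σ, ρ and μ collected; θ/ε is the reciprocal of
  -- εm - l p_α.
  have h1 : (Λ * (s * μ ^ ε)) ^ (θ / ε) ≤ k := by
    refine le_of_eq_of_le ?_ hkΛ
    rw [Real.mul_rpow hΛ (by positivity), Real.mul_rpow hs0.le (by positivity), hs,
      Real.mul_rpow (by positivity) (by positivity), ← Real.rpow_mul (by positivity),
      ← Real.rpow_mul hρ.le, ← Real.rpow_mul hμ, one_div, ← Real.rpow_neg hρ.le]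
    congr 4
    · field_simp
    · field_simp
    · field_simp
  have h2 : Λ * (s * μ ^ ε) ≤ k ^ (ε * m - l * P) := by
    have h3 := Real.rpow_le_rpow (by positivity) h1 hpos.le
    rwa [← Real.rpow_mul (by positivity), hθε, Real.rpow_one] at h3
  -- Sorting the powers of k defines `levelExp`; sorting those of ρ and σ yields the scale-invariant
  -- quotient and the leftover power of ρ, which disappears for p = q.
  have h4 : k ^ (-m) * ((ρ ^ (n : ℝ) * σ) ^ (P / n) * (k / ρ) ^ (scaleExp p q * (P / n + P / p))) =
      s * k ^ (l * P) := by
    have hkk : k ^ (-m) * k ^ (scaleExp p q * (P / n + P / p)) = k ^ (l * P) := by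
      rw [← Real.rpow_add hk]
      congr 1
      rw [hm, mExp, scaleExp, hl, levelExp, ← hPdef]
      field_simp; ring
    have hρρ : ρ ^ ((n : ℝ) * (P / n)) / ρ ^ (scaleExp p q * (P / n + P / p)) =
        ρ ^ (-((q - p) * P / (p + 1 - q))) / ρ ^ (p / (p + 1 - q) * (P / n)) := by
      rw [← Real.rpow_sub hρ, ← Real.rpow_sub hρ]
      congr 1
      rw [scaleExp]
      field_simp; ring
    rw [hs, Real.mul_rpow (by positivity) hσ.le, Real.div_rpow hk.le hρ.le,
      Real.div_rpow hσ.le (by positivity), ← Real.rpow_mul hρ.le, ← Real.rpow_mul hρ.le, ← hkk]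
    calc _ = ρ ^ ((n : ℝ) * (P / n)) / ρ ^ (scaleExp p q * (P / n + P / p)) * σ ^ (P / n) *
          (k ^ (-m) * k ^ (scaleExp p q * (P / n + P / p))) := by ring
      _ = _ := by rw [hρρ]; ring
  rw [h4, Real.div_rpow hμ (by positivity), ← Real.rpow_mul hk.le]
  calc Λ * (s * k ^ (l * P)) * (μ ^ ε / k ^ (m * ε)) =
        Λ * (s * μ ^ ε) * (k ^ (l * P) / k ^ (m * ε)) := by ring
    _ ≤ k ^ (ε * m - l * P) * (k ^ (l * P) / k ^ (m * ε)) := by gcongr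
    _ = 1 := by
      rw [← Real.rpow_sub hk, ← Real.rpow_add hk]
      ring_nf
      exact Real.rpow_zero k

end Admissible

end ParabolicPQ

/-! ### One step of the iteration: integral form -/

namespace ParabolicPQ

/-- A transfer to real numbers, where the absorption of R takes place. Finiteness of R is essential,
since R = ∞ would satisfy the hypothesis trivially. -/
theorem energy_toReal {R L L' e Y A B : ℝ≥0∞} {m ϱ β g θ s t : ℝ} (hR : R ≠ ⊤) (hL : L ≠ ⊤)
    (hL' : L' ≠ ⊤) (he : e ≠ ⊤) (hY : Y ≠ ⊤) (hA : A ≠ ⊤) (hB : B ≠ ⊤) (hm : 2 ≤ m) (hϱ : 0 < ϱ)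
    (hϱm : ϱ ≤ m) (hβ : 0 < β) (hg : 0 ≤ g) (hθ : 0 ≤ θ) (hs : 0 ≤ s) (ht : 0 ≤ t)
    (h : R ≤ L' * (e ^ (m - 2) * Y) + L * (2 ^ g * ((e ^ (m - ϱ) * Y) ^ (1 / ϱ) *
      B ^ (1 / β) * (R ^ θ * A ^ s + (e ^ m * Y) ^ t)))) :
    R.toReal ≤ L'.toReal * (e.toReal ^ (m - 2) * Y.toReal) + L.toReal * (2 ^ g *
      ((e.toReal ^ (m - ϱ) * Y.toReal) ^ (1 / ϱ) * B.toReal ^ (1 / β) *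
        (R.toReal ^ θ * A.toReal ^ s + (e.toReal ^ m * Y.toReal) ^ t))) := by
  lift R to NNReal using hR
  lift L to NNReal using hL
  lift L' to NNReal using hL'
  lift e to NNReal using he
  lift Y to NNReal using hY
  lift A to NNReal using hA
  lift B to NNReal using hB
  have h2 : (2 : ℝ≥0∞) = ((2 : NNReal) : ℝ≥0∞) := rfl
  have hm2 : 0 ≤ m - 2 := by linarith
  have hmϱ : 0 ≤ m - ϱ := by linarith
  have hm0 : 0 ≤ m := by linarith
  have hϱ' : 0 ≤ 1 / ϱ := by positivity
  have hβ' : 0 ≤ 1 / β := by positivity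
  simp only [h2, ← ENNReal.coe_rpow_of_nonneg _ hm2, ← ENNReal.coe_rpow_of_nonneg _ hmϱ,
    ← ENNReal.coe_rpow_of_nonneg _ hm0, ← ENNReal.coe_rpow_of_nonneg _ hg, ← ENNReal.coe_mul,
    ← ENNReal.coe_rpow_of_nonneg _ hϱ', ← ENNReal.coe_rpow_of_nonneg _ hβ',
    ← ENNReal.coe_rpow_of_nonneg _ hθ, ← ENNReal.coe_rpow_of_nonneg _ hs,
    ← ENNReal.coe_rpow_of_nonneg _ ht, ← ENNReal.coe_add, ENNReal.coe_le_coe] at h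
  simp only [ENNReal.coe_toReal]
  exact_mod_cast h

theorem decay_toReal {y g R v A L e Y : ℝ≥0∞} {N P a a' m : ℝ} (hg : g ≠ ⊤) (hR : R ≠ ⊤)
    (hv : v ≠ ⊤) (hA : A ≠ ⊤) (hL : L ≠ ⊤) (he : e ≠ ⊤) (hY : Y ≠ ⊤) (hN : 0 ≤ N) (hP : 0 ≤ P)
    (ha : 0 ≤ a) (ha' : 0 ≤ a') (hPm : P ≤ m)
    (h : y ≤ g * (2 * R * v) ^ N * (2 ^ P * (R ^ a * A ^ a' + L ^ P * (e ^ (m - P) * Y)))) :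
    y.toReal ≤ g.toReal * (2 * R.toReal * v.toReal) ^ N * (2 ^ P * (R.toReal ^ a * A.toReal ^ a' +
      L.toReal ^ P * (e.toReal ^ (m - P) * Y.toReal))) := by
  lift g to NNReal using hg
  lift R to NNReal using hR
  lift v to NNReal using hv
  lift A to NNReal using hA
  lift L to NNReal using hL
  lift e to NNReal using he
  lift Y to NNReal using hY
  have h2 : (2 : ℝ≥0∞) = ((2 : NNReal) : ℝ≥0∞) := rfl
  have hmP : 0 ≤ m - P := by linarith
  simp only [h2, ← ENNReal.coe_mul, ← ENNReal.coe_rpow_of_nonneg _ hN,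
    ← ENNReal.coe_rpow_of_nonneg _ hP, ← ENNReal.coe_rpow_of_nonneg _ hmP,
    ← ENNReal.coe_rpow_of_nonneg _ ha, ← ENNReal.coe_rpow_of_nonneg _ ha', ← ENNReal.coe_add] at h
  have hy : y ≠ ⊤ := ne_top_of_le_ne_top ENNReal.coe_ne_top h
  lift y to NNReal using hy
  rw [ENNReal.coe_le_coe] at h
  simp only [ENNReal.coe_toReal]
  exact_mod_cast h

variable {n : ℕ}

/-- A subsolution `u` with gradient `G` and flux `V` of `p,q`-growth on the open set `O`, extended
to the whole space-time. -/
structure IsGrowthSubsolution (p q α β : ℝ) (O : Set (E n × ℝ)) (u : E n × ℝ → ℝ)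
    (G V : E n × ℝ → E n) (a b : E n × ℝ → ℝ) : Prop where
  isOpen : IsOpen O
  isSubsolutionOn : IsSubsolutionOn O u G V
  integrable : Integrable fun z => ‖u z‖ ^ qExp q β
  integrable_grad : Integrable fun z => ‖G z‖ ^ qExp q β
  integrable_flux : Integrable fun z => ‖V z‖ ^ (qExp q β).conjExponent
  inner_nonneg : ∀ᵐ z, 0 ≤ inner ℝ (V z) (G z)
  coercive : ∀ᵐ z ∂(volume.restrict O), a z * ‖G z‖ ^ p ≤ inner ℝ (V z) (G z)
  growth : ∀ᵐ z ∂(volume.restrict O), ‖V z‖ ≤ b z * (1 + ‖G z‖) ^ (q - 1)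
  a_pos : ∀ᵐ z ∂(volume.restrict O), 0 < a z
  b_nonneg : ∀ᵐ z ∂(volume.restrict O), 0 ≤ b z
  aemeasurable_a : AEMeasurable (fun z => (a z)⁻¹) (volume.restrict O)
  aemeasurable_b : AEMeasurable b (volume.restrict O)

theorem Admissible.two_le_qExp {p q α β : ℝ} (h : Admissible n p q α β) : 2 ≤ qExp q β := by
  have := h.two_le_p; have := h.p_le_q; have := h.one_lt_β
  rw [qExp, le_div_iff₀ (by linarith)]
  nlinarith

theorem Admissible.pExp_le_qExp {p q α β : ℝ} (h : Admissible n p q α β) :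
    pExp p α ≤ qExp q β := by
  have := h.two_le_p; have := h.p_le_q; have := h.one_lt_β; have := h.pExp_le
  have h1 : q ≤ qExp q β := by
    rw [qExp, le_div_iff₀ (by linarith)]
    nlinarith
  linarith

variable {p q α β : ℝ} {O : Set (E n × ℝ)} {u : E n × ℝ → ℝ}
    {G V : E n × ℝ → E n} {a b : E n × ℝ → ℝ}

/-- One step of the iteration, between two cylinders and two levels. -/
theorem IsGrowthSubsolution.lintegral_step (hE : Admissible n p q α β)
    (hu : IsGrowthSubsolution p q α β O u G V a b) (z₀ : E n × ℝ)
    {R₁ R₂ σ₁ σ₂ : ℝ} (hR₁ : 0 ≤ R₁) (hR : R₁ < R₂) (hσ₁ : 0 ≤ σ₁) (hσ : σ₁ < σ₂)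
    (hSO : Metric.closedBall z₀.1 R₂ ×ˢ Ico (z₀.2 - σ₂) z₀.2 ⊆ O) {L L' : ℝ}
    (hL : 4 * scaleExp p q / (R₂ - R₁) ≤ L) (hL' : 2 * scaleExp p q / (σ₂ - σ₁) ≤ L') {l l' : ℝ}
    (hl : l < l') {c : ℝ≥0∞} (hc0 : c ≠ 0) (hc : c ≠ ⊤) {e Y A B : ℝ≥0∞}
    (he : e = ENNReal.ofReal (1 / (l' - l)))
    (hY : Y = c * ∫⁻ z in cyl z₀ R₂ σ₂, ENNReal.ofReal (max (u z - l) 0) ^ mExp n p α)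
    (hA : A = c * ∫⁻ z in cyl z₀ R₂ σ₂, ENNReal.ofReal (a z)⁻¹ ^ α)
    (hB : B = c * ∫⁻ z in cyl z₀ R₂ σ₂, ENNReal.ofReal (b z) ^ β) :
    ∃ R : ℝ≥0∞, R ≠ ⊤ ∧
      R ≤ ENNReal.ofReal L' * (e ^ (mExp n p α - 2) * Y) + ENNReal.ofReal L * (2 ^ (q - 1) *
        ((e ^ (mExp n p α - 1 / compExp p q α β) * Y) ^ (1 / (1 / compExp p q α β)) *
          B ^ (1 / β) * (R ^ ((q - 1) / p) * A ^ ((q - 1) / (p * α)) +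
            (e ^ mExp n p α * Y) ^ ((q - 1) / pExp p α)))) ∧
      c * ∫⁻ z in cyl z₀ R₁ σ₁, ENNReal.ofReal (max (u z - l') 0) ^ mExp n p α ≤
        gnConst n (pExp p α) * (2 * R * c⁻¹) ^ (pExp p α / n) * (2 ^ pExp p α *
          (R ^ (α / (α + 1)) * A ^ (1 / (α + 1)) +
            ENNReal.ofReal L ^ pExp p α * (e ^ (mExp n p α - pExp p α) * Y))) := by
  have hp := hE.two_le_p
  have hpq := hE.p_le_q
  have hα := hE.one_lt_α
  have hβ := hE.one_lt_β
  have hr2 := hE.two_le_qExp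
  have hπ : 1 < scaleExp p q := by linarith [hE.p_le_scaleExp]
  have hs0 : 0 < compExp p q α β := hE.compExp_pos
  obtain ⟨φ, R, hφm, hφ0, hφ1, hRtop, hR1, hR2, hR3⟩ := hu.isSubsolutionOn.cyl_estimates
    hE.two_le_dim hu.isOpen hr2 (Real.HolderConjugate.conjExponent (by linarith)) hu.integrable
    hu.integrable_grad hu.integrable_flux hu.inner_nonneg l' hE.one_lt_pExp hE.pExp_le_qExp hπ z₀
    hR₁ hR hσ₁ hσ hSO hL hL'
  rw [← hE.div_eq_one_sub] at hR1
  have hL0 : 0 ≤ L := le_trans (by have := sub_pos.2 hR; positivity) hL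
  have hL0' : 0 ≤ L' := le_trans (by have := sub_pos.2 hσ; positivity) hL'
  have hcylO : cyl z₀ R₂ σ₂ ⊆ O :=
    (Set.prod_mono Metric.ball_subset_closedBall Ioo_subset_Ico_self).trans hSO
  have hle : volume.restrict (cyl z₀ R₂ σ₂) ≤ volume.restrict O :=
    Measure.restrict_mono hcylO le_rfl
  -- With c later the inverse volume of Q, all integrals become normalized, so that the constants
  -- see a and b only through their means.
  set ν := c • volume.restrict (cyl z₀ R₂ σ₂) with hν
  have hac : ν ≪ volume.restrict (cyl z₀ R₂ σ₂) := Measure.smul_absolutelyContinuous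
  have hνint : ∀ f : E n × ℝ → ℝ≥0∞, ∫⁻ z, f z ∂ν = c * ∫⁻ z in cyl z₀ R₂ σ₂, f z := fun f => by
    rw [hν, lintegral_smul_measure, smul_eq_mul]
  have hum : AEMeasurable u ν := (hu.isSubsolutionOn.locallyIntegrable.aestronglyMeasurable
    |>.aemeasurable).mono_ac (hac.trans Measure.restrict_le_self.absolutelyContinuous)
  have hGm : AEMeasurable G ν := (hu.isSubsolutionOn.locallyIntegrable_grad.aestronglyMeasurable
    |>.aemeasurable).mono_ac (hac.trans Measure.restrict_le_self.absolutelyContinuous)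
  have hVm : AEMeasurable V ν := (hu.isSubsolutionOn.locallyIntegrable_flux.aestronglyMeasurable
    |>.aemeasurable).mono_ac (hac.trans Measure.restrict_le_self.absolutelyContinuous)
  have hacO : ν ≪ volume.restrict O := hac.trans hle.absolutelyContinuous
  have hbm : AEMeasurable b ν := hu.aemeasurable_b.mono_ac hacO
  have ham : AEMeasurable (fun z => (a z)⁻¹) ν := hu.aemeasurable_a.mono_ac hacO
  have him : AEMeasurable (fun z => if l' < u z then (1 : ℝ) else 0) ν := by
    have : Measurable fun y : ℝ => if l' < y then (1 : ℝ) else 0 :=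
      Measurable.ite measurableSet_Ioi measurable_const measurable_const
    exact this.comp_aemeasurable hum
  set W : E n × ℝ → ℝ≥0∞ := fun z => ENNReal.ofReal (max (u z - l') 0) with hWdef
  set W' : E n × ℝ → ℝ≥0∞ := fun z => ENNReal.ofReal (max (u z - l) 0) with hWdef'
  set F : E n × ℝ → ℝ≥0∞ := fun z => ENNReal.ofReal ((if l' < u z then 1 else 0) * ‖G z‖) with hF
  set S : E n × ℝ → ℝ≥0∞ := fun z =>
    ENNReal.ofReal ((if l' < u z then 1 else 0) * inner ℝ (V z) (G z)) with hS
  have hWm : AEMeasurable W ν := ((hum.sub_const _).max aemeasurable_const).ennreal_ofReal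
  have hFm : AEMeasurable F ν := (him.mul hGm.norm).ennreal_ofReal
  have hSm : AEMeasurable S ν := (him.mul (hVm.inner hGm)).ennreal_ofReal
  have hφm' : AEMeasurable (fun z => ENNReal.ofReal (φ z)) ν :=
    hφm.ennreal_ofReal.aemeasurable
  have hWW' : ∀ z, W z ≤ W' z := fun z => ENNReal.ofReal_le_ofReal (by gcongr)
  have heW : ∀ z, W z ≠ 0 → 1 ≤ e * W' z := by
    intro z hz
    have h1 : l' < u z := by
      by_contra h
      exact hz (by simp only [hWdef]; rw [max_eq_right (by linarith)]; simp)
    have hll : 0 < l' - l := by linarith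
    rw [he, ← ENNReal.ofReal_mul (by positivity), max_eq_left (by linarith), ENNReal.one_le_ofReal,
      one_div_mul_eq_div, one_le_div hll]
    linarith
  have hφ1' : ∀ z, ENNReal.ofReal (φ z) ≤ 1 := fun z => by simpa using hφ1 z
  have hFS : ∀ᵐ z ∂ν, F z ^ p ≤ ENNReal.ofReal (a z)⁻¹ * S z := by
    filter_upwards [hacO.ae_le hu.coercive, hacO.ae_le hu.a_pos] with z h1 h2
    simp only [hF, hS]
    split_ifs with hlt
    · rw [one_mul, one_mul, ENNReal.ofReal_rpow_of_nonneg (norm_nonneg _) (by linarith),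
        ← ENNReal.ofReal_mul (by positivity)]
      refine ENNReal.ofReal_le_ofReal ?_
      rw [inv_mul_eq_div, le_div_iff₀ h2, mul_comm]
      exact h1
    · simp [(by linarith : 0 < p)]
  have hSR : ∫⁻ z, ENNReal.ofReal (φ z) * S z ∂ν ≤ c * R := by
    rw [hνint]
    gcongr
    refine le_of_eq_of_le (lintegral_congr fun z => ?_) hR2
    rw [hS, ENNReal.ofReal_mul (hφ0 z)]
  have hRle : c * R ≤ ENNReal.ofReal L' * ∫⁻ z, W z ^ (2 : ℝ) ∂ν + ENNReal.ofReal L *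
      ∫⁻ z, ENNReal.ofReal (φ z) ^ ((q - 1) / p) *
        (W z * (ENNReal.ofReal (b z) * (1 + F z) ^ (q - 1))) ∂ν := by
    rw [← lintegral_const_mul' _ _ ENNReal.ofReal_ne_top,
      ← lintegral_const_mul' _ _ ENNReal.ofReal_ne_top, ← lintegral_add_left' (by fun_prop), hνint]
    gcongr
    refine hR1.trans (lintegral_mono_ae ?_)
    filter_upwards [hle.absolutelyContinuous.ae_le hu.growth,
      hle.absolutelyContinuous.ae_le hu.b_nonneg] with z h1 h2
    have hw : 0 ≤ max (u z - l') 0 := le_max_right _ _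
    have hq0 : 0 ≤ (q - 1) / p := div_nonneg (by linarith) (by linarith)
    have hφp := Real.rpow_nonneg (hφ0 z) ((q - 1) / p)
    rw [ENNReal.ofReal_add (by positivity) (by positivity), ENNReal.ofReal_mul hL0',
      ENNReal.ofReal_mul hL0, ENNReal.ofReal_mul hφp, ENNReal.ofReal_mul hw,
      ← ENNReal.ofReal_rpow_of_nonneg (hφ0 z) hq0, ← Real.rpow_two,
      ← ENNReal.ofReal_rpow_of_nonneg hw two_pos.le]
    gcongr _ + _ * (_ * ?_)
    -- F equals |G| only above the level l'; below it the factor W vanishes and F is irrelevant.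
    rcases le_or_gt (u z) l' with hlt | hlt
    · simp only [hWdef, max_eq_right (sub_nonpos.2 hlt)]; simp
    · gcongr _ * ?_
      simp only [hF, if_pos hlt, one_mul]
      refine (ENNReal.ofReal_le_ofReal h1).trans (le_of_eq ?_)
      rw [ENNReal.ofReal_mul h2, ← ENNReal.ofReal_rpow_of_nonneg (by positivity) (by linarith),
        ENNReal.ofReal_add zero_le_one (norm_nonneg _), ENNReal.ofReal_one]
  have hetop : e ≠ ⊤ := by rw [he]; exact ENNReal.ofReal_ne_top
  refine ⟨c * R, ENNReal.mul_ne_top hc hRtop, ?_, ?_⟩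
  · rw [hY, hA, hB, ← hνint, ← hνint, ← hνint]
    exact energy_level_le hWm hFm hφm' hbm.ennreal_ofReal ham.ennreal_ofReal hSm hetop hWW' heW hφ1'
      (by linarith) (by linarith) (by linarith) (by linarith) (by positivity) hE.inv_compExp_le
      hE.two_le_mExp (by rw [one_div_one_div, compExp]; ring) hFS hSR hRle
  · have hgrad := gradient_level_le hWm hφm' ham.ennreal_ofReal hSm hetop ENNReal.ofReal_ne_top hWW'
      heW hφ1' (by linarith) (by linarith) hE.pExp_le_mExp hFS hSR (L := ENNReal.ofReal L)
    rw [hY, hA, ← hνint, ← hνint]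
    -- Gagliardo-Nirenberg is not linear in the measure: one factor c normalizes the gradient
    -- integral, while the extra power of the energy leaves c⁻¹ behind, later bounded by a multiple
    -- of ρⁿσ.
    have h2R : 2 * (c * R) * c⁻¹ = 2 * R := by
      rw [mul_comm c R, ← mul_assoc, mul_assoc, ENNReal.mul_inv_cancel hc0 hc, mul_one]
    rw [h2R]
    calc _ ≤ c * (gnConst n (pExp p α) * (2 * R) ^ (pExp p α / n) *
          ∫⁻ z in cyl z₀ R₂ σ₂, ENNReal.ofReal ((φ z * ((if l' < u z then 1 else 0) * ‖G z‖) +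
            L * max (u z - l') 0) ^ pExp p α)) := by
          gcongr
          exact hR3
      _ = gnConst n (pExp p α) * (2 * R) ^ (pExp p α / n) *
          ∫⁻ z, (ENNReal.ofReal (φ z) * F z + ENNReal.ofReal L * W z) ^ pExp p α ∂ν := by
          rw [mul_left_comm, hνint]
          congr 2
          refine lintegral_congr fun z => ?_
          have hi : (0 : ℝ) ≤ if l' < u z then 1 else 0 := by split_ifs <;> norm_num
          have hw : 0 ≤ max (u z - l') 0 := le_max_right _ _
          have h0 := hφ0 z
          rw [hF, hWdef, ← ENNReal.ofReal_mul h0, ← ENNReal.ofReal_mul hL0,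
            ← ENNReal.ofReal_add (by positivity) (by positivity),
            ENNReal.ofReal_rpow_of_nonneg (by positivity) hE.pExp_pos.le]
      _ ≤ _ := by gcongr

end ParabolicPQ

/-! ### One step of the iteration: normalized form -/

namespace ParabolicPQ

variable {n : ℕ}

/-- The power of the structural constant in the energy estimate. -/
noncomputable def energyGrowthExp (n : ℕ) (p q α β : ℝ) : ℝ :=
  3 + scaleExp p q + (1 + scaleExp p q) * (mExp n p α + 2 + (q - 1) +
    mExp n p α / (1 / compExp p q α β) + 1 / β + (q - 1) / (p * α) +
      mExp n p α * ((q - 1) / pExp p α))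

/-- The power of the structural constant in one step of the iteration. -/
noncomputable def stepGrowthExp (n : ℕ) (p q α β : ℝ) : ℝ :=
  3 + (2 + energyGrowthExp n p q α β) * (pExp p α / n) + 2 * pExp p α +
    energyGrowthExp n p q α β * (α / (α + 1)) + mExp n p α

theorem Admissible.energyGrowthExp_nonneg {p q α β : ℝ} (hE : Admissible n p q α β) :
    0 ≤ energyGrowthExp n p q α β := by
  have := hE.scaleExp_pos; have := hE.two_le_mExp; have := hE.two_le_p
  have := hE.compExp_pos; have := hE.one_lt_α; have := hE.one_lt_β; have := hE.pExp_pos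
  have : 0 ≤ q - 1 := by linarith [hE.p_le_q]
  rw [energyGrowthExp]
  positivity

theorem Admissible.stepGrowthExp_pos {p q α β : ℝ} (hE : Admissible n p q α β) :
    0 < stepGrowthExp n p q α β := by
  have := hE.energyGrowthExp_nonneg; have := hE.two_le_mExp; have := hE.pExp_pos
  have := hE.one_lt_α; have := hE.dim_pos
  rw [stepGrowthExp]
  positivity

/-- Since α/(α+1) = p_α/p, the powers of δ from the slice norm and the gradient integral add up to
the superlinear exponent of the recursion. -/
theorem Admissible.energyExp_mul {p q α β : ℝ} (hE : Admissible n p q α β) :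
    energyExp p q α β * (pExp p α / n + α / (α + 1)) = 1 + iterExp n p q α β := by
  have := hE.two_le_p
  have h : pExp p α / p = α / (α + 1) := by rw [pExp]; field_simp
  rw [iterExp, h]; ring

variable {p q α β : ℝ} {O : Set (E n × ℝ)} {u : E n × ℝ → ℝ}
    {G V : E n × ℝ → E n} {a b : E n × ℝ → ℝ}

/-- A single number Γ bounds every structural and geometric constant of the step. The iteration
takes Γ = H·2^j, so that the fixed power of Γ becomes a geometric factor. -/
theorem IsGrowthSubsolution.toReal_step_le (hE : Admissible n p q α β)
    (hu : IsGrowthSubsolution p q α β O u G V a b) (z₀ : E n × ℝ)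
    {R₁ R₂ σ₁ σ₂ : ℝ} (hR₁ : 0 ≤ R₁) (hR : R₁ < R₂) (hσ₁ : 0 ≤ σ₁) (hσ : σ₁ < σ₂)
    (hSO : Metric.closedBall z₀.1 R₂ ×ˢ Ico (z₀.2 - σ₂) z₀.2 ⊆ O) {ρ σ Γ k l l' δ w : ℝ}
    (hΓ : 2 ≤ Γ) (hρ : 0 < ρ) (hρk : ρ ≤ k) (hσ0 : 0 < σ)
    (hL : 4 * scaleExp p q / (R₂ - R₁) ≤ Γ / ρ) (hL' : 2 * scaleExp p q / (σ₂ - σ₁) ≤ Γ / σ)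
    (hl : l < l') (hll : 1 / (l' - l) ≤ Γ / k) (hkσ : k ^ 2 / σ ≤ Γ * (k / ρ) ^ scaleExp p q)
    {c : ℝ≥0∞} (hc0 : c ≠ 0) (hc : c ≠ ⊤) (hw : 0 ≤ w) (hcw : c⁻¹.toReal ≤ Γ * w)
    (hA : c * ∫⁻ z in cyl z₀ R₂ σ₂, ENNReal.ofReal (a z)⁻¹ ^ α ≤ ENNReal.ofReal Γ)
    (hB : c * ∫⁻ z in cyl z₀ R₂ σ₂, ENNReal.ofReal (b z) ^ β ≤ ENNReal.ofReal Γ)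
    (hg : (gnConst n (pExp p α)).toReal ≤ Γ)
    (hY : c * ∫⁻ z in cyl z₀ R₂ σ₂, ENNReal.ofReal (max (u z - l) 0) ^ mExp n p α ≠ ⊤)
    (hYδ : (c * ∫⁻ z in cyl z₀ R₂ σ₂, ENNReal.ofReal (max (u z - l) 0) ^ mExp n p α).toReal =
      k ^ mExp n p α * δ) (hδ : 0 ≤ δ) (hδ1 : δ ≤ 1) :
    (c * ∫⁻ z in cyl z₀ R₁ σ₁, ENNReal.ofReal (max (u z - l') 0) ^ mExp n p α).toReal ≤
      Γ ^ stepGrowthExp n p q α β * (w ^ (pExp p α / n) *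
        ((k / ρ) ^ (scaleExp p q * (pExp p α / n + α / (α + 1))) *
          δ ^ (1 + iterExp n p q α β))) := by
  have hΓ0 : 0 < Γ := by linarith
  have hk : 0 < k := by linarith
  have hp := hE.two_le_p
  have hpq := hE.p_le_q
  have hα := hE.one_lt_α
  have hβ := hE.one_lt_β
  have hs := hE.compExp_pos
  have hP := hE.pExp_pos
  have hm := hE.two_le_mExp
  have hn := hE.dim_pos
  have hq : 0 ≤ q - 1 := by linarith
  have hΓρ : 0 ≤ Γ / ρ := by positivity
  have hΓσ : 0 ≤ Γ / σ := by positivity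
  have hl0 : 0 ≤ 1 / (l' - l) := by have := sub_pos.2 hl; positivity
  obtain ⟨R, hRtop, h1, h2⟩ := hu.lintegral_step hE z₀ hR₁ hR hσ₁ hσ hSO hL hL' hl hc0 hc
    rfl rfl rfl rfl
  have hAtop := ne_top_of_le_ne_top ENNReal.ofReal_ne_top hA
  have hBtop := ne_top_of_le_ne_top ENNReal.ofReal_ne_top hB
  have hAΓ := ENNReal.toReal_mono ENNReal.ofReal_ne_top hA
  have hBΓ := ENNReal.toReal_mono ENNReal.ofReal_ne_top hB
  rw [ENNReal.toReal_ofReal hΓ0.le] at hAΓ hBΓ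
  have h1' := energy_toReal hRtop ENNReal.ofReal_ne_top ENNReal.ofReal_ne_top ENNReal.ofReal_ne_top
    hY hAtop hBtop hm (by positivity) hE.inv_compExp_le (by linarith) hq (by positivity)
    (by positivity) (by positivity) h1
  have h2' := decay_toReal (gnConst_ne_top n hP.le) hRtop (ENNReal.inv_ne_top.2 hc0) hAtop
    ENNReal.ofReal_ne_top ENNReal.ofReal_ne_top hY (by positivity) hP.le (by positivity)
    (by positivity) hE.pExp_le_mExp h2
  rw [hYδ, ENNReal.toReal_ofReal hΓρ, ENNReal.toReal_ofReal hl0] at h1' h2'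
  rw [ENNReal.toReal_ofReal hΓσ] at h1'
  have hκ1 := hE.energyExp_le_one
  have hR' := energy_numeric hΓ hk hρ hρk hσ0 hδ hδ1 hl0 hll le_rfl le_rfl ENNReal.toReal_nonneg
    hAΓ ENNReal.toReal_nonneg hBΓ ENNReal.toReal_nonneg hkσ hm (by positivity) hE.inv_compExp_le
    (by linarith) (by linarith [hE.p_le_scaleExp]) hq hE.div_eq_one_sub (by positivity)
    (by positivity) (κ := energyExp p q α β)
    ((min_le_left _ _).trans (by rw [one_div_one_div, compExp]; linarith))
    ((min_le_right _ _).trans (by rw [one_div_one_div])) hκ1 h1'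
  have ha1 : α / (α + 1) ≤ 1 := by rw [div_le_one (by linarith)]; linarith
  have ha0 : 0 ≤ α / (α + 1) := by positivity
  have hfin := decay_numeric (π := scaleExp p q) (κ := energyExp p q α β)
    (c₁ := energyGrowthExp n p q α β) hΓ hk hρ hρk hδ hδ1 hl0 hll hΓρ le_rfl ENNReal.toReal_nonneg
    hAΓ ENNReal.toReal_nonneg hP.le hE.pExp_le_mExp ha0 (by positivity)
    (by rw [div_le_one (by linarith)]; linarith) (by positivity)
    (by
      rw [pExp, mul_div_assoc]
      exact mul_le_mul_of_nonneg_right hE.p_le_scaleExp ha0)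
    hE.energyExp_pos.le (mul_le_one₀ hκ1 ha0 ha1) ENNReal.toReal_nonneg hw hcw hg
    hE.energyGrowthExp_nonneg hR' h2'
  rw [hE.energyExp_mul] at hfin
  exact hfin

end ParabolicPQ

/-! ### De Giorgi's iteration -/

namespace ParabolicPQ

variable {n : ℕ} {p q α β : ℝ} {O : Set (E n × ℝ)} {u : E n × ℝ → ℝ}
    {G V : E n × ℝ → E n} {a b : E n × ℝ → ℝ}

theorem volume_cyl_pos (z₀ : E n × ℝ) {ρ σ : ℝ} (hρ : 0 < ρ) (hσ : 0 < σ) :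
    0 < volume (cyl z₀ ρ σ) := by
  rw [cyl, Measure.volume_eq_prod, Measure.prod_prod]
  refine ENNReal.mul_pos (Metric.measure_ball_pos _ _ hρ).ne' ?_
  rw [Real.volume_Ioo]
  simpa using hσ

/-- De Giorgi's iteration: a subsolution is bounded by every level that is large enough with
respect to its mean. -/
theorem IsGrowthSubsolution.ae_le (hE : Admissible n p q α β)
    (hu : IsGrowthSubsolution p q α β O u G V a b) (z₀ : E n × ℝ) {ρ σ H k μ : ℝ}
    (hρ : 0 < ρ) (hσ : 0 < σ)
    (hSO : Metric.closedBall z₀.1 (2 * ρ) ×ˢ Ico (z₀.2 - 2 * σ) z₀.2 ⊆ O)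
    (hH : 2 ≤ H) (hρk : ρ ≤ k) (hkσ : k ^ 2 / σ ≤ H * (k / ρ) ^ scaleExp p q)
    {c : ℝ≥0∞} (hc0 : c ≠ 0) (hc : c ≠ ⊤) (hcw : c⁻¹.toReal ≤ H * (ρ ^ (n : ℝ) * σ))
    (hA : c * ∫⁻ z in cyl z₀ (2 * ρ) (2 * σ), ENNReal.ofReal (a z)⁻¹ ^ α ≤ ENNReal.ofReal H)
    (hB : c * ∫⁻ z in cyl z₀ (2 * ρ) (2 * σ), ENNReal.ofReal (b z) ^ β ≤ ENNReal.ofReal H)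
    (hg : (gnConst n (pExp p α)).toReal ≤ H) (hπH : 8 * scaleExp p q ≤ H)
    (hμ0 : 0 ≤ μ) (hμ : c * ∫⁻ z in cyl z₀ (2 * ρ) (2 * σ),
      ENNReal.ofReal (max (u z) 0) ^ mExp n p α = ENNReal.ofReal μ)
    (hμk : μ ≤ k ^ mExp n p α)
    (hcond : H ^ stepGrowthExp n p q α β *
        (2 ^ stepGrowthExp n p q α β) ^ (1 / iterExp n p q α β) *
        (k ^ (-mExp n p α) * ((ρ ^ (n : ℝ) * σ) ^ (pExp p α / n) *
          (k / ρ) ^ (scaleExp p q * (pExp p α / n + pExp p α / p)))) *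
            (μ / k ^ mExp n p α) ^ iterExp n p q α β ≤ 1) :
    ∀ᵐ z ∂(volume.restrict (cyl z₀ ρ σ)), u z ≤ k := by
  have hk : 0 < k := by linarith
  have hH0 : 0 < H := by linarith
  have hm := hE.two_le_mExp
  have hε := hE.iterExp_pos
  have hs := hE.stepGrowthExp_pos
  have hπ := hE.scaleExp_pos
  have hpp : pExp p α / p = α / (α + 1) := by
    have := hE.two_le_p
    rw [pExp]; field_simp
  rw [hpp] at hcond
  set m := mExp n p α with hmdef
  set ε := iterExp n p q α β
  set s := stepGrowthExp n p q α β
  -- The cylinders decrease from 2ρ, 2σ to ρ, σ while the levels k(1 - 2^(-j)) increase from 0 to k;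
  -- the normalization c stays that of the largest cylinder.
  set Z : ℕ → ℝ≥0∞ := fun j => c * ∫⁻ z in cyl z₀ (ρ * (1 + (1 / 2) ^ j)) (σ * (1 + (1 / 2) ^ j)),
    ENNReal.ofReal (max (u z - k * (1 - (1 / 2) ^ j)) 0) ^ m with hZ
  have hpow0 : ∀ j : ℕ, (0 : ℝ) < (1 / 2) ^ j := fun j => by positivity
  have hpow1 : ∀ j : ℕ, ((1 : ℝ) / 2) ^ j ≤ 1 := fun j => pow_le_one₀ (by norm_num) (by norm_num)
  have hcyl2 : ∀ j : ℕ, cyl z₀ (ρ * (1 + (1 / 2) ^ j)) (σ * (1 + (1 / 2) ^ j)) ⊆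
      cyl z₀ (2 * ρ) (2 * σ) := fun j =>
    cyl_subset_cyl z₀ (by nlinarith [hpow1 j]) (by nlinarith [hpow1 j])
  have hZ0 : Z 0 = ENNReal.ofReal μ := by
    rw [← hμ, hZ]
    simp only [pow_zero, sub_self, mul_zero, sub_zero, (by ring : ρ * (1 + 1) = 2 * ρ),
      (by ring : σ * (1 + 1) = 2 * σ)]
  have hZle : ∀ j, Z j ≤ ENNReal.ofReal μ := by
    intro j
    rw [← hμ]
    refine mul_le_mul_right ((lintegral_mono_set (hcyl2 j)).trans (lintegral_mono fun z => ?_)) _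
    have h1 : 0 ≤ k * (1 - (1 / 2) ^ j) := mul_nonneg hk.le (by linarith [hpow1 j])
    gcongr
    linarith
  have hZtop : ∀ j, Z j ≠ ⊤ := fun j => ne_top_of_le_ne_top ENNReal.ofReal_ne_top (hZle j)
  have hkm : 0 < k ^ m := by positivity
  set y : ℕ → ℝ := fun j => (Z j).toReal / k ^ m with hy
  have hy0 : ∀ j, 0 ≤ y j := fun j => by positivity
  -- The condition μ ≤ k^m gives this at j = 0, and Z_j ≤ Z_0 keeps it; the step needs δ ≤ 1.
  have hy1 : ∀ j, y j ≤ 1 := fun j => by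
    rw [hy, div_le_one hkm]
    refine le_trans ?_ hμk
    have := ENNReal.toReal_mono ENNReal.ofReal_ne_top (hZle j)
    rwa [ENNReal.toReal_ofReal hμ0] at this
  set K := k ^ (-m) * ((ρ ^ (n : ℝ) * σ) ^ (pExp p α / n) *
          (k / ρ) ^ (scaleExp p q * (pExp p α / n + α / (α + 1)))) with hK
  have hstep : ∀ j, y (j + 1) ≤ H ^ s * K * (2 ^ s) ^ j * y j ^ (1 + ε) := by
    intro j
    have hq0 := hpow0 j
    have hsucc : ((1 : ℝ) / 2) ^ (j + 1) = (1 / 2) ^ j / 2 := by ring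
    have h2j : (1 : ℝ) ≤ 2 ^ j := one_le_pow₀ (by norm_num)
    have hinv : ((1 : ℝ) / 2) ^ j = 1 / 2 ^ j := by rw [div_pow, one_pow]
    have hHΓ : H ≤ H * 2 ^ j := le_mul_of_one_le_right hH0.le h2j
    -- Consecutive radii, heights and levels differ by 2^(-j)/2 times ρ, σ, k. Used with x = 4π, 2π
    -- and 1, where π is `scaleExp p q`, this requires 8π ≤ H and 2 ≤ H.
    have hrel : ∀ {x d t : ℝ}, 0 < d → x * 2 ≤ H → t = d * (1 / 2) ^ j / 2 →
        x / t ≤ H * 2 ^ j / d := by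
      intro x d t hd hx ht
      rw [ht, hinv]
      have : x / (d * (1 / 2 ^ j) / 2) = x * 2 * 2 ^ j / d := by field_simp
      rw [this]
      gcongr
    have hst := hu.toReal_step_le hE z₀ (R₁ := ρ * (1 + (1 / 2) ^ (j + 1)))
      (R₂ := ρ * (1 + (1 / 2) ^ j)) (σ₁ := σ * (1 + (1 / 2) ^ (j + 1)))
      (σ₂ := σ * (1 + (1 / 2) ^ j)) (by positivity) (by rw [hsucc]; nlinarith) (by positivity)
      (by rw [hsucc]; nlinarith) ?_ (Γ := H * 2 ^ j) (ρ := ρ) (σ := σ) (k := k)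
      (l := k * (1 - (1 / 2) ^ j)) (l' := k * (1 - (1 / 2) ^ (j + 1))) (δ := y j)
      (w := ρ ^ (n : ℝ) * σ) (hH.trans hHΓ) hρ hρk hσ
      (hrel hρ (by linarith) (by rw [hsucc]; ring)) (hrel hσ (by linarith) (by rw [hsucc]; ring))
      (by rw [hsucc]; nlinarith) (hrel hk (by linarith) (by rw [hsucc]; ring))
      (hkσ.trans (by gcongr)) hc0 hc (by positivity) (hcw.trans (by gcongr))
      ((mul_le_mul_right (lintegral_mono_set (hcyl2 j)) _).trans
        (hA.trans (ENNReal.ofReal_le_ofReal hHΓ)))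
      ((mul_le_mul_right (lintegral_mono_set (hcyl2 j)) _).trans
        (hB.trans (ENNReal.ofReal_le_ofReal hHΓ)))
      (hg.trans hHΓ) (hZtop j) (by simp only [hy]; rw [mul_div_cancel₀ _ hkm.ne']) (hy0 j) (hy1 j)
    · have hΓs : (H * 2 ^ j) ^ s = H ^ s * (2 ^ s) ^ j := by
        rw [Real.mul_rpow hH0.le (by positivity), ← Real.rpow_natCast 2 j,
          ← Real.rpow_mul two_pos.le, mul_comm (j : ℝ) s, Real.rpow_mul two_pos.le,
          Real.rpow_natCast]
      rw [hΓs] at hst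
      calc y (j + 1) = k ^ (-m) * (Z (j + 1)).toReal := by
            rw [hy, Real.rpow_neg hk.le]; ring
        _ ≤ k ^ (-m) * (H ^ s * (2 ^ s) ^ j * ((ρ ^ (n : ℝ) * σ) ^ (pExp p α / n) *
              ((k / ρ) ^ (scaleExp p q * (pExp p α / n + α / (α + 1))) * y j ^ (1 + ε)))) := by
            gcongr
        _ = _ := by rw [hK]; ring
    · refine (Set.prod_mono (Metric.closedBall_subset_closedBall (by nlinarith [hpow1 j]))
        (Ico_subset_Ico (by nlinarith [hpow1 j]) le_rfl)).trans hSO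
  have hlim : Tendsto y atTop (𝓝 0) := by
    refine tendsto_zero_of_le_mul_rpow hy0 (Real.one_lt_rpow one_lt_two hs) hε (by positivity)
      hstep ?_
    have hy00 : y 0 = μ / k ^ m := by
      simp only [hy]; rw [hZ0, ENNReal.toReal_ofReal hμ0]
    rw [hy00, Real.rpow_neg (by positivity), ← one_div, le_div_iff₀ (by positivity)]
    refine le_of_eq_of_le ?_ hcond
    ring
  -- The limit cylinder lies in all the others and k lies above all levels, so this integral is at
  -- most every Z_j.
  have hzero : c * ∫⁻ z in cyl z₀ ρ σ, ENNReal.ofReal (max (u z - k) 0) ^ m ≤ 0 := by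
    have hZlim : Tendsto Z atTop (𝓝 0) := by
      have h1 : Tendsto (fun j => ENNReal.ofReal (k ^ m * y j)) atTop (𝓝 0) := by
        have := (ENNReal.continuous_ofReal.tendsto _).comp (hlim.const_mul (k ^ m))
        simpa [Function.comp_def] using this
      refine h1.congr fun j => ?_
      simp only [hy]
      rw [mul_div_cancel₀ _ hkm.ne', ENNReal.ofReal_toReal (hZtop j)]
    refine ge_of_tendsto' hZlim fun j => ?_
    refine mul_le_mul_right ((lintegral_mono_set (cyl_subset_cyl z₀
      (by nlinarith [hpow0 j]) (by nlinarith [hpow0 j]))).trans (lintegral_mono fun z => ?_)) _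
    gcongr
    nlinarith [hpow0 j]
  have hint : ∫⁻ z in cyl z₀ ρ σ, ENNReal.ofReal (max (u z - k) 0) ^ m = 0 :=
    (mul_eq_zero.1 (nonpos_iff_eq_zero.1 hzero)).resolve_left hc0
  have hum : AEMeasurable u (volume.restrict (cyl z₀ ρ σ)) :=
    hu.isSubsolutionOn.locallyIntegrable.aestronglyMeasurable.aemeasurable.restrict
  rw [lintegral_eq_zero_iff' (by fun_prop)] at hint
  filter_upwards [hint] with z hz
  have h1 : ENNReal.ofReal (max (u z - k) 0) = 0 := by
    have hm0 : 0 < m := by linarith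
    simpa [hm0, hm0.not_gt, hm0.ne'] using hz
  have h2 := ENNReal.ofReal_eq_zero.1 h1
  linarith [le_max_left (u z - k) 0]

end ParabolicPQ

/-! ### The scaling term and the structural constant -/

namespace ParabolicPQ

variable {n : ℕ}

theorem volume_cyl (z₀ : E n × ℝ) {ρ : ℝ} (hρ : 0 < ρ) {σ : ℝ} (hσ : 0 < σ) :
    (volume (cyl z₀ (2 * ρ) (2 * σ))).toReal =
      2 ^ (n + 1) * (volume (Metric.ball (0 : E n) 1)).toReal * (ρ ^ (n : ℝ) * σ) := by
  rw [cyl, Measure.volume_eq_prod, Measure.prod_prod, Measure.addHaar_ball_of_pos _ _ (by positivity),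
    Real.volume_Ioo, finrank_euclideanSpace_fin, ENNReal.toReal_mul, ENNReal.toReal_mul,
    ENNReal.toReal_ofReal (by positivity), ENNReal.toReal_ofReal (by linarith), Real.rpow_natCast]
  ring

theorem inv_mul_lintegral_ofReal {X : Type*} [MeasurableSpace X] {μ : Measure X} {s : Set X}
    (hs0 : μ s ≠ 0) (hs : μ s ≠ ⊤) {f : X → ℝ} (hint : IntegrableOn f s μ)
    (hf : 0 ≤ᵐ[μ.restrict s] f) :
    (μ s)⁻¹ * ∫⁻ x in s, ENNReal.ofReal (f x) ∂μ = ENNReal.ofReal (⨍ x in s, f x ∂μ) := by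
  have hpos : 0 < (μ s).toReal := ENNReal.toReal_pos hs0 hs
  rw [setAverage_eq, smul_eq_mul, Measure.real, ENNReal.ofReal_mul (by positivity),
    ENNReal.ofReal_inv_of_pos hpos, ENNReal.ofReal_toReal hs,
    ofReal_integral_eq_lintegral_ofReal hint hf]

/-- The scaling term is the threshold for k²/σ ≤ (k/ρ)^π. Since π - 2 = (p - 2 + 2(q-p))/(p+1-q),
the inequality reads k^(π-2) ≥ ρ^π/σ. For p = q = 2 both sides are quadratic in k: it holds for all
k when ρ² ≤ σ, and otherwise fails by the fixed factor ρ²/σ. -/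
theorem scaleTerm_cases {p q α β : ℝ} (hE : Admissible n p q α β) {ρ σ : ℝ} (hρ : 0 < ρ)
    (hσ : 0 < σ) :
    (∃ t : ℝ, scaleTerm p q ρ σ = (t : EReal) ∧ ∀ k, 0 < k → t ≤ k →
      k ^ 2 / σ ≤ (k / ρ) ^ scaleExp p q) ∨
    (scaleTerm p q ρ σ = ⊤ ∧ ∀ k, k ^ 2 / σ = ρ ^ 2 / σ * (k / ρ) ^ scaleExp p q) := by
  by_cases h : p = 2 ∧ q = 2
  · have hπ : scaleExp p q = 2 := by rw [scaleExp, h.1, h.2]; norm_num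
    have hid : ∀ k, k ^ 2 / σ = ρ ^ 2 / σ * (k / ρ) ^ scaleExp p q := by
      intro k
      rw [hπ, Real.rpow_two]; field_simp
    by_cases h1 : ρ ^ 2 ≤ σ
    · have hle : ∀ k, k ^ 2 / σ ≤ (k / ρ) ^ scaleExp p q := by
        intro k
        rw [hid]
        refine mul_le_of_le_one_left ?_ ((div_le_one hσ).2 h1)
        rw [hπ, Real.rpow_two]; positivity
      refine Or.inl ?_
      rcases h1.lt_or_eq with h2 | h2
      · exact ⟨0, by simp [scaleTerm, h, h2], fun k _ _ => hle k⟩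
      · exact ⟨1, by simp [scaleTerm, h, h2], fun k _ _ => hle k⟩
    · have h2 : ¬ ρ ^ 2 < σ := fun h' => h1 h'.le
      have h3 : ¬ ρ ^ 2 = σ := fun h' => h1 h'.le
      exact Or.inr ⟨by simp [scaleTerm, h, h2, h3], hid⟩
  · refine Or.inl ⟨_, by rw [scaleTerm, if_neg h], fun k hk hle => ?_⟩
    have hd := hE.gap_pos; have hp := hE.two_le_p; have hpq := hE.p_le_q
    have hnum : 0 < p - 2 + 2 * (q - p) := by
      rcases hp.lt_or_eq with h1 | h1
      · linarith
      · have : q ≠ 2 := fun h2 => h ⟨h1.symm, h2⟩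
        have : 2 < q := lt_of_le_of_ne (by linarith) (Ne.symm this)
        linarith
    set τ := (p - 2 + 2 * (q - p)) / (p + 1 - q) with hτ
    have hτ0 : 0 < τ := by positivity
    have hexp : (p + 1 - q) / (p - 2 + 2 * (q - p)) = 1 / τ := by rw [hτ, one_div_div]
    have hπ : scaleExp p q = 2 + τ := by rw [scaleExp, hτ]; field_simp; ring
    have h1 : ρ ^ scaleExp p q / σ ≤ k ^ τ := by
      have h2 := Real.rpow_le_rpow (by positivity) hle hτ0.le
      rwa [hexp, ← Real.rpow_mul (by positivity), one_div_mul_cancel hτ0.ne', Real.rpow_one] at h2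
    rw [Real.div_rpow hk.le hρ.le, div_le_div_iff₀ hσ (by positivity)]
    rw [div_le_iff₀ hσ] at h1
    calc k ^ 2 * ρ ^ scaleExp p q ≤ k ^ 2 * (k ^ τ * σ) := by gcongr
      _ = k ^ scaleExp p q * σ := by rw [hπ, Real.rpow_add hk, Real.rpow_two]; ring

/-- The structural constant. -/
noncomputable def structConst (n : ℕ) (p q α A B : ℝ) : ℝ :=
  max 2 (max A (max B (max (gnConst n (pExp p α)).toReal
    (max (8 * scaleExp p q) (2 ^ (n + 1) * (volume (Metric.ball (0 : E n) 1)).toReal)))))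

/-- The factor in the bound, in terms of the structural constant. -/
noncomputable def boundConst (n : ℕ) (p q α β θ H : ℝ) : ℝ :=
  (H ^ stepGrowthExp n p q α β *
    (2 ^ stepGrowthExp n p q α β) ^ (1 / iterExp n p q α β)) ^ (θ / iterExp n p q α β)

/-- Thus one factor in front of the maximum serves all four terms, although only the first one needs
it. -/
theorem Admissible.one_le_boundConst {p q α β θ H : ℝ} (hE : Admissible n p q α β) (hθ : 0 ≤ θ)
    (hH : 1 ≤ H) : 1 ≤ boundConst n p q α β θ H := by
  have hs := hE.stepGrowthExp_pos
  have hε := hE.iterExp_pos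
  refine Real.one_le_rpow (one_le_mul_of_one_le_of_one_le (Real.one_le_rpow hH hs.le)
    (Real.one_le_rpow (Real.one_le_rpow one_le_two hs.le) (by positivity))) (by positivity)

end ParabolicPQ

/-! ### Boundedness from above for weak subsolutions -/

namespace ParabolicPQ

variable {n : ℕ} {p q α β : ℝ}

theorem lintegral_rpow_eq {X : Type*} [MeasurableSpace X] {μ : Measure X} {f : X → ℝ}
    (hf : ∀ᵐ x ∂μ, 0 ≤ f x) {r : ℝ} (hr : 0 ≤ r) :
    ∫⁻ x, ENNReal.ofReal (f x) ^ r ∂μ = ∫⁻ x, ENNReal.ofReal (f x ^ r) ∂μ := by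
  refine lintegral_congr_ae ?_
  filter_upwards [hf] with x hx
  exact ENNReal.ofReal_rpow_of_nonneg hx hr

theorem integrable_rpow_of_memLp {X : Type*} [MeasurableSpace X] {μ : Measure X} {f : X → ℝ}
    (hf : ∀ᵐ x ∂μ, 0 ≤ f x) {r : ℝ} (hr : 0 < r) (h : MemLp f (ENNReal.ofReal r) μ) :
    Integrable (fun x => f x ^ r) μ := by
  have h1 := h.integrable_norm_rpow (by simpa using hr) ENNReal.ofReal_ne_top
  rw [ENNReal.toReal_ofReal hr.le] at h1
  refine h1.congr ?_
  filter_upwards [hf] with x hx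
  rw [Real.norm_of_nonneg hx]

/-- Integrability of `u_+^m` and boundedness from above for weak subsolutions. -/
theorem IsWeakSubsolution.integrableOn_and_essSupOn_le (hE : Admissible n p q α β)
    {Ω : Set (E n)} {T μ : ℝ} {a b : E n × ℝ → ℝ} {𝒜 : E n × ℝ → E n → E n} {u : E n × ℝ → ℝ}
    (hΩ : IsOpen Ω) (hΩb : Bornology.IsBounded Ω) (hμ : 0 ≤ μ) (hμ1 : μ ≤ 1)
    (hA : IsCaratheodory Ω T 𝒜) (hg : HasPQGrowth Ω T p q α β μ a b 𝒜)
    (hu : IsWeakSubsolution Ω T (qExp q β) 𝒜 u) {z₀ : E n × ℝ} {ρ σ : ℝ} (hρ : 0 < ρ) (hσ : 0 < σ)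
    (hsub : cyl z₀ (2 * ρ) (2 * σ) ⊆ spaceTime Ω T)
    (hsep : Metric.AreSeparated (cyl z₀ (2 * ρ) (2 * σ)) (parBoundary Ω T)) {θ : ℝ}
    (hθ : θ = 1 / (mExp n p α - levelExp n p q * pExp p α / iterExp n p q α β)) :
    IntegrableOn (fun z => max (u z) 0 ^ mExp n p α) (cyl z₀ (2 * ρ) (2 * σ)) ∧
      ∀ H k : ℝ, structConst n p q α (⨍ z in cyl z₀ (2 * ρ) (2 * σ), a z ^ (-α))
          (⨍ z in cyl z₀ (2 * ρ) (2 * σ), b z ^ β) ≤ H → ρ ≤ k →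
        k ^ 2 / σ ≤ H * (k / ρ) ^ scaleExp p q →
        meanPos (cyl z₀ (2 * ρ) (2 * σ)) (mExp n p α) u ^ (1 / mExp n p α) ≤ k →
        boundConst n p q α β θ H *
          ((σ / ρ ^ (p / (p + 1 - q))) ^ (pExp p α * θ / (n * iterExp n p q α β)) *
            (1 / ρ ^ ((q - p) * (pExp p α * θ / ((p + 1 - q) * iterExp n p q α β)))) *
              meanPos (cyl z₀ (2 * ρ) (2 * σ)) (mExp n p α) u ^ θ) ≤ k →
        essSupOn (cyl z₀ ρ σ) u ≤ (k : EReal) := by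
  have hp := hE.two_le_p
  have hα := hE.one_lt_α
  have hβ := hE.one_lt_β
  have hm := hE.two_le_mExp
  set Q := cyl z₀ (2 * ρ) (2 * σ) with hQ
  have hQm : MeasurableSet Q := measurableSet_cyl _ _ _
  obtain ⟨ρ', σ', hρ', hσ', hSO⟩ := exists_cyl_subset_spaceTime hΩ (by positivity) (by positivity)
    hsub hsep
  have hr' := Real.HolderConjugate.conjExponent
    (show 1 < qExp q β by linarith [hE.two_le_qExp])
  obtain ⟨G, V, hsol, hui, hGi, hVi, hVG, hae⟩ :=
    hu.exists_isSubsolutionOn hp hE.p_le_q hβ hΩ hΩb hμ hμ1 hA hg hr'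
  set v := (spaceTime Ω T).indicator u with hv
  have hvu : ∀ z ∈ spaceTime Ω T, v z = u z := fun z hz => indicator_of_mem hz u
  have hgs : IsGrowthSubsolution p q α β (spaceTime Ω T) v G V a b :=
    { isOpen := isOpen_spaceTime hΩ T
      isSubsolutionOn := hsol
      integrable := hui
      integrable_grad := hGi
      integrable_flux := hVi
      inner_nonneg := hVG
      coercive := hae.mono fun _ h => h.1
      growth := hae.mono fun _ h => h.2
      a_pos := hg.a_pos
      b_nonneg := hg.b_nonneg
      aemeasurable_a := hg.memLp_a_inv.1.aemeasurable
      aemeasurable_b := hg.memLp_b.1.aemeasurable }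
  have hQ0 : volume Q ≠ 0 := (volume_cyl_pos z₀ (by positivity) (by positivity)).ne'
  have hQtop : volume Q ≠ ⊤ := volume_cyl_ne_top _ _ _
  have hfin := hsol.lintegral_posPart_ne_top hE.two_le_dim hgs.isOpen hE.two_le_qExp hr' hui hGi hVi
    hVG hE.one_lt_pExp hE.pExp_le_qExp z₀ (by positivity) hρ' (by positivity) hσ' hSO
  have hfin' : ∫⁻ z in Q, ENNReal.ofReal (max (v z) 0) ^ mExp n p α =
      ∫⁻ z in Q, ENNReal.ofReal (max (u z) 0 ^ mExp n p α) := by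
    rw [← lintegral_rpow_eq (ae_of_all _ fun z => le_max_right _ _) (by linarith)]
    exact setLIntegral_congr_fun hQm fun z hz => by simp only [hvu z (hsub hz)]
  have hint : IntegrableOn (fun z => max (u z) 0 ^ mExp n p α) Q := by
    have hum : AEMeasurable u (volume.restrict Q) := by
      have h1 : AEMeasurable v (volume.restrict Q) :=
        hsol.locallyIntegrable.aestronglyMeasurable.aemeasurable.restrict
      refine h1.congr ?_
      filter_upwards [ae_restrict_mem hQm] with z hz using hvu z (hsub hz)
    rw [IntegrableOn, ← lintegral_ofReal_ne_top_iff_integrable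
      ((hum.max aemeasurable_const).pow_const _).aestronglyMeasurable
      (ae_of_all _ fun z => Real.rpow_nonneg (le_max_right _ _) _), ← hfin']
    exact hfin
  refine ⟨hint, fun H k hH hρk hkσ hk2 hk1 => ?_⟩
  have hQle : volume.restrict Q ≤ volume.restrict (spaceTime Ω T) :=
    Measure.restrict_mono hsub le_rfl
  have hapos : ∀ᵐ z ∂(volume.restrict Q), 0 < a z := hQle.absolutelyContinuous.ae_le hg.a_pos
  have hbpos : ∀ᵐ z ∂(volume.restrict Q), 0 ≤ b z := hQle.absolutelyContinuous.ae_le hg.b_nonneg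
  -- The identity for real powers uses a > 0, which holds almost everywhere on Q.
  have hainv : (fun z => (a z)⁻¹ ^ α) =ᵐ[volume.restrict Q] fun z => a z ^ (-α) := by
    filter_upwards [hapos] with z hz
    rw [Real.rpow_neg hz.le, Real.inv_rpow hz.le]
  have haint : IntegrableOn (fun z => a z ^ (-α)) Q := by
    refine Integrable.congr ?_ hainv
    exact integrable_rpow_of_memLp (hapos.mono fun z hz => by positivity) (by linarith)
      (hg.memLp_a_inv.mono_measure hQle)
  have hbint : IntegrableOn (fun z => b z ^ β) Q :=
    integrable_rpow_of_memLp hbpos (by linarith) (hg.memLp_b.mono_measure hQle)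
  have hAeq : (volume Q)⁻¹ * ∫⁻ z in Q, ENNReal.ofReal (a z)⁻¹ ^ α =
      ENNReal.ofReal (⨍ z in Q, a z ^ (-α)) := by
    rw [← inv_mul_lintegral_ofReal hQ0 hQtop haint
      (hapos.mono fun z hz => Real.rpow_nonneg hz.le _),
      lintegral_rpow_eq (hapos.mono fun z hz => by positivity) (by linarith)]
    congr 1
    exact lintegral_congr_ae (hainv.mono fun z hz => by simp only [hz])
  have hBeq : (volume Q)⁻¹ * ∫⁻ z in Q, ENNReal.ofReal (b z) ^ β =
      ENNReal.ofReal (⨍ z in Q, b z ^ β) := by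
    rw [← inv_mul_lintegral_ofReal hQ0 hQtop hbint
      (hbpos.mono fun z hz => Real.rpow_nonneg hz _), lintegral_rpow_eq hbpos (by linarith)]
  have hUeq : (volume Q)⁻¹ * ∫⁻ z in Q, ENNReal.ofReal (max (v z) 0) ^ mExp n p α =
      ENNReal.ofReal (meanPos Q (mExp n p α) u) := by
    rw [hfin', meanPos]
    exact inv_mul_lintegral_ofReal hQ0 hQtop hint
      (ae_of_all _ fun z => Real.rpow_nonneg (le_max_right _ _) _)
  have hmean0 : 0 ≤ meanPos Q (mExp n p α) u := by
    rw [meanPos, setAverage_eq, smul_eq_mul]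
    exact mul_nonneg (by positivity) (integral_nonneg fun z => Real.rpow_nonneg (le_max_right _ _) _)
  simp only [structConst, max_le_iff] at hH
  obtain ⟨hH2, hHA, hHB, hHg, hHπ, hHv⟩ := hH
  have hk : 0 < k := by linarith
  have hkm : meanPos Q (mExp n p α) u ≤ k ^ mExp n p α := by
    have := Real.rpow_le_rpow (by positivity) hk2 (by linarith : 0 ≤ mExp n p α)
    rwa [← Real.rpow_mul hmean0, one_div_mul_cancel (by linarith), Real.rpow_one] at this
  have hle := hgs.ae_le hE z₀ (H := H) (k := k) (c := (volume Q)⁻¹) hρ hσ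
    ((Set.prod_mono (Metric.closedBall_subset_closedBall hρ'.le)
      (Ico_subset_Ico (by linarith) le_rfl)).trans hSO) hH2 hρk hkσ
    (ENNReal.inv_ne_zero.2 hQtop) (ENNReal.inv_ne_top.2 hQ0)
    (by rw [inv_inv, hQ, volume_cyl z₀ hρ hσ]; gcongr)
    (hAeq.trans_le (ENNReal.ofReal_le_ofReal hHA)) (hBeq.trans_le (ENNReal.ofReal_le_ofReal hHB))
    hHg hHπ hmean0 hUeq hkm
    (hE.iteration_condition hθ (by positivity) hk hρ hσ hmean0 hk1)
  refine essSup_le_of_ae_le _ ?_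
  filter_upwards [hle, ae_restrict_mem (measurableSet_cyl z₀ ρ σ)] with z hz hzm
  rw [hvu z (hsub (cyl_subset_cyl z₀ (by linarith) (by linarith) hzm))] at hz
  exact_mod_cast hz

end ParabolicPQ

/-! ### The theorem -/

open ParabolicPQ in
theorem theorem1p2 (n : ℕ) (hn : 2 ≤ n) (p q α β : ℝ) (hp : 2 ≤ p) (hpq : p ≤ q)
    (hα : 1 < α) (hβ : 1 < β)
    (hgap : q < p * (α / (α + 1)) * ((β - 1) / β) + 2 / ((n : ℝ) + 2)) :
    ∃ θ₁ θ₂ θ₃ : ℝ, 0 < θ₁ ∧ 0 < θ₂ ∧ 0 < θ₃ ∧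
      ∃ C : ℝ → ℝ → ℝ, (∀ A B, 0 < C A B) ∧
        ∀ (Ω : Set (E n)) (T μ : ℝ) (a b : E n × ℝ → ℝ) (𝒜 : E n × ℝ → E n → E n)
          (u : E n × ℝ → ℝ),
          IsOpen Ω → Bornology.IsBounded Ω → 0 < T → 0 ≤ μ → μ ≤ 1 →
          IsCaratheodory Ω T 𝒜 → HasPQGrowth Ω T p q α β μ a b 𝒜 →
          IsWeakSubsolution Ω T (qExp q β) 𝒜 u →
          ∀ (z₀ : E n × ℝ) (ρ σ : ℝ), 0 < ρ → 0 < σ →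
            cyl z₀ (2 * ρ) (2 * σ) ⊆ spaceTime Ω T →
            Metric.AreSeparated (cyl z₀ (2 * ρ) (2 * σ)) (parBoundary Ω T) →
            IntegrableOn (fun z => max (u z) 0 ^ mExp n p α) (cyl z₀ (2 * ρ) (2 * σ)) ∧
            essSupOn (cyl z₀ ρ σ) u < ⊤ ∧
            essSupOn (cyl z₀ ρ σ) u ≤
              (C (⨍ z in cyl z₀ (2 * ρ) (2 * σ), a z ^ (-α))
                  (⨍ z in cyl z₀ (2 * ρ) (2 * σ), b z ^ β) : EReal) *
              max (max
                (((σ / ρ ^ (p / (p + 1 - q))) ^ θ₁ * (1 / ρ ^ ((q - p) * θ₂)) *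
                  meanPos (cyl z₀ (2 * ρ) (2 * σ)) (mExp n p α) u ^ θ₃ : ℝ) : EReal)
                ((meanPos (cyl z₀ (2 * ρ) (2 * σ)) (mExp n p α) u ^ (1 / mExp n p α) : ℝ) : EReal))
                (max (scaleTerm p q ρ σ) (ρ : EReal)) := by
  have hE : Admissible n p q α β := ⟨hn, hp, hpq, hα, hβ, hgap⟩
  have hε := hE.iterExp_pos
  have hP := hE.pExp_pos
  have hd := hE.gap_pos
  have hn0 := hE.dim_pos
  obtain ⟨θ, hθ⟩ : ∃ θ, θ = 1 / (mExp n p α - levelExp n p q * pExp p α / iterExp n p q α β) :=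
    ⟨_, rfl⟩
  have hθ0 : 0 < θ := by rw [hθ]; exact one_div_pos.2 hE.mExp_sub_pos
  have hC : ∀ A B, 1 ≤ boundConst n p q α β θ (structConst n p q α A B) := fun A B =>
    hE.one_le_boundConst hθ0.le (one_le_two.trans (le_max_left _ _))
  -- The exponents are those that appear when the smallness condition is solved for k; see
  -- `Admissible.iteration_condition`.
  refine ⟨pExp p α * θ / (n * iterExp n p q α β),
    pExp p α * θ / ((p + 1 - q) * iterExp n p q α β), θ, by positivity, by positivity, hθ0,
    fun A B => boundConst n p q α β θ (structConst n p q α A B),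
    fun A B => one_pos.trans_le (hC A B), ?_⟩
  intro Ω T μ a b 𝒜 u hΩ hΩb _ hμ hμ1 hA hg hu z₀ ρ σ hρ hσ hsub hsep
  obtain ⟨hint, hbound⟩ := hu.integrableOn_and_essSupOn_le hE hΩ hΩb hμ hμ1 hA hg hρ hσ hsub hsep hθ
  refine ⟨hint, ?_⟩
  set M := meanPos (cyl z₀ (2 * ρ) (2 * σ)) (mExp n p α) u
  set H := structConst n p q α (⨍ z in cyl z₀ (2 * ρ) (2 * σ), a z ^ (-α))
    (⨍ z in cyl z₀ (2 * ρ) (2 * σ), b z ^ β) with hH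
  have hH2 : 2 ≤ H := le_max_left _ _
  have hCH : 1 ≤ boundConst n p q α β θ H := hC _ _
  set T₁ := (σ / ρ ^ (p / (p + 1 - q))) ^ (pExp p α * θ / (n * iterExp n p q α β)) *
    (1 / ρ ^ ((q - p) * (pExp p α * θ / ((p + 1 - q) * iterExp n p q α β)))) * M ^ θ
  rcases scaleTerm_cases hE hρ hσ with ⟨t, ht, htk⟩ | ⟨ht, htk⟩
  -- Here the level is k = C·X, with X the whole maximum. As C ≥ 1 it passes the thresholds M^(1/m),
  -- t and ρ, and the factor C itself handles T₁.
  · set X := max (max T₁ (M ^ (1 / mExp n p α))) (max t ρ) with hX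
    have hρX : ρ ≤ X := (le_max_right _ _).trans (le_max_right _ _)
    have hX0 : 0 < X := hρ.trans_le hρX
    have hXk : X ≤ boundConst n p q α β θ H * X := le_mul_of_one_le_left hX0.le hCH
    have hle := hbound H (boundConst n p q α β θ H * X) le_rfl (hρX.trans hXk) ?_
      (((le_max_right _ _).trans (le_max_left _ _)).trans hXk)
      (mul_le_mul_of_nonneg_left ((le_max_left _ _).trans (le_max_left _ _)) (by linarith))
    · refine ⟨hle.trans_lt (EReal.coe_lt_top _), hle.trans (le_of_eq ?_)⟩
      have hmono := EReal.coe_strictMono.monotone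
      rw [ht, EReal.coe_mul, hX, hmono.map_max, hmono.map_max, hmono.map_max]
    · have hk0 : 0 < boundConst n p q α β θ H * X := by positivity
      refine (htk _ hk0 (((le_max_left _ _).trans (le_max_right _ _)).trans hXk)).trans ?_
      exact le_mul_of_one_le_left (by positivity) (by linarith)
  · constructor
    -- For p = q = 2 and ρ² > σ the asserted bound is infinite, but finiteness of the supremum still
    -- has to be shown. Enlarging the structural constant by ρ²/σ makes the iteration run at some
    -- finite level.
    · set H' := max H (ρ ^ 2 / σ)
      set k := max ρ (max (M ^ (1 / mExp n p α)) (boundConst n p q α β θ H' * T₁)) with hk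
      have hk0 : 0 < k := hρ.trans_le (le_max_left _ _)
      refine (hbound H' k (le_max_left _ _) (le_max_left _ _) ?_
        ((le_max_left _ _).trans (le_max_right _ _))
        ((le_max_right _ _).trans (le_max_right _ _))).trans_lt (EReal.coe_lt_top _)
      rw [htk]
      gcongr
      exact le_max_right _ _
    · rw [ht, max_eq_left le_top, max_eq_right le_top,
        EReal.coe_mul_top_of_pos (one_pos.trans_le hCH)]
      exact le_top
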